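/- A \emph{3-colored complex} is a finite simplicial complex $\Delta$ whose vertices are colored with $1,2,3$ so that no face has two vertices of one color; $f_S(\Delta)$ is the number of faces with color set $S$ (we write $f_{12}$ for $f_{\{1,2\}}$, etc.). Fix positive integers $f_1,f_2,f_3,f_{12},f_{13},f_{23}$. \textbf{Structured complexes.} Let $g_1,g_2,g_3\ge 1$ be integers with $g_i\le f_i$ and $g_ig_j\le f_{ij}$ for $i\ne j$, and let $p\ne q$ be colors; let $r$ be the third color. The complex $\Gamma(g;p,q)$ has $g_i$ core vertices of each color $i$, any two of different colors being adjacent. If $g_p<f_p$, add a vertex of color $p$ and make it adjacent to as many vertices of each other color as possible, earliest first, keeping the number of edges of each color pair $\{i,j\}$ at most $f_{ij}$. Then, if $g_q<f_q$, add a vertex of color $q$ and do the same. The faces are all sets of pairwise adjacent vertices. If the above inequalities fail, $\Gamma(g;p,q)$ is called undefined. Let $m$ be the maximum of $f_{123}(\Gamma(g;p,q))$ over all well-defined $\Gamma(g;p,q)$. \textbf{Notation.} For $\{i,j,k\}=\{1,2,3\}$ put $b_i=\lfloor\sqrt{f_{ij}f_{ik}/f_{jk}}\rfloor$, and for $t>0$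 put $v(t)=b_1f_{23}+(f_{12}-b_1t)\left(f_{13}-\frac{b_1f_{23}}{t}\right)$. For a color $r$ and an integer $h\ge1$ let $i<j$ be the other two colors and let $K(r,h)=\Gamma(g;p,q)$, where $g_r=h$; $g_i=f_{ir}/h-1$ if $h\mid f_{ir}$ and $\frac{f_{ir}}h\lceil\frac{f_{jr}}h-1\rceil>f_{ij}$, and $g_i=\lfloor f_{ir}/h\rfloor$ otherwise; $g_j=f_{jr}/h-1$ if $h\mid f_{jr}$ and $\frac{f_{jr}}h g_i>f_{ij}$, and $g_j=\lfloor f_{jr}/h\rfloor$ otherwise; $(p,q)=(i,j)$ if $f_{ir}-g_ih\ge f_{jr}-g_jh$, and $(p,q)=(j,i)$ otherwise. \textbf{Procedure.} To \emph{try} $K(r,h)$ means to compute its number of facets $f_{123}$ if it is well-defined. \begin{enumerate} \item If $f_{ij}>f_if_j$ for some $i\neq j$, report that there is no complex and stop. \item If $\lfloor f_{ij}/f_i\rfloor\lfloor f_{ik}/f_i\rfloor\ge f_{jk}$ for some $\{i,j,k\}=\{1,2,3\}$, return $f_if_{jk}$ and stop. \item Relabel the colors so that $f_{12}\le f_{13}\le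 f_{23}$ (in any way that achieves this). \item Compute $b_1,b_2,b_3$. If $b_1=0$, return $f_{12}f_{13}$ and stop. \item Try $K(1,b_1)$ and $K(2,b_2)$. \item If $\lceil f_{23}/(b_3+1)\rceil\le\lfloor f_{23}/b_3\rfloor$, try $K(2,h)$ for $h$ equal to each of these two numbers. \item If $\lceil f_{13}/(b_3+1)\rceil\le\lfloor f_{13}/b_3\rfloor$, try $K(1,h)$ for $h$ equal to each of these two numbers. \item If $\lceil f_{12}/(b_2+1)\rceil\le\lfloor f_{12}/b_2\rfloor$, try $K(1,h)$ for $h$ equal to each of these two numbers. \item Try $K(3,f_3)$. \item Determine the range $[\ell,u]$ of $g_2$. If $f_1<b_1$, it is empty. If $f_1=b_1$, it is $\{f_{12}/f_1\}$ if this is an integer, and empty otherwise. If $f_1>b_1$, it is empty if $f_{13}>f_3(b_1+1)$; otherwise it consists of the integers that are at least $\frac{f_{12}}{f_1}$, $\frac{f_{12}}{b_1+1}$, $\frac{f_{23}}{\lfloor f_{13}/b_1\rfloor+1}$, $\frac{f_{23}}{f_3}$ and at most $\frac{f_{12}}{b_1}$, $f_2$, $\frac{f_{23}}{\lceil f_{13}/(b_1+1)\rceil-1}$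 (the last bound is void if its denominator is $0$). \item If $\ell\le b_2\le u$, try $K(2,t)$ for $t=b_2,b_2-1,\dots$, stopping as soon as $t<\ell$, or $K(2,t)$ is undefined, or, after a number of facets has been computed, $v(t-1)$ is at most the largest number of facets found so far. Then try $K(2,t)$ for $t=b_2+1,b_2+2,\dots$, stopping as soon as $t>u$, or $K(2,t)$ is undefined, or, after a number of facets has been computed, $v(t+1)$ is at most the largest number of facets found so far. \item If the range is non-empty and $\ell>b_2$, try $K(2,t)$ for $t=\ell,\ell+1,\dots$ with the same rule for stopping as for increasing $t$ in step 11. \item If the range is non-empty and $u<b_2$, try $K(2,t)$ for $t=u,u-1,\dots$ with the same rule for stopping as for decreasing $t$ in step 11. \item Return the largest number of facets found. \end{enumerate} \textbf{Theorem.} The procedure reports that there is no complex exactly if one of $f_{12}\le f_1f_2$, $f_{13}\le f_1f_3$, $f_{23}\le f_2f_3$ fails, and then there is no 3-colored complex with these numbers of vertices and edges. Otherwise it returns $m$, and $m$ is the largest possible number of facets $f_{123}(\Delta)$ of a 3-colored complex $\Delta$ with these numbers of vertices and edges; moreover a 3-colored complex with these numbers of vertices and edges and with $f_{123}=k$ exists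 if and only if $0\le k\le m$. In every case the procedure computes the number of facets of fewer than $$15+2\sqrt2\,\frac{\sqrt{f_{12}f_{23}}}{f_{13}}$$ complexes, where the colors are labeled such that $f_{12}\le f_{13}\le f_{23}$. -/

import Mathlib

/-- An `n`-colored simplicial complex on the vertex type `V`: an abstract simplicial complex (every
vertex is a face; faces are listed without the empty one) with a color for each vertex, such that no
two vertices in a common face have the same color. -/
structure ColoredComplex (n : ℕ) (V : Type*) extends AbstractSimplicialComplex V where
  color : V → Fin n
  injOn_color : ∀ s ∈ faces, Set.InjOn color (s : Set V)

/-- The flag f-number `f_S`: the number of faces whose color set is `S` (for nonempty `S`). -/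
noncomputable def ColoredComplex.flagNumber {n : ℕ} {V : Type*} (Δ : ColoredComplex n V)
    (S : Finset (Fin n)) : ℕ :=
  {s : Finset V | s ∈ Δ.faces ∧ s.image Δ.color = S}.ncard

/-- There is a finite 3-colored complex with the given flag f-numbers; the colors 1, 2, 3 are
represented by `0, 1, 2 : Fin 3`. -/
def IsFlagVector (f₁ f₂ f₃ f₁₂ f₁₃ f₂₃ f₁₂₃ : ℕ) : Prop :=
  ∃ (V : Type) (_ : Finite V) (Δ : ColoredComplex 3 V),
    Δ.flagNumber {0} = f₁ ∧ Δ.flagNumber {1} = f₂ ∧ Δ.flagNumber {2} = f₃ ∧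
    Δ.flagNumber {0, 1} = f₁₂ ∧ Δ.flagNumber {0, 2} = f₁₃ ∧ Δ.flagNumber {1, 2} = f₂₃ ∧
    Δ.flagNumber {0, 1, 2} = f₁₂₃

/-- The third color: for `i ≠ j`, the set `{i, j, third i j}` consists of all three colors. -/
def third (i j : Fin 3) : Fin 3 := -(i + j)

/-- Prescribed numbers of vertices and edges of a 3-colored complex: `vert i` is the number of
vertices of color `i`, and `opp k` is the number of edges whose two colors are those
different from `k`. -/
structure EdgeData where
  vert : Fin 3 → ℕ
  opp : Fin 3 → ℕ

namespace EdgeData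

/-- The prescribed number of edges with color set `{i, j}`, for `i ≠ j`. -/
def edge (d : EdgeData) (i j : Fin 3) : ℕ := d.opp (third i j)

/-- Relabeling of the colors: the new color `i` is the old color `σ i`. -/
def relabel (d : EdgeData) (σ : Equiv.Perm (Fin 3)) : EdgeData where
  vert i := d.vert (σ i)
  opp i := d.opp (σ i)

/-- `f₁₂ ≤ f₁₃ ≤ f₂₃`. -/
def IsSorted (d : EdgeData) : Prop := d.edge 0 1 ≤ d.edge 0 2 ∧ d.edge 0 2 ≤ d.edge 1 2

/-- The colors can always be relabeled so that the numbers of edges are sorted. -/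
theorem exists_relabel_isSorted (d : EdgeData) : ∃ σ, (d.relabel σ).IsSorted := by
  have h := Tuple.monotone_sort d.opp
  refine ⟨Fin.revPerm.trans (Tuple.sort d.opp), h (a := 0) (b := 1) (by decide),
    h (a := 1) (b := 2) (by decide)⟩

end EdgeData

/-- The parameters of a structured complex: the numbers `g₁, g₂, g₃` of core vertices,
the color `p` of the first and the color `q` of the second extra vertex. -/
structure Params where
  g : Fin 3 → ℕ
  p : Fin 3
  q : Fin 3

namespace Params

/-- The color without an extra vertex. -/
def r (P : Params) : Fin 3 := third P.p P.q

/-- There are enough vertices and edges for the core of the structured complex. -/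
def WellDefined (d : EdgeData) (P : Params) : Prop :=
  P.p ≠ P.q ∧ (∀ i, 1 ≤ P.g i ∧ P.g i ≤ d.vert i) ∧
    ∀ i j, i ≠ j → P.g i * P.g j ≤ d.edge i j

instance (d : EdgeData) (P : Params) : Decidable (P.WellDefined d) := by
  unfold WellDefined; infer_instance

/-- The number of vertices of color `i`: the `g i` core vertices, and an extra one if `i` is `p` or
`q` and a further vertex of color `i` is available. -/
def numVert (d : EdgeData) (P : Params) (i : Fin 3) : ℕ :=
  if (i = P.p ∨ i = P.q) ∧ P.g i < d.vert i then P.g i + 1 else P.g i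

/-- The number of vertices of color `j ≠ p` to which the first extra vertex (of color `p`) is
adjacent: as many core vertices as the edges left over by the core allow
(`0` if there is no such extra vertex). -/
def firstDeg (d : EdgeData) (P : Params) (j : Fin 3) : ℕ :=
  if P.g P.p < d.vert P.p then min (P.g j) (d.edge P.p j - P.g P.p * P.g j) else 0

/-- The number of vertices of color `j ≠ q` to which the second extra vertex (of color `q`) is
adjacent: as many as possible, the vertices of color `j` now including the first extra vertex if
`j = p`, with the edges left over by the core and the first extra vertex. -/
def secondDeg (d : EdgeData) (P : Params) (j : Fin 3) : ℕ :=
  if j = P.p then min (P.numVert d j) (d.edge P.q j - P.g P.q * P.g j - P.firstDeg d P.q)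
  else min (P.g j) (d.edge P.q j - P.g P.q * P.g j)

/-- The vertices of the structured complex; those of color `i` are `⟨i, 0⟩, ⟨i, 1⟩, …`, and the
extra vertex, if any, is the last one of its color. -/
abbrev Vertex (d : EdgeData) (P : Params) : Type := Σ i : Fin 3, Fin (P.numVert d i)

/-- `u` is an extra vertex and `v` is among the vertices to which `u` was joined when it was
added (the earliest ones of their color). -/
def Joins (d : EdgeData) (P : Params) (u v : P.Vertex d) : Prop :=
  (u.1 = P.p ∧ (u.2 : ℕ) = P.g u.1 ∧ (v.2 : ℕ) < P.firstDeg d v.1) ∨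
  (u.1 = P.q ∧ (u.2 : ℕ) = P.g u.1 ∧ (v.2 : ℕ) < P.secondDeg d v.1)

/-- Adjacency in the structured complex. -/
def Adj (d : EdgeData) (P : Params) (u v : P.Vertex d) : Prop :=
  u.1 ≠ v.1 ∧ (((u.2 : ℕ) < P.g u.1 ∧ (v.2 : ℕ) < P.g v.1) ∨ P.Joins d u v ∨ P.Joins d v u)

/-- The structured complex with the given parameters: its faces are all the nonempty sets of
pairwise adjacent vertices. -/
def complex (d : EdgeData) (P : Params) : ColoredComplex 3 (P.Vertex d) where
  faces := {s | s.Nonempty ∧ ∀ u ∈ s, ∀ v ∈ s, u ≠ v → P.Adj d u v}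
  isRelLowerSet_faces := fun _ hs =>
    ⟨hs.1, fun _ hts ht => ⟨ht, fun u hu v hv => hs.2 u (hts hu) v (hts hv)⟩⟩
  singleton_mem := fun v => ⟨Finset.singleton_nonempty v, fun u hu w hw h => by
    rw [Finset.mem_singleton] at hu hw
    exact absurd (hu.trans hw.symm) h⟩
  color := Sigma.fst
  injOn_color := fun _ hs u hu v hv huv => by
    by_contra h
    exact (hs.2 u hu v hv h).1 huv

/-- The number of facets `f₁₂₃` of the structured complex. -/
noncomputable def facets (d : EdgeData) (P : Params) : ℕ :=
  (P.complex d).flagNumber {0, 1, 2}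

end Params

/-- The numbers of facets of all structured complexes for the given numbers of vertices and edges;
`m(Δ)` is the maximum of this set. -/
def structuredFacetNumbers (d : EdgeData) : Set ℕ :=
  {k | ∃ P : Params, P.WellDefined d ∧ P.facets d = k}

namespace EdgeData

/-- `f_{ij} ≤ f_i f_j` for all colors `i ≠ j`. -/
def TrivialInequalities (d : EdgeData) : Prop :=
  ∀ i j, i ≠ j → d.edge i j ≤ d.vert i * d.vert j

instance (d : EdgeData) : Decidable d.TrivialInequalities := by
  unfold TrivialInequalities; infer_instance

/-- `⌊f_{ij} / f_i⌋ ⌊f_{ik} / f_i⌋ ≥ f_{jk}`, where `j` and `k` are the two colors other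
than `i`. -/
def VertexTest (d : EdgeData) (i : Fin 3) : Prop :=
  d.edge (i + 1) (i + 2) ≤ (d.edge i (i + 1) / d.vert i) * (d.edge i (i + 2) / d.vert i)

instance (d : EdgeData) (i : Fin 3) : Decidable (d.VertexTest i) := by
  unfold VertexTest; infer_instance

/-- `b_i = ⌊√(f_{ij} f_{ik} / f_{jk})⌋`, where `j` and `k` are the two colors other than `i`. -/
def b (d : EdgeData) (i : Fin 3) : ℕ :=
  Nat.sqrt (d.edge i (i + 1) * d.edge i (i + 2) / d.edge (i + 1) (i + 2))

theorem b_eq_floor_sqrt (d : EdgeData) (i : Fin 3) :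
    d.b i = ⌊√((d.edge i (i + 1) * d.edge i (i + 2) : ℝ) / d.edge (i + 1) (i + 2))⌋₊ := by
  rw [← Nat.cast_mul, b, ← Nat.floor_div_eq_div (K := ℝ)]
  set x : ℝ := ((d.edge i (i + 1) * d.edge i (i + 2) : ℕ) : ℝ) / d.edge (i + 1) (i + 2)
  have hx : 0 ≤ x := by positivity
  refine eq_of_forall_le_iff fun c => ?_
  rw [Nat.le_sqrt', Nat.le_floor_iff hx, Nat.le_floor_iff (Real.sqrt_nonneg x),
    Real.le_sqrt (Nat.cast_nonneg c) hx, Nat.cast_pow]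

/-- For `r = 1, 2, 3` (that is, `0, 1, 2`), the smaller of the other two colors. -/
def other₁ (r : Fin 3) : Fin 3 := if r = 0 then 1 else 0

/-- For `r = 1, 2, 3` (that is, `0, 1, 2`), the larger of the other two colors. -/
def other₂ (r : Fin 3) : Fin 3 := if r = 2 then 1 else 2

/-- With `i` and `j` the two other colors, the number of core vertices of color `i` used when the
color `r` without an extra vertex and the number `h` of its vertices are known:
`⌊f_{ir} / h⌋` if `f_{ir} / h` is not an integer, and otherwise `f_{ir} / h - 1` or `f_{ir} / h`
according to whether `(f_{ir} / h) ⌈f_{jr} / h - 1⌉ > f_{ij}` or not. -/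
def known₁ (d : EdgeData) (r : Fin 3) (h : ℕ) : ℕ :=
  let i := other₁ r
  let j := other₂ r
  if h ∣ d.edge i r ∧ d.edge i j < d.edge i r / h * (d.edge j r ⌈/⌉ h - 1) then
    d.edge i r / h - 1
  else d.edge i r / h

/-- With `i` and `j` the two other colors, the number of core vertices of color `j`, given that there
are `known₁` core vertices of color `i`. -/
def known₂ (d : EdgeData) (r : Fin 3) (h : ℕ) : ℕ :=
  let i := other₁ r
  let j := other₂ r
  if h ∣ d.edge j r ∧ d.edge i j < d.edge j r / h * d.known₁ r h then
    d.edge j r / h - 1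
  else d.edge j r / h

/-- The candidate for which `r` is the color without an extra vertex and `h` is the number of core
vertices of color `r`. Of the two other colors `i`, `j`, the first extra vertex has color `i` if at
least as many edges are left over between the colors `i` and `r` as between `j` and `r`. -/
def known (d : EdgeData) (r : Fin 3) (h : ℕ) : Params :=
  let i := other₁ r
  let j := other₂ r
  let g : Fin 3 → ℕ := fun k => if k = r then h else if k = i then d.known₁ r h else d.known₂ r h
  if d.edge j r - g j * h ≤ d.edge i r - g i * h then ⟨g, i, j⟩ else ⟨g, j, i⟩

/-- The candidates for which `r` is the color without an extra vertex and there are `b_i` core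
vertices of color `i ≠ r`: the number of core vertices of color `r` is
`⌈f_{ir} / (b_i + 1)⌉` or `⌊f_{ir} / b_i⌋`, and there is none if the former exceeds the latter. -/
def twoCandidates (d : EdgeData) (i r : Fin 3) : List Params :=
  let lo := d.edge i r ⌈/⌉ (d.b i + 1)
  let hi := d.edge i r / d.b i
  if lo < hi then [d.known r lo, d.known r hi]
  else if lo = hi then [d.known r lo]
  else []

/-- The candidates of steps 5 to 9. -/
def firstCandidates (d : EdgeData) : List Params :=
  -- step 5
  [d.known 0 (d.b 0), d.known 1 (d.b 1)]
  -- steps 6, 7 and 8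
  ++ d.twoCandidates 2 1 ++ d.twoCandidates 2 0 ++ d.twoCandidates 1 0
  -- step 9
  ++ [d.known 2 (d.vert 2)]

/-- The largest number of facets among the complexes evaluated so far. -/
noncomputable def best (d : EdgeData) (L : List Params) : ℕ :=
  (L.map fun P => P.facets d).foldr max 0

/-- The minimal and the maximal possible number `g₂` of core vertices of color 2, if there are `b₁`
core vertices of color 1 and color 2 has no extra vertex (step 10). The upper bound
`f₂₃ / (⌈f₁₃ / (b₁ + 1)⌉ - 1)` is void if its denominator is zero. -/
def range₂ (d : EdgeData) : Option (ℕ × ℕ) :=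
  let b₁ := d.b 0
  let f₁ := d.vert 0
  let f₂ := d.vert 1
  let f₃ := d.vert 2
  let f₁₂ := d.edge 0 1
  let f₁₃ := d.edge 0 2
  let f₂₃ := d.edge 1 2
  if f₁ < b₁ then none
  else if f₁ = b₁ then
    if f₁ ∣ f₁₂ then some (f₁₂ / f₁, f₁₂ / f₁) else none
  else
    let lo := max (max (f₁₂ ⌈/⌉ f₁) (f₁₂ ⌈/⌉ (b₁ + 1))) (max (f₂₃ ⌈/⌉ (f₁₃ / b₁ + 1)) (f₂₃ ⌈/⌉ f₃))
    let hi₀ := min (f₁₂ / b₁) f₂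
    let c := f₁₃ ⌈/⌉ (b₁ + 1) - 1
    let hi := if c = 0 then hi₀ else min hi₀ (f₂₃ / c)
    if f₁₃ ≤ f₃ * (b₁ + 1) ∧ lo ≤ hi then some (lo, hi) else none

/-- The upper bound `v(Δ, t)` for the number of facets if there are `b₁` core vertices of color 1 and
`t` of color 2, and color 2 has no extra vertex; as a function of `t > 0`, it increases up to
`t = √(f₁₂ f₂₃ / f₁₃)` and decreases from there on. -/
def v (d : EdgeData) (t : ℕ) : ℚ :=
  d.b 0 * d.edge 1 2 +
    (d.edge 0 1 - d.b 0 * t) * (d.edge 0 2 - (d.b 0 * d.edge 1 2 : ℚ) / t)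

/-- Construct the complexes with `g₂ = t, t - 1, t - 2, …` and evaluate them (append them to the list
of evaluated complexes), until `g₂` falls below its minimum `lo`, or the complex is not
well-defined, or the bound `v` says that decreasing `g₂` further cannot give more facets than an
already known complex. -/
noncomputable def descend (d : EdgeData) (lo : ℕ) : (t : ℕ) → List Params → List Params
  | 0, L => L
  | t + 1, L =>
    if lo ≤ t + 1 ∧ (d.known 1 (t + 1)).WellDefined d then
      let L' := L ++ [d.known 1 (t + 1)]
      if d.v t ≤ d.best L' then L' else d.descend lo t L'
    else L

/-- Construct the complexes with `g₂ = t, t + 1, …, t + n - 1` and evaluate them (append them to the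
list of evaluated complexes), until the complex is not well-defined, or the bound `v` says that
increasing `g₂` further cannot give more facets than an already known complex. -/
noncomputable def ascend (d : EdgeData) : (n t : ℕ) → List Params → List Params
  | 0, _, L => L
  | n + 1, t, L =>
    if (d.known 1 t).WellDefined d then
      let L' := L ++ [d.known 1 t]
      if d.v (t + 1) ≤ d.best L' then L' else d.ascend n (t + 1) L'
    else L

/-- Steps 5 to 13: the list of all complexes whose number of facets is computed, in this order. -/
noncomputable def evaluated (d : EdgeData) : List Params :=
  -- steps 5 to 9
  let L := d.firstCandidates.filter fun P => P.WellDefined d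
  -- step 10
  match d.range₂ with
  | none => L
  | some (lo, hi) =>
    if lo ≤ d.b 1 ∧ d.b 1 ≤ hi then
      -- step 11
      d.ascend (hi - d.b 1) (d.b 1 + 1) (d.descend lo (d.b 1) L)
    else if d.b 1 < lo then
      -- step 12
      d.ascend (hi + 1 - lo) lo L
    else
      -- step 13
      d.descend lo hi L

/-- The result of the procedure: the computed value of `m` (or `none`, if it was found that there is
no complex), and the list of the structured complexes whose number of facets was computed. -/
structure Outcome where
  answer : Option ℕ
  evaluated : List Params

/-- Steps 4 to 14, for sorted numbers of edges. -/
noncomputable def sortedProcedure (d : EdgeData) : Outcome :=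
  if d.b 0 = 0 then ⟨some (d.edge 0 1 * d.edge 0 2), []⟩
  else ⟨some (d.best d.evaluated), d.evaluated⟩

/-- The whole procedure; `σ` is the relabeling chosen in step 3. -/
noncomputable def procedure (d : EdgeData) (σ : Equiv.Perm (Fin 3)) : Outcome :=
  -- step 1
  if ¬ d.TrivialInequalities then ⟨none, []⟩
  -- step 2
  else if d.VertexTest 0 then ⟨some (d.vert 0 * d.edge 1 2), []⟩
  else if d.VertexTest 1 then ⟨some (d.vert 1 * d.edge 0 2), []⟩
  else if d.VertexTest 2 then ⟨some (d.vert 2 * d.edge 0 1), []⟩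
  -- steps 3 to 14
  else (d.relabel σ).sortedProcedure

end EdgeData

/-!
The proof reduces the problem to an optimization problem for two sequences of integers.

Fix two colors `i`, `j` and a third color `k` with `n` vertices; let `M`, `X`, `Y` be the numbers
of edges of the color pairs `i j`, `i k`, `j k`. In a complex, let `A l` and `B l` be the numbers
of vertices of color `i` and `j` that have more than `l` neighbors of color `k`. An edge of colors
`i`, `j` lies in at most as many facets as the smaller of the degrees of its ends into color `k`,
so that there are at most `∑ l < n, min M (A l * B l)` facets (`card_triples_le`). The sequences
are antitone, their terms are bounded by the numbers of vertices, and their sums are `X` and `Y`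
(`Feasible`). Conversely, a set of triples whose projections are not too large is the set of
facets of a complex with the prescribed numbers (`realizes_card`). So structured complexes, which
may have fewer edges and vertices than prescribed, can be completed, and every smaller number of
facets occurs too.

A pair of sequences of maximal value in which no unit can be discarded or moved to an earlier
place without loss has a rigid shape: up to exchanging the two sequences, `h` slots with a
constant second factor `g₂` and first factors `g₁ + 1` or `g₁`, and one last slot with smaller or
equal factors (`NormalForm`, `exists_normalForm`). Elementary inequalities compare such a pair
with the value of balanced slots, for which the edges of two color pairs are distributed as evenly
as possible among the core vertices of their common color (`SearchCondition.isCovered`). One of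
the sizes of the core is then forced, for instance to be `⌊√(M X / Y)⌋`, or all vertices of some
color are in the core. The structured complexes of the procedure reach the values of balanced
slots (`balancedValue_le_facets_known`). In most cases this leaves finitely many explicit
candidates; in the remaining one, one size is unknown, and the search finds the best value because
`v` is an upper bound that is monotone on either side of its maximum
(`IsSearchCase.exists_of_isCandidate`).

For the number of evaluated complexes, the value of balanced slots is at least `v - M`
(`v_le_balancedValue_add`). While a search goes on for `w` steps from `t` to `x`, the value of `v`
therefore decreases by less than `M`; but it decreases by at least `c w² X / x`, where
`c = ⌊√(M X / Y)⌋`. This bounds `w` in terms of `√(M Y) / X` (`IsSearchCase.length_evaluated_lt`).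
-/

section

open Finset

/-! ### Balanced slots -/

/-- `m` units distributed as evenly as possible over `t` slots, the larger shares first: the share
of slot `k < t`. -/
def balanced (m t k : ℕ) : ℕ := m / t + if k < m % t then 1 else 0

/-- The value `∑ min M (x_k y_k)` of `h` slots, when `P` units are distributed as evenly as possible
among the `x_k` and `Q` units among the `y_k`. -/
def balancedValue (M P Q h : ℕ) : ℕ :=
  ∑ k ∈ range h, min M (balanced P h k * balanced Q h k)

theorem balanced_eq {m t k c e : ℕ} (hm : m = c * t + e) (he : e ≤ t) (hk : k < t) :
    balanced m t k = c + if k < e then 1 else 0 := by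
  have ht : 0 < t := by omega
  unfold balanced
  rcases he.lt_or_eq with he | rfl
  · have h1 : m / t = c := by
      rw [hm, mul_comm, Nat.mul_add_div ht, Nat.div_eq_of_lt he, add_zero]
    have h2 : m % t = e := by
      rw [hm, Nat.mul_comm, Nat.mul_add_mod, Nat.mod_eq_of_lt he]
    rw [h1, h2]
  · have h0 : m = (c + 1) * e := by rw [hm]; ring
    rw [h0, Nat.mul_div_cancel _ ht, Nat.mul_mod_left]
    simp [hk]

theorem sum_ite_lt (t e : ℕ) : ∑ k ∈ range t, (if k < e then 1 else 0) = min e t := by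
  rw [Finset.sum_ite, Finset.sum_const_zero, Finset.sum_const, smul_eq_mul, mul_one, add_zero]
  have : (range t).filter (fun k => k < e) = range (min e t) := by
    ext k; simp; omega
  rw [this, card_range]

theorem sum_balanced (m : ℕ) {t : ℕ} (ht : 0 < t) : ∑ k ∈ range t, balanced m t k = m := by
  unfold balanced
  rw [Finset.sum_add_distrib, sum_ite_lt, Finset.sum_const, card_range, smul_eq_mul,
    min_eq_left (Nat.mod_lt m ht).le]
  exact Nat.div_add_mod m t

theorem le_balanced {m t c k : ℕ} (h : c * t ≤ m) (ht : 0 < t) : c ≤ balanced m t k := by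
  have : c ≤ m / t := (Nat.le_div_iff_mul_le ht).2 h
  unfold balanced; omega

/-- A lower bound for the value of balanced slots: the core `c × t × h` together with two slabs. -/
theorem le_balancedValue {X M Y t c e h y α x : ℕ} (hM : M = c * t + e) (he : e ≤ t)
    (hY : Y = h * t + y) (hy : y ≤ t) (hX : c * h + α + x ≤ X) (hα : α ≤ h) (hx : x ≤ c) :
    c * t * h + α * e + x * y ≤ balancedValue X M Y t := by
  have key : ∀ k ∈ range t, c * h + α * (if k < e then 1 else 0) + x * (if k < y then 1 else 0) ≤
      min X (balanced M t k * balanced Y t k) := by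
    intro k hk
    rw [balanced_eq hM he (mem_range.1 hk), balanced_eq hY hy (mem_range.1 hk)]
    split_ifs <;> (rw [le_min_iff]; constructor <;> nlinarith)
  refine le_trans (le_of_eq ?_) (Finset.sum_le_sum key)
  rw [Finset.sum_add_distrib, Finset.sum_add_distrib, Finset.sum_const, card_range,
    ← Finset.mul_sum, ← Finset.mul_sum, sum_ite_lt, sum_ite_lt, min_eq_left he, min_eq_left hy,
    smul_eq_mul]
  ring

/-- The concave function `x ↦ min M (x β)` lies below the line through its values at `q`
and `q + 1`. -/
theorem min_mul_le_line (M β q x : ℤ) (hβ : 0 ≤ β) : min M (x * β) ≤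
    min M (q * β) + (x - q) * (min M ((q + 1) * β) - min M (q * β)) := by
  rcases le_or_gt M (q * β) with h1 | h1
  · rw [min_eq_left h1, min_eq_left (by nlinarith : M ≤ (q + 1) * β), sub_self, mul_zero, add_zero]
    exact min_le_left _ _
  · rw [min_eq_right h1.le]
    rcases le_or_gt ((q + 1) * β) M with h2 | h2
    · rw [min_eq_right h2]
      exact (min_le_right _ _).trans (by nlinarith)
    · rw [min_eq_left h2.le]
      rcases le_or_gt x q with h3 | h3
      · exact (min_le_right _ _).trans (by nlinarith)
      · exact (min_le_left _ _).trans (by nlinarith)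

/-- The value of a pair of sequences: the number of facets of a color-shifted complex in which the
`k`-th vertex of the third color is adjacent to the first `A k` vertices of the first and the first
`B k` vertices of the second color, the edges between these colors being the best possible `M`
ones. -/
def seqValue (M n : ℕ) (A B : ℕ → ℕ) : ℕ := ∑ k ∈ range n, min M (A k * B k)

/-- If the second factors are bounded by `β` and there are enough units to have `β` in each slot,
balancing does not decrease the value. -/
theorem seqValue_le_balancedValue {M n X Y β : ℕ} {A B : ℕ → ℕ} (hn : 0 < n)
    (hA : ∑ k ∈ range n, A k ≤ X) (hB : ∀ k, B k ≤ β) (hY : n * β ≤ Y) :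
    seqValue M n A B ≤ balancedValue M X Y n := by
  set q := X / n
  have h1 : ∀ k ∈ range n, min M (balanced X n k * β) ≤
      min M (balanced X n k * balanced Y n k) := fun k _ =>
    min_le_min le_rfl (Nat.mul_le_mul_left _ (le_balanced (by linarith [mul_comm n β]) hn))
  refine le_trans ?_ (Finset.sum_le_sum h1)
  have h2 : ∀ k ∈ range n, min M (A k * B k) ≤ min M (A k * β) := fun k _ =>
    min_le_min le_rfl (Nat.mul_le_mul_left _ (hB k))
  refine (Finset.sum_le_sum h2).trans ?_
  zify
  set s : ℤ := min (M : ℤ) (((q : ℤ) + 1) * β) - min (M : ℤ) (q * β)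
  have hs : 0 ≤ s := by
    have : min (M : ℤ) (q * β) ≤ min (M : ℤ) (((q : ℤ) + 1) * β) :=
      min_le_min le_rfl (by nlinarith)
    simp only [s]; linarith
  have h3 : ∑ k ∈ range n, min (M : ℤ) (A k * β) ≤
      ∑ k ∈ range n, (min (M : ℤ) (q * β) + ((A k : ℤ) - q) * s) :=
    Finset.sum_le_sum fun k _ => min_mul_le_line M β q (A k) (by positivity)
  have h4 : ∑ k ∈ range n, min (M : ℤ) (balanced X n k * β) =
      ∑ k ∈ range n, (min (M : ℤ) (q * β) + ((balanced X n k : ℤ) - q) * s) := by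
    refine Finset.sum_congr rfl fun k _ => ?_
    unfold balanced
    split_ifs
    · simp only [s]; push_cast; simp [q]
    · simp [q]
  rw [h4]
  refine h3.trans ?_
  rw [Finset.sum_add_distrib, Finset.sum_add_distrib, ← Finset.sum_mul, ← Finset.sum_mul,
    Finset.sum_sub_distrib, Finset.sum_sub_distrib]
  have h5 : (∑ k ∈ range n, (A k : ℤ)) ≤ ∑ k ∈ range n, (balanced X n k : ℤ) := by
    have := sum_balanced X hn
    exact_mod_cast hA.trans this.ge
  nlinarith

/-! ### Pairs of antitone sequences of maximal value -/

/-- Pairs of antitone sequences supported in `{0, …, n - 1}` with terms at most `a` and `b` and with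
sums at most `X` and `Y`. -/
structure Feasible (a b n X Y : ℕ) (A B : ℕ → ℕ) : Prop where
  antiA : Antitone A
  antiB : Antitone B
  leA : ∀ k, A k ≤ a
  leB : ∀ k, B k ≤ b
  zeroA : ∀ k, n ≤ k → A k = 0
  zeroB : ∀ k, n ≤ k → B k = 0
  sumA : ∑ k ∈ range n, A k ≤ X
  sumB : ∑ k ∈ range n, B k ≤ Y

/-- A weight that decreases when a unit is discarded or moved to an earlier place. -/
def seqWeight (n : ℕ) (A B : ℕ → ℕ) : ℕ := ∑ k ∈ range n, (k + 1) * (A k + B k)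

/-- Among the feasible pairs of maximal value, a pair of minimal weight. -/
structure IsOptimal (M a b n X Y : ℕ) (A B : ℕ → ℕ) : Prop extends Feasible a b n X Y A B where
  opt : ∀ A' B', Feasible a b n X Y A' B' → seqValue M n A' B' ≤ seqValue M n A B
  least : ∀ A' B', Feasible a b n X Y A' B' → seqValue M n A' B' = seqValue M n A B →
    seqWeight n A B ≤ seqWeight n A' B'

theorem seqValue_comm (M n : ℕ) (A B : ℕ → ℕ) : seqValue M n A B = seqValue M n B A := by
  simp only [seqValue, mul_comm]

theorem seqWeight_comm (n : ℕ) (A B : ℕ → ℕ) : seqWeight n A B = seqWeight n B A := by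
  simp only [seqWeight, add_comm (A _)]

section

variable {M a b n X Y : ℕ} {A B : ℕ → ℕ}

theorem Feasible.symm (h : Feasible a b n X Y A B) : Feasible b a n Y X B A :=
  ⟨h.antiB, h.antiA, h.leB, h.leA, h.zeroB, h.zeroA, h.sumB, h.sumA⟩

theorem IsOptimal.symm (h : IsOptimal M a b n X Y A B) : IsOptimal M b a n Y X B A where
  toFeasible := h.toFeasible.symm
  opt A' B' h' := by
    rw [seqValue_comm, seqValue_comm M n B]; exact h.opt _ _ h'.symm
  least A' B' h' e := by
    rw [seqWeight_comm, seqWeight_comm n A']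
    rw [seqValue_comm, seqValue_comm M n B] at e
    exact h.least _ _ h'.symm e

theorem exists_isOptimal (M a b n X Y : ℕ) : ∃ A B, IsOptimal M a b n X Y A B := by
  let S : Set ℕ := {v | ∃ A B, Feasible a b n X Y A B ∧ seqValue M n A B = v}
  have hne : S.Nonempty := ⟨_, 0, 0,
    ⟨fun _ _ _ => le_rfl, fun _ _ _ => le_rfl, by simp, by simp, by simp, by simp, by simp,
      by simp⟩, rfl⟩
  have hbdd : BddAbove S := by
    refine ⟨n * M, ?_⟩
    rintro _ ⟨A, B, -, rfl⟩
    exact (Finset.sum_le_card_nsmul _ _ M fun k _ => min_le_left _ _).trans (by simp)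
  obtain ⟨A₀, B₀, h₀, e₀⟩ := Nat.sSup_mem hne hbdd
  let W : Set ℕ := {w | ∃ A B, Feasible a b n X Y A B ∧ seqValue M n A B = sSup S ∧
    seqWeight n A B = w}
  obtain ⟨A, B, h, e, hw⟩ := Nat.sInf_mem (s := W) ⟨_, A₀, B₀, h₀, e₀, rfl⟩
  refine ⟨A, B, h, fun A' B' h' => ?_, fun A' B' h' e' => ?_⟩
  · rw [e]; exact le_csSup hbdd ⟨A', B', h', rfl⟩
  · rw [hw]; exact Nat.sInf_le ⟨A', B', h', e'.trans e, rfl⟩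

theorem sum_update_add (F : ℕ → ℕ → ℕ) (A : ℕ → ℕ) {k n : ℕ} (hk : k < n) (v : ℕ) :
    ∑ i ∈ range n, F i (Function.update A k v i) + F k (A k) =
      ∑ i ∈ range n, F i (A i) + F k v := by
  rw [← Finset.add_sum_erase _ _ (mem_range.2 hk),
    ← Finset.add_sum_erase (range n) (fun i => F i (A i)) (mem_range.2 hk)]
  have : ∑ i ∈ (range n).erase k, F i (Function.update A k v i) =
      ∑ i ∈ (range n).erase k, F i (A i) :=
    Finset.sum_congr rfl fun i hi => by rw [Function.update_of_ne (Finset.ne_of_mem_erase hi)]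
  rw [this, Function.update_self]
  ring

theorem antitone_update_add (hA : Antitone A) {k w : ℕ} (hk : ∀ i < k, A k + w ≤ A i) :
    Antitone (Function.update A k (A k + w)) := by
  intro i j hij
  rcases eq_or_ne j k with rfl | hj
  · rcases eq_or_ne i j with rfl | hi
    · rfl
    · rw [Function.update_self, Function.update_of_ne hi]
      exact hk i (lt_of_le_of_ne hij hi)
  · rw [Function.update_of_ne hj]
    rcases eq_or_ne i k with rfl | hi
    · rw [Function.update_self]; exact (hA hij).trans (Nat.le_add_right _ _)
    · rw [Function.update_of_ne hi]; exact hA hij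

theorem antitone_update_sub (hA : Antitone A) {l : ℕ} (hl : ∀ i, l < i → A i < A l) :
    Antitone (Function.update A l (A l - 1)) := by
  intro i j hij
  rcases eq_or_ne i l with rfl | hi
  · rcases eq_or_ne i j with rfl | hj
    · rfl
    · rw [Function.update_self, Function.update_of_ne hj.symm]
      have := hl j (lt_of_le_of_ne hij hj); omega
  · rw [Function.update_of_ne hi]
    rcases eq_or_ne j l with rfl | hj
    · rw [Function.update_self]; exact (Nat.sub_le _ _).trans (hA hij)
    · rw [Function.update_of_ne hj]; exact hA hij

theorem Feasible.add (h : Feasible a b n X Y A B) {k w : ℕ} (hk : k < n)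
    (hfirst : ∀ i < k, A k + w ≤ A i) (ha : A k + w ≤ a) (hX : ∑ i ∈ range n, A i + w ≤ X) :
    Feasible a b n X Y (Function.update A k (A k + w)) B where
  antiA := antitone_update_add h.antiA hfirst
  antiB := h.antiB
  leA i := by
    rcases eq_or_ne i k with rfl | hi
    · rwa [Function.update_self]
    · rw [Function.update_of_ne hi]; exact h.leA i
  leB := h.leB
  zeroA i hi := by rw [Function.update_of_ne (by omega)]; exact h.zeroA i hi
  zeroB := h.zeroB
  sumA := by
    have := sum_update_add (fun _ z => z) A hk (A k + w)
    omega
  sumB := h.sumB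

theorem Feasible.sub (h : Feasible a b n X Y A B) {l : ℕ} (hl : ∀ i, l < i → A i < A l) :
    Feasible a b n X Y (Function.update A l (A l - 1)) B where
  antiA := antitone_update_sub h.antiA hl
  antiB := h.antiB
  leA i := by
    rcases eq_or_ne i l with rfl | hi
    · rw [Function.update_self]; exact (Nat.sub_le _ _).trans (h.leA i)
    · rw [Function.update_of_ne hi]; exact h.leA i
  leB := h.leB
  zeroA i hi := by
    rcases eq_or_ne i l with rfl | hi'
    · rw [Function.update_self, h.zeroA i hi]
    · rw [Function.update_of_ne hi']; exact h.zeroA i hi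
  zeroB := h.zeroB
  sumA := (Finset.sum_le_sum fun i _ => by
    rcases eq_or_ne i l with rfl | hi
    · rw [Function.update_self]; exact Nat.sub_le _ _
    · rw [Function.update_of_ne hi]).trans h.sumA
  sumB := h.sumB

theorem seqValue_update (M : ℕ) (A B : ℕ → ℕ) {k : ℕ} (hk : k < n) (v : ℕ) :
    seqValue M n (Function.update A k v) B + min M (A k * B k) =
      seqValue M n A B + min M (v * B k) :=
  sum_update_add (fun i z => min M (z * B i)) A hk v

theorem seqWeight_update (A B : ℕ → ℕ) {k : ℕ} (hk : k < n) (v : ℕ) :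
    seqWeight n (Function.update A k v) B + (k + 1) * (A k + B k) =
      seqWeight n A B + (k + 1) * (v + B k) :=
  sum_update_add (fun i z => (i + 1) * (z + B i)) A hk v

namespace IsOptimal

variable (h : IsOptimal M a b n X Y A B)
include h

/-- Discarding a unit decreases the value, since it decreases the weight. -/
theorem discard {l : ℕ} (hn : l < n) (hl : ∀ i, l < i → A i < A l) (h1 : 1 ≤ A l) :
    min M ((A l - 1) * B l) < min M (A l * B l) := by
  have f := h.toFeasible.sub hl
  have e := seqValue_update M A B hn (A l - 1)
  have e' := seqWeight_update A B hn (A l - 1)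
  have o := h.opt _ _ f
  by_contra! hc
  have hle : min M ((A l - 1) * B l) ≤ min M (A l * B l) :=
    min_le_min le_rfl (Nat.mul_le_mul_right _ (Nat.sub_le _ _))
  have o' := h.least _ _ f (by omega)
  have : (l + 1) * (A l - 1 + B l) < (l + 1) * (A l + B l) :=
    Nat.mul_lt_mul_of_pos_left (by omega) (by omega)
  omega

/-- Moving a unit does not increase the value. -/
theorem move_le {k l : ℕ} (hkn : k < n) (hln : l < n) (hkl : k ≠ l)
    (hk : ∀ i < k, A k < A i) (ha : A k < a)
    (hl : ∀ i, l < i → A i < A l) (hlk : l < k → A k + 1 < A l) (h1 : 1 ≤ A l) :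
    seqValue M n (Function.update (Function.update A l (A l - 1)) k (A k + 1)) B ≤
      seqValue M n A B ∧
    Feasible a b n X Y (Function.update (Function.update A l (A l - 1)) k (A k + 1)) B := by
  have f := h.toFeasible.sub hl
  have e1 : Function.update A l (A l - 1) k = A k := Function.update_of_ne hkl _ _
  have s := sum_update_add (fun _ z => z) A hln (A l - 1)
  have sA := h.sumA
  have f2 := f.add (k := k) (w := 1) hkn (fun i hi => by
      rw [e1]
      rcases eq_or_ne i l with rfl | hil
      · rw [Function.update_self]; have := hlk hi; omega
      · rw [Function.update_of_ne hil]; exact hk i hi)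
    (by rw [e1]; exact ha) (by omega)
  rw [e1] at f2
  exact ⟨h.opt _ _ f2, f2⟩

/-- The local form of `move_le`: only the two slots involved change. -/
theorem move {k l : ℕ} (hkn : k < n) (hln : l < n) (hkl : k ≠ l)
    (hk : ∀ i < k, A k < A i) (ha : A k < a)
    (hl : ∀ i, l < i → A i < A l) (hlk : l < k → A k + 1 < A l) (h1 : 1 ≤ A l) :
    min M ((A k + 1) * B k) + min M ((A l - 1) * B l) ≤ min M (A k * B k) + min M (A l * B l) := by
  have o := (h.move_le hkn hln hkl hk ha hl hlk h1).1
  have e1 : Function.update A l (A l - 1) k = A k := Function.update_of_ne hkl _ _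
  have e := seqValue_update M A B hln (A l - 1)
  have e' := seqValue_update M (Function.update A l (A l - 1)) B hkn (A k + 1)
  rw [e1] at e'
  omega

/-- Moving a unit to an earlier place decreases the value. -/
theorem move_lt {k l : ℕ} (hln : l < n) (hkl : k < l)
    (hk : ∀ i < k, A k < A i) (ha : A k < a) (hl : ∀ i, l < i → A i < A l) (h1 : 1 ≤ A l) :
    min M ((A k + 1) * B k) + min M ((A l - 1) * B l) < min M (A k * B k) + min M (A l * B l) := by
  have hkn := hkl.trans hln
  obtain ⟨o, f⟩ := h.move_le hkn hln hkl.ne hk ha hl (fun hh => absurd hh hkl.not_gt) h1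
  have e1 : Function.update A l (A l - 1) k = A k := Function.update_of_ne hkl.ne _ _
  have e := seqValue_update M A B hln (A l - 1)
  have e' := seqValue_update M (Function.update A l (A l - 1)) B hkn (A k + 1)
  have w := seqWeight_update A B hln (A l - 1)
  have w' := seqWeight_update (Function.update A l (A l - 1)) B hkn (A k + 1)
  rw [e1] at e' w'
  by_contra! hc
  have o' := h.least _ _ f (by omega)
  have : (k + 1) * (A k + 1 + B k) = (k + 1) * (A k + B k) + (k + 1) := by ring
  have : (l + 1) * (A l + B l) = (l + 1) * (A l - 1 + B l) + (l + 1) := by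
    obtain ⟨z, hz⟩ := Nat.exists_eq_add_of_le h1
    rw [hz, Nat.add_sub_cancel_left]; ring
  omega

/-- A unit that is left over cannot be used to increase the value. -/
theorem add_le {k : ℕ} (hkn : k < n) (hk : ∀ i < k, A k < A i) (ha : A k < a)
    (hX : ∑ i ∈ range n, A i < X) : min M ((A k + 1) * B k) ≤ min M (A k * B k) := by
  have o := h.opt _ _ (h.toFeasible.add (w := 1) hkn hk ha hX)
  have e := seqValue_update M A B hkn (A k + 1)
  omega

/-- If units of both kinds are left over, then there is no room for a further slot. -/
theorem not_add_both {k : ℕ} (hM : 1 ≤ M) (ha : 1 ≤ a) (hb : 1 ≤ b) (hkn : k < n)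
    (hA0 : A k = 0) (hB0 : B k = 0) (hk : ∀ i < k, 1 ≤ A i ∧ 1 ≤ B i)
    (hX : ∑ i ∈ range n, A i < X) (hY : ∑ i ∈ range n, B i < Y) : False := by
  have f := h.toFeasible.add (k := k) (w := 1) hkn (fun i hi => by have := hk i hi; omega)
    (by omega) hX
  have f2 := f.symm.add (k := k) (w := 1) hkn (fun i hi => by have := hk i hi; omega)
    (by omega) hY
  have o := h.opt _ _ f2.symm
  have e := seqValue_update M A B hkn (A k + 1)
  have e' := seqValue_update M B (Function.update A k (A k + 1)) hkn (B k + 1)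
  rw [seqValue_comm, seqValue_comm M n B] at e'
  rw [Function.update_self, hA0, hB0] at e'
  rw [hA0, hB0] at e o
  have : min M ((0 + 1) * (0 + 1)) = 1 := by simp [hM]
  simp only [zero_mul, mul_zero, _root_.min_zero, Nat.zero_add, one_mul] at *
  omega

/-- Moving a unit to a new slot, which gets `w` units of the other kind that are left over, does not
increase the value. -/
theorem new_slot {k l w : ℕ} (hkn : k < n) (hlk : l < k) (hA0 : A k = 0) (hB0 : B k = 0)
    (hk : ∀ i < k, 1 ≤ A i ∧ w ≤ B i) (hl : ∀ i, l < i → A i < A l) (h2 : 2 ≤ A l)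
    (hY : ∑ i ∈ range n, B i + w ≤ Y) :
    min M ((A l - 1) * B l) + min M w ≤ min M (A l * B l) := by
  have hln := hlk.trans hkn
  have ha := h.leA l
  obtain ⟨-, f⟩ := h.move_le hkn hln hlk.ne' (fun i hi => by have := hk i hi; omega)
    (by omega) hl (fun _ => by omega) (by omega)
  have hb : w ≤ b := (hk l hlk).2.trans (h.leB l)
  have f2 := f.symm.add (k := k) (w := w) hkn (fun i hi => by have := hk i hi; omega)
    (by omega) hY
  have o := h.opt _ _ f2.symm
  have e1 : Function.update A l (A l - 1) k = A k := Function.update_of_ne hlk.ne' _ _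
  have e := seqValue_update M A B hln (A l - 1)
  have e' := seqValue_update M (Function.update A l (A l - 1)) B hkn (A k + 1)
  have e'' := seqValue_update M B
    (Function.update (Function.update A l (A l - 1)) k (A k + 1)) hkn (B k + w)
  rw [seqValue_comm, seqValue_comm M n B] at e''
  rw [Function.update_self] at e''
  rw [e1] at e'
  simp only [hA0, hB0, zero_mul, mul_zero, _root_.min_zero, Nat.zero_add, Nat.mul_one] at *
  omega

end IsOptimal

end

/-! ### The shape of optimal pairs -/

/-- The shape of an optimal pair: `h` slots with second factor `g₂` and first factor `g₁ + 1`
(the first `α` slots) or `g₁`, and one last slot `(x, y)`. -/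
structure NormalForm (M a b n X Y : ℕ) (A B : ℕ → ℕ) (h α g₁ g₂ x y : ℕ) : Prop
    extends IsOptimal M a b n X Y A B where
  hn : h < n
  eqA : ∀ k < h, A k = g₁ + if k < α then 1 else 0
  eqB : ∀ k < h, B k = g₂
  lastA : A h = x
  lastB : B h = y
  tail : ∀ k, h < k → A k = 0 ∧ B k = 0
  hx : 1 ≤ x
  hxg : x ≤ g₁
  hy : 1 ≤ y
  hyg : y ≤ g₂
  hga : g₁ ≤ a
  hgb : g₂ ≤ b
  hα : α = 0 ∨ α < h
  single : h = 0 → x = g₁ ∧ y = g₂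
  extra : 0 < α → g₁ < a ∧ g₁ * g₂ < M ∧ M < g₁ * g₂ + y

namespace IsOptimal

variable {M a b n X Y : ℕ} {A B : ℕ → ℕ}

/-- Both sequences are positive exactly up to the same place `h`. -/
theorem exists_support (o : IsOptimal M a b n X Y A B) (hM : 1 ≤ M) (ha : 1 ≤ a) (hb : 1 ≤ b)
    (hn : 1 ≤ n) (hX : 1 ≤ X) (hY : 1 ≤ Y) :
    ∃ h < n, (∀ k ≤ h, 1 ≤ A k ∧ 1 ≤ B k) ∧ ∀ k, h < k → A k = 0 ∧ B k = 0 := by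
  classical
  have key : ∀ {a b X Y : ℕ} {A B : ℕ → ℕ}, IsOptimal M a b n X Y A B → ∀ k, A k ≠ 0 →
      B k ≠ 0 := by
    intro a b X Y A B o k hA hB
    have ex : ∃ i, A i = 0 := ⟨n, o.zeroA n le_rfl⟩
    set N := Nat.find ex
    have h1 : A N = 0 := Nat.find_spec ex
    have hkN : k < N := by
      by_contra! hc
      have := o.antiA hc; omega
    have h2 : A (N - 1) ≠ 0 := Nat.find_min ex (m := N - 1) (by omega)
    have hNn : N ≤ n := Nat.find_min' ex (o.zeroA n le_rfl)
    have h3 := o.discard (l := N - 1) (by omega) (fun i hi => by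
      have := o.antiA (show N ≤ i by omega); omega) (by omega)
    have h4 : B (N - 1) = 0 := by
      have := o.antiB (show k ≤ N - 1 by omega); omega
    rw [h4] at h3
    simp at h3
  have key1 := fun k => key o k
  have key2 := fun k => key o.symm k
  have ex : ∃ i, A i = 0 := ⟨n, o.zeroA n le_rfl⟩
  set N := Nat.find ex
  have hN : A N = 0 := Nat.find_spec ex
  have hlt : ∀ k < N, A k ≠ 0 := fun k hk => Nat.find_min ex hk
  have hge : ∀ k, N ≤ k → A k = 0 := fun k hk => by have := o.antiA hk; omega
  have hge' : ∀ k, N ≤ k → B k = 0 := fun k hk => by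
    by_contra hc; exact key2 k hc (hge k hk)
  have hNn : N ≤ n := Nat.find_min' ex (o.zeroA n le_rfl)
  have hN0 : N ≠ 0 := by
    intro h0
    refine o.not_add_both (k := 0) hM ha hb (by omega) (hge 0 (by omega)) (hge' 0 (by omega))
      (by simp) ?_ ?_
    · rw [Finset.sum_eq_zero fun k _ => hge k (by omega)]; omega
    · rw [Finset.sum_eq_zero fun k _ => hge' k (by omega)]; omega
  refine ⟨N - 1, by omega, fun k hk => ?_, fun k hk => ⟨hge k (by omega), hge' k (by omega)⟩⟩
  have h1 := hlt k (by omega)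
  have h2 := key1 k h1
  omega

/-- All slots but the last one are nearly filled: a further unit of the first kind would exceed
the capacity `M`. -/
theorem near_full (o : IsOptimal M a b n X Y A B) {h k : ℕ} (hn : h < n)
    (hpos : 1 ≤ A h) (hposB : 1 ≤ B h) (htail : ∀ k, h < k → A k = 0) (hk : k < h)
    (hfirst : ∀ i < k, A k < A i) (ha : A k < a) : M < A k * B k + B h := by
  have h1 := o.move_lt hn hk hfirst ha (fun i hi => by rw [htail i hi]; omega) hpos
  have h2 := o.antiB hk.le
  obtain ⟨z, hz⟩ := Nat.exists_eq_add_of_le hpos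
  rw [hz, Nat.add_sub_cancel_left] at h1
  have e1 : (A k + 1) * B k = A k * B k + B k := by ring
  have e2 : (1 + z) * B h = z * B h + B h := by ring
  rw [e1, e2] at h1
  by_contra! hc
  omega

/-- Before its last positive term, an optimal sequence takes at most two values, `g + 1` (for `α`
slots) and `g`: slots of a larger value would be filled even without one of their units, which
could be discarded. -/
theorem levels (o : IsOptimal M a b n X Y A B) {h : ℕ} (h1 : 1 ≤ h) (hn : h < n)
    (hpos : ∀ k ≤ h, 1 ≤ A k ∧ 1 ≤ B k) (htail : ∀ k, h < k → A k = 0 ∧ B k = 0) :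
    ∃ g α, α < h ∧ (∀ k < h, A k = g + if k < α then 1 else 0) ∧
      (g < a → M < g * B α + B h) ∧ (0 < α → g < a ∧ g * B (α - 1) < M) ∧ A h ≤ g := by
  classical
  have ex : ∃ k, A k = A (h - 1) := ⟨_, rfl⟩
  set α := Nat.find ex
  have hα : A α = A (h - 1) := Nat.find_spec ex
  have hαmin : ∀ k < α, A k ≠ A (h - 1) := fun k hk => Nat.find_min ex hk
  have hαh : α ≤ h - 1 := Nat.find_min' ex rfl
  set g := A (h - 1)
  have hgt : ∀ k < α, g < A k := fun k hk => by
    have := o.antiA hk.le; have := hαmin k hk; omega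
  have nf : g < a → M < g * B α + B h := fun hga => by
    have := o.near_full hn (hpos h le_rfl).1 (hpos h le_rfl).2 (fun k hk => (htail k hk).1)
      (show α < h by omega) (fun i hi => by rw [hα]; exact hgt i hi) (by rw [hα]; exact hga)
    rwa [hα] at this
  have hle : A 0 ≤ g + 1 := by
    by_contra! hc
    have ex2 : ∃ k, A k < A 0 := ⟨h - 1, by omega⟩
    set L := Nat.find ex2
    have hL : A L < A 0 := Nat.find_spec ex2
    have hLmin : ∀ k < L, ¬ A k < A 0 := fun k hk => Nat.find_min ex2 hk
    have hL0 : L ≠ 0 := by rintro h0; rw [h0] at hL; omega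
    have hLα : L ≤ α := Nat.find_min' ex2 (by omega)
    have hl : A (L - 1) = A 0 := by
      have := hLmin (L - 1) (by omega); have := o.antiA (Nat.zero_le (L - 1)); omega
    have d := o.discard (l := L - 1) (by omega) (fun i hi => by
      have := o.antiA (show L ≤ i by omega); omega) (by omega)
    rw [hl] at d
    have hga : g < a := by have := o.leA 0; omega
    have := nf hga
    have hB1 : B α ≤ B (L - 1) := o.antiB (by omega)
    have hB2 : B h ≤ B α := o.antiB (by omega)
    have e : (g + 1) * B α ≤ (A 0 - 1) * B (L - 1) := Nat.mul_le_mul (by omega) hB1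
    have e2 : (g + 1) * B α = g * B α + B α := by ring
    omega
  have heq : ∀ k < α, A k = g + 1 := fun k hk => by
    have := o.antiA (Nat.zero_le k); have := hgt k hk; omega
  refine ⟨g, α, by omega, fun k hk => ?_, nf, fun h0 => ?_, o.antiA (by omega)⟩
  · split_ifs with hka
    · exact heq k hka
    · have := o.antiA (show k ≤ h - 1 by omega); have := o.antiA (not_lt.1 hka); omega
  · have e := heq (α - 1) (by omega)
    refine ⟨by have := o.leA (α - 1); omega, ?_⟩
    have d := o.discard (l := α - 1) (by omega) (fun i hi => by
      have := o.antiA (show α ≤ i by omega); omega) (by omega)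
    rw [e, Nat.add_sub_cancel] at d
    omega

/-- An optimal pair has, up to exchanging the two sequences, the normal form: extra units of
both kinds cannot both be useful. -/
theorem exists_normalForm (o : IsOptimal M a b n X Y A B) (hM : 1 ≤ M) (ha : 1 ≤ a) (hb : 1 ≤ b)
    (hn : 1 ≤ n) (hX : 1 ≤ X) (hY : 1 ≤ Y) :
    ∃ h α g₁ g₂ x y, NormalForm M a b n X Y A B h α g₁ g₂ x y ∨
      NormalForm M b a n Y X B A h α g₁ g₂ x y := by
  obtain ⟨h, hhn, hpos, htail⟩ := o.exists_support hM ha hb hn hX hY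
  rcases Nat.eq_zero_or_pos h with rfl | h1
  · exact ⟨0, 0, A 0, B 0, A 0, B 0, Or.inl
      { toIsOptimal := o, hn := hhn, eqA := by simp, eqB := by simp, lastA := rfl, lastB := rfl,
        tail := htail, hx := (hpos 0 le_rfl).1, hxg := le_rfl, hy := (hpos 0 le_rfl).2,
        hyg := le_rfl, hga := o.leA 0, hgb := o.leB 0, hα := Or.inl rfl,
        single := fun _ => ⟨rfl, rfl⟩, extra := fun h => absurd h (lt_irrefl 0) }⟩
  obtain ⟨g₁, α, hα, eA, nA, dA, lA⟩ := o.levels h1 hhn hpos htail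
  obtain ⟨g₂, β, hβ, eB, nB, dB, lB⟩ := o.symm.levels h1 hhn (fun k hk => (hpos k hk).symm)
    (fun k hk => (htail k hk).symm)
  have main : ∀ {a b X Y : ℕ} {A B : ℕ → ℕ} {g₁ g₂ α β : ℕ}, IsOptimal M a b n X Y A B →
      (∀ k ≤ h, 1 ≤ A k ∧ 1 ≤ B k) → (∀ k, h < k → A k = 0 ∧ B k = 0) →
      α < h → (∀ k < h, A k = g₁ + if k < α then 1 else 0) →
      (g₁ < a → M < g₁ * B α + B h) → (0 < α → g₁ < a ∧ g₁ * B (α - 1) < M) → A h ≤ g₁ →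
      β < h → (∀ k < h, B k = g₂ + if k < β then 1 else 0) →
      (0 < β → g₂ < b ∧ g₂ * A (β - 1) < M) → B h ≤ g₂ →
      β ≤ α → NormalForm M a b n X Y A B h α g₁ g₂ (A h) (B h) := by
    intro a b X Y A B g₁ g₂ α β o hpos htail hα eA nA dA lA hβ eB dB lB hle
    have hBα : B α = g₂ := by rw [eB α hα, if_neg (by omega), add_zero]
    -- by `near_full`, the slot `β - 1` is filled even without its extra unit of the second kind
    have hβ0 : β = 0 := by
      by_contra h0
      have h2 := (dB (by omega)).2
      have h3 := nA (dA (by omega)).1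
      rw [hBα] at h3
      rw [eA (β - 1) (by omega), if_pos (by omega)] at h2
      have : g₂ * (g₁ + 1) = g₁ * g₂ + g₂ := by ring
      omega
    subst hβ0
    have hA0 := o.leA (h - 1)
    have hB0 := o.leB (h - 1)
    rw [eA (h - 1) (by omega)] at hA0
    rw [eB (h - 1) (by omega)] at hB0
    exact
      { toIsOptimal := o, hn := hhn, eqA := eA, eqB := fun k hk => by rw [eB k hk]; simp,
        lastA := rfl, lastB := rfl, tail := htail, hx := (hpos h le_rfl).1, hxg := lA,
        hy := (hpos h le_rfl).2, hyg := lB, hga := by omega, hgb := by omega,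
        hα := Or.inr hα, single := fun h0 => by omega,
        extra := fun h0 => by
          obtain ⟨d1, d2⟩ := dA h0
          have := nA d1
          rw [hBα] at this
          rw [eB (α - 1) (by omega)] at d2
          exact ⟨d1, by simpa using d2, this⟩ }
  rcases le_total β α with hle | hle
  · exact ⟨h, α, g₁, g₂, A h, B h, Or.inl
      (main o hpos htail hα eA nA dA lA hβ eB dB lB hle)⟩
  · exact ⟨h, β, g₂, g₁, B h, A h, Or.inr
      (main o.symm (fun k hk => (hpos k hk).symm) (fun k hk => (htail k hk).symm) hβ eB nB dB lB
        hα eA dA lA hle)⟩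

end IsOptimal

/-! ### Comparison of normal forms with balanced slots -/

/-- `c` core vertices of the first and `t` of the second color, where `c = ⌊√(M X / Y)⌋`, such that
the remaining edges can be accounted for by one further vertex of the first and one of the
third color. -/
structure IsGoodSize (M a b n X Y c t : ℕ) : Prop where
  hc : 1 ≤ c
  ht : 1 ≤ t
  sq_le : c ^ 2 * Y ≤ M * X
  lt_sq : M * X < (c + 1) ^ 2 * Y
  hca : c ≤ a
  htb : t ≤ b
  hcM : c * t ≤ M
  hMc : M ≤ (c + 1) * t
  hYn : Y ≤ t * n
  hXn : X ≤ (c + 1) * n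
  lower : ∃ h, Y ≤ (h + 1) * t ∧ c * h ≤ X
  upper : ∃ h, h * t ≤ Y ∧ X ≤ (c + 1) * (h + 1)

/-- `T` is at most the value of one of the candidates: two balanced slots for a good size, for all
`n` vertices of the third color, or for all vertices of the first or second color if their number
is `⌊√(M X / Y)⌋` or `⌊√(M Y / X)⌋`, respectively. -/
def IsCovered (M a b n X Y T : ℕ) : Prop :=
  (∃ c t, IsGoodSize M a b n X Y c t ∧ (c < a ∨ M = c * t) ∧ T ≤ balancedValue X M Y t) ∨
  (∃ c t, IsGoodSize M b a n Y X c t ∧ (c < b ∨ M = c * t) ∧ T ≤ balancedValue Y M X t) ∨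
  (n ≤ X ∧ n ≤ Y ∧ T ≤ balancedValue M X Y n) ∨
  (a ^ 2 * Y ≤ M * X ∧ M * X < (a + 1) ^ 2 * Y ∧ T ≤ balancedValue Y M X a) ∨
  (b ^ 2 * X ≤ M * Y ∧ M * Y < (b + 1) ^ 2 * X ∧ T ≤ balancedValue X M Y b)

/-- The conditions under which the procedure reaches its search: the trivial inequalities hold, the
vertex tests fail, and `⌊√(M X / Y)⌋`, `⌊√(M Y / X)⌋` are positive. -/
structure SearchCondition (M a b n X Y : ℕ) : Prop where
  hM : 1 ≤ M
  hMX : M ≤ X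
  hMY : M ≤ Y
  hXan : X ≤ a * n
  hYbn : Y ≤ b * n
  hMab : M ≤ a * b
  testA : (M / a) * (X / a) < Y
  testB : (M / b) * (Y / b) < X
  testN : (X / n) * (Y / n) < M
  hYMX : Y ≤ M * X
  hXMY : X ≤ M * Y

theorem balancedValue_comm (M P Q h : ℕ) : balancedValue M P Q h = balancedValue M Q P h := by
  simp only [balancedValue, mul_comm]

theorem IsCovered.symm {M a b n X Y T : ℕ} (h : IsCovered M a b n X Y T) :
    IsCovered M b a n Y X T := by
  rcases h with h | h | ⟨h, h', h''⟩ | h | h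
  · exact Or.inr (Or.inl h)
  · exact Or.inl h
  · exact Or.inr (Or.inr (Or.inl ⟨h', h, by rwa [balancedValue_comm]⟩))
  · exact Or.inr (Or.inr (Or.inr (Or.inr h)))
  · exact Or.inr (Or.inr (Or.inr (Or.inl h)))

namespace SearchCondition

variable {M a b n X Y : ℕ} (s : SearchCondition M a b n X Y)
include s

theorem symm : SearchCondition M b a n Y X :=
  ⟨s.hM, s.hMY, s.hMX, s.hYbn, s.hXan, by rw [mul_comm]; exact s.hMab, s.testB, s.testA,
    by rw [mul_comm]; exact s.testN, s.hXMY, s.hYMX⟩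

theorem a_pos : 1 ≤ a := by
  have := s.hMab; have := s.hM
  rcases Nat.eq_zero_or_pos a with rfl | h
  · omega
  · exact h

theorem n_pos : 1 ≤ n := by
  have := s.hXan; have := s.hM; have := s.hMX
  rcases Nat.eq_zero_or_pos n with rfl | h
  · omega
  · exact h

theorem test_a {p q : ℕ} (hp : p * a ≤ M) (hq : q * a ≤ X) : p * q < Y :=
  (Nat.mul_le_mul ((Nat.le_div_iff_mul_le s.a_pos).2 hp)
    ((Nat.le_div_iff_mul_le s.a_pos).2 hq)).trans_lt s.testA

theorem test_n {p q : ℕ} (hp : p * n ≤ X) (hq : q * n ≤ Y) : p * q < M :=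
  (Nat.mul_le_mul ((Nat.le_div_iff_mul_le s.n_pos).2 hp)
    ((Nat.le_div_iff_mul_le s.n_pos).2 hq)).trans_lt s.testN

end SearchCondition

/-- The core `g₁ × g₂ × h` with an extra vertex of the first color, adjacent to `ε` vertices of the
second and `α` vertices of the third color, and an extra vertex of the third color is dominated by
balanced slots for the good size `(g₁, g₂)`, provided that `g₁ = ⌊√(M X / Y)⌋`. -/
theorem isCovered_of_core {M a b n X Y T g₁ g₂ h α ε x y : ℕ} (hn : h < n)
    (h1 : 1 ≤ g₁) (h2 : 1 ≤ g₂) (hga : g₁ ≤ a) (hgb : g₂ ≤ b) (hM : M = g₁ * g₂ + ε) (hε : ε ≤ g₂)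
    (hX : X = h * g₁ + α + x) (hY : Y = h * g₂ + y) (hα : α ≤ h) (hx : x ≤ g₁) (hy : y ≤ g₂)
    (hsq : g₁ ^ 2 * Y ≤ M * X) (hlt : M * X < (g₁ + 1) ^ 2 * Y)
    (hc : g₁ < a ∨ ε = 0) (hT : T ≤ g₁ * g₂ * h + α * ε + x * y) :
    IsCovered M a b n X Y T := by
  refine Or.inl ⟨g₁, g₂, ⟨h1, h2, hsq, hlt, hga, hgb, by omega, by rw [hM]; linarith, ?_, ?_,
    ⟨h, by rw [hY]; linarith, by rw [hX, mul_comm]; omega⟩,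
    ⟨h, by omega, by rw [hX]; nlinarith⟩⟩, ?_,
    hT.trans (le_balancedValue hM hε hY hy (by rw [hX, mul_comm]) hα hx)⟩
  · calc Y ≤ g₂ * (h + 1) := by rw [hY]; linarith
      _ ≤ g₂ * n := Nat.mul_le_mul_left _ hn
  · calc X ≤ (g₁ + 1) * (h + 1) := by rw [hX]; nlinarith
      _ ≤ (g₁ + 1) * n := Nat.mul_le_mul_left _ hn
  · rcases hc with hc | hc
    · exact Or.inl hc
    · exact Or.inr (by omega)

theorem mul_lt_sq_mul_of_le_of_le {g₁ g₂ h α ε x y : ℕ} (hα : α ≤ h) (hx : x ≤ g₁) (hh : g₁ ≤ h)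
    (hε : ε ≤ y) (hy : y ≤ g₂) (hy1 : 1 ≤ y) :
    (g₁ * g₂ + ε) * (h * g₁ + α + x) < (g₁ + 1) ^ 2 * (h * g₂ + y) := by
  have h1 : (g₁ * g₂ + ε) * (h * g₁ + α + x) ≤ (g₁ * g₂ + ε) * (h * g₁ + h + x) :=
    Nat.mul_le_mul_left _ (by omega)
  refine h1.trans_lt ?_
  obtain ⟨r, rfl⟩ := Nat.exists_eq_add_of_le hx
  obtain ⟨s, rfl⟩ := Nat.exists_eq_add_of_le hh
  obtain ⟨q, rfl⟩ := Nat.exists_eq_add_of_le hε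
  obtain ⟨p, rfl⟩ := Nat.exists_eq_add_of_le hy
  have e : (x + r + 1) ^ 2 * ((x + r + s) * (ε + q + p) + (ε + q)) =
      ((x + r) * (ε + q + p) + ε) * ((x + r + s) * (x + r) + (x + r + s) + x) +
      ((q + p) * ((x + r) * (r + s) + (x + r + s)) + ε * (x + r + 1) * (r + 1)
        + (x + r + 1) ^ 2 * q) := by ring
  rw [e]
  refine Nat.lt_add_of_pos_right ?_
  rcases Nat.eq_zero_or_pos q with rfl | hq
  · have : 0 < ε := by omega
    positivity
  · positivity

theorem mul_lt_sq_mul_of_le {g₁ g₂ h ε x y : ℕ} (hx : x ≤ g₁) (hh : g₁ ≤ h)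
    (hε : ε ≤ g₂) (hy1 : 1 ≤ y) :
    (g₁ * g₂ + ε) * (h * g₁ + x) < (g₁ + 1) ^ 2 * (h * g₂ + y) := by
  obtain ⟨r, rfl⟩ := Nat.exists_eq_add_of_le hx
  obtain ⟨s, rfl⟩ := Nat.exists_eq_add_of_le hh
  obtain ⟨p, rfl⟩ := Nat.exists_eq_add_of_le hε
  have e : (x + r + 1) ^ 2 * ((x + r + s) * (ε + p) + y) =
      ((x + r) * (ε + p) + ε) * ((x + r + s) * (x + r) + x) +
      ((x + r) * (ε + p) * (r + s) + (x + r + s) * (x + r) * p + (r + s) * ε + (x + r + s) * p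
        + (x + r + 1) ^ 2 * y) := by ring
  rw [e]
  refine Nat.lt_add_of_pos_right ?_
  positivity

/-- The core `g₁ × g₂ × h` with an extra vertex of the first color that is adjacent to `α` vertices
of the third and `ε` vertices of the second color, and an extra vertex of the third color. -/
theorem isCovered_of_extra {M a b n X Y T g₁ g₂ h α ε x y : ℕ} (s : SearchCondition M a b n X Y)
    (hn : h < n) (hga : g₁ < a) (hgb : g₂ ≤ b) (hM : M = g₁ * g₂ + ε)
    (hX : X = h * g₁ + α + x) (hY : Y = h * g₂ + y) (hα : α < h) (hx : x ≤ g₁) (hx1 : 1 ≤ x)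
    (hy : y ≤ g₂) (hε : ε < y) (hε0 : 0 < ε) (hT : T ≤ g₁ * g₂ * h + α * ε + x * y) :
    IsCovered M a b n X Y T := by
  have hg : g₁ ≤ h := by
    by_contra! hc
    have := s.hMY
    have : (h + 1) * g₂ ≤ g₁ * g₂ := Nat.mul_le_mul_right _ hc
    have : (h + 1) * g₂ = h * g₂ + g₂ := by ring
    omega
  have hlt : M * X < (g₁ + 1) ^ 2 * Y := by
    rw [hM, hX, hY]
    exact mul_lt_sq_mul_of_le_of_le hα.le hx hg hε.le hy (by omega)
  by_cases hsq : g₁ ^ 2 * Y ≤ M * X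
  · exact isCovered_of_core hn (by omega) (by omega) hga.le hgb hM (by omega) hX hY hα.le hx hy hsq
      hlt (Or.inl hga) hT
  -- if `g₁` exceeds `√(M X / Y)`, the roles of the first two colors are exchanged
  push Not at hsq
  have e1 : g₁ * (g₁ * g₂ * h) + g₁ * (g₂ * (α + x)) + g₁ * (ε * h) + ε * (α + x) <
      g₁ * (g₁ * g₂ * h) + g₁ * (g₁ * y) := by
    rw [hM, hX, hY] at hsq
    calc _ = (g₁ * g₂ + ε) * (h * g₁ + α + x) := by ring
      _ < _ := hsq
      _ = _ := by ring
  have e2 : g₂ * (α + x) + ε * h < g₁ * y := by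
    have : g₁ * (g₂ * (α + x) + ε * h) < g₁ * (g₁ * y) := by
      have := Nat.zero_le (ε * (α + x)); nlinarith
    exact Nat.lt_of_mul_lt_mul_left this
  have hαx : α + x < g₁ := by
    by_contra! hc
    have : g₂ * g₁ ≤ g₂ * (α + x) := Nat.mul_le_mul_left _ hc
    have : g₁ * y ≤ g₁ * g₂ := Nat.mul_le_mul_left _ hy
    have := mul_comm g₁ g₂
    omega
  have hg2 : g₂ ≤ h := by
    by_contra! hc
    have := s.hMX
    have : g₁ * (h + 1) ≤ g₁ * g₂ := Nat.mul_le_mul_left _ hc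
    have : g₁ * (h + 1) = h * g₁ + g₁ := by ring
    omega
  have hε1 : ε ≤ g₁ := by
    by_contra! hc
    have : g₁ * y ≤ ε * h := Nat.mul_le_mul hc.le (hy.trans hg2)
    omega
  have hsq' : g₂ ^ 2 * X ≤ M * Y := by
    rw [hM, hX, hY]
    have e3 : g₂ * (g₂ * (α + x)) ≤ g₂ * (g₁ * y) := Nat.mul_le_mul_left _ (by omega)
    have := Nat.zero_le (ε * (h * g₂ + y))
    nlinarith
  have hlt' : M * Y < (g₂ + 1) ^ 2 * X := by
    have := mul_lt_sq_mul_of_le (g₁ := g₂) (g₂ := g₁) (ε := ε) (y := α + x) hy hg2 hε1 (by omega)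
    rw [hM, hX, hY, mul_comm g₁ g₂, add_assoc (h * g₁)]
    exact this
  have hT' : T ≤ g₂ * g₁ * h + 0 * ε + y * (α + x) := by
    have : α * ε ≤ α * y := Nat.mul_le_mul_left _ hε.le
    nlinarith
  rcases hgb.lt_or_eq with hgb | hgb
  · exact (isCovered_of_core hn (by omega) (by omega) hgb.le hga.le (by rw [hM, mul_comm g₁]) hε1
      (α := 0) (by rw [hY, add_zero]) (by rw [hX, add_assoc]) (Nat.zero_le _) hy hαx.le hsq' hlt'
      (Or.inl hgb) hT').symm
  · subst hgb
    exact Or.inr (Or.inr (Or.inr (Or.inr ⟨hsq', hlt', hT.trans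
      (le_balancedValue hM (by omega) hY hy (by rw [hX, mul_comm]) hα.le hx)⟩)))

/-- The core `g₁ × g₂ × (h + 1)` with an extra vertex of the first color that is adjacent to `α`
vertices of the third and `ε` vertices of the second color, where some edges between the second and
third color are left over. -/
theorem isCovered_of_leftover {M a b n X Y T g₁ g₂ N α ε υ : ℕ} (s : SearchCondition M a b n X Y)
    (hn : N < n) (h1 : 1 ≤ g₁) (hga : g₁ < a) (hgb : g₂ ≤ b) (hM : M = g₁ * g₂ + ε)
    (hX : X = N * g₁ + α) (hY : Y = N * g₂ + υ) (hα : α ≤ N) (hN : 1 ≤ N)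
    (hυ : υ ≤ ε) (hε : ε < g₂) (hT : T ≤ g₁ * g₂ * N + α * ε) :
    IsCovered M a b n X Y T := by
  have hg : g₁ ≤ N := by
    by_contra! hc
    have := s.hMY
    have : (N + 1) * g₂ ≤ g₁ * g₂ := Nat.mul_le_mul_right _ hc
    have : (N + 1) * g₂ = N * g₂ + g₂ := by ring
    omega
  refine isCovered_of_core hn h1 (by omega) hga.le hgb hM hε.le (x := 0) hX hY hα (Nat.zero_le _)
    (by omega) ?_ ?_ (Or.inl hga) (by simpa using hT)
  · rw [hM, hX, hY]
    have : g₁ * g₁ * υ ≤ N * g₁ * ε := Nat.mul_le_mul (Nat.mul_le_mul_right _ hg) hυ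
    have := Nat.zero_le ((g₁ * g₂ + ε) * α)
    nlinarith
  · rw [hM, hX, hY]
    calc (g₁ * g₂ + ε) * (N * g₁ + α) ≤ (g₁ * g₂ + ε) * (N * (g₁ + 1)) :=
          Nat.mul_le_mul_left _ (by linarith)
      _ < ((g₁ + 1) * g₂) * (N * (g₁ + 1)) :=
          Nat.mul_lt_mul_of_pos_right (by linarith) (by positivity)
      _ ≤ _ := by nlinarith [Nat.zero_le ((g₁ + 1) ^ 2 * υ)]

/-- The case of `isCovered_of_box` in which `g₁ ≤ √(M X / Y)`. -/
theorem isCovered_of_box_aux {M a b n X Y T g₁ g₂ h ε x y : ℕ} (s : SearchCondition M a b n X Y)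
    (hn : h < n) (hga : g₁ ≤ a) (hgb : g₂ ≤ b) (hM : M = g₁ * g₂ + ε)
    (hX : X = h * g₁ + x) (hY : Y = h * g₂ + y) (hx : x ≤ g₁) (hx1 : 1 ≤ x)
    (hy : y ≤ g₂) (hy1 : 1 ≤ y) (hεy : 0 < ε → g₁ = a ∨ ε < y) (hεx : 0 < ε → g₂ = b ∨ ε < x)
    (hT : T ≤ g₁ * g₂ * h + x * y) (hxy : g₁ * y ≤ g₂ * x) :
    IsCovered M a b n X Y T := by
  have hsq : g₁ ^ 2 * Y ≤ M * X := by
    rw [hM, hX, hY]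
    have e3 : g₁ * (g₁ * y) ≤ g₁ * (g₂ * x) := Nat.mul_le_mul_left _ hxy
    have := Nat.zero_le (ε * (h * g₁ + x))
    nlinarith
  have hg : g₁ ≤ h ∨ ε = 0 ∧ y = g₂ := by
    by_contra! hc
    have := s.hMY
    have : (h + 1) * g₂ ≤ g₁ * g₂ := Nat.mul_le_mul_right _ hc.1
    have : (h + 1) * g₂ = h * g₂ + g₂ := by ring
    have := hc.2
    omega
  rcases Nat.eq_zero_or_pos ε with h0 | h0
  · refine isCovered_of_core hn (by omega) (by omega) hga hgb hM (by omega) (α := 0)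
      (by rw [hX, add_zero]) hY (Nat.zero_le _) hx hy hsq ?_ (Or.inr h0)
      (by rw [zero_mul, add_zero]; exact hT)
    rcases hg with hg | ⟨-, hg⟩
    · rw [hM, hX, hY]
      exact mul_lt_sq_mul_of_le hx hg (by omega) hy1
    · rw [hM, hX, hY, h0, hg]
      calc (g₁ * g₂ + 0) * (h * g₁ + x) ≤ (g₁ * g₂ + 0) * (h * g₁ + g₁) :=
            Nat.mul_le_mul_left _ (by omega)
        _ = g₁ ^ 2 * (h * g₂ + g₂) := by ring
        _ < _ := Nat.mul_lt_mul_of_pos_right (Nat.pow_lt_pow_left (by omega) (by omega))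
            (by omega)
  have hg : g₁ ≤ h := by omega
  rcases hga.lt_or_eq with hga | hga
  · have hε : ε < y := by have := hεy h0; omega
    refine isCovered_of_core hn (by omega) (by omega) hga.le hgb hM (by omega) (α := 0)
      (by rw [hX, add_zero]) hY (Nat.zero_le _) hx hy hsq ?_ (Or.inl hga)
      (by rw [zero_mul, add_zero]; exact hT)
    rw [hM, hX, hY]
    exact mul_lt_sq_mul_of_le hx hg (by omega) hy1
  subst hga
  have hgb' : g₂ < b := by
    rcases hgb.lt_or_eq with hgb | hgb
    · exact hgb
    · have := s.hMab; rw [← hgb] at this; omega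
  have hε : ε < x := by have := hεx h0; omega
  have hg2 : g₂ ≤ h := by
    by_contra! hc
    have := s.hMX
    have : g₁ * (h + 1) ≤ g₁ * g₂ := Nat.mul_le_mul_left _ hc
    have : g₁ * (h + 1) = h * g₁ + g₁ := by ring
    omega
  by_cases hsq' : g₂ ^ 2 * X ≤ M * Y
  · refine (isCovered_of_core hn (by omega) (by omega) hgb le_rfl (by rw [hM, mul_comm g₁])
      (by omega) (α := 0) (by rw [hY, add_zero]) hX (Nat.zero_le _) hy hx hsq' ?_ (Or.inl hgb')
      (by rw [zero_mul, add_zero, mul_comm g₂, mul_comm y]; exact hT)).symm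
    rw [hM, hX, hY, mul_comm g₁ g₂]
    exact mul_lt_sq_mul_of_le hy hg2 (by omega) hx1
  push Not at hsq'
  have e1 : g₂ * (ε * h) < g₂ * (g₂ * x) := by
    rw [hM, hX, hY] at hsq'
    have := Nat.zero_le (g₁ * g₂ * y)
    have := Nat.zero_le (ε * y)
    nlinarith
  have e2 : ε * h < g₂ * x := Nat.lt_of_mul_lt_mul_left e1
  have hε2 : ε ≤ g₂ := by
    by_contra! hc
    have : g₂ * x ≤ ε * h := Nat.mul_le_mul hc.le (hx.trans hg)
    omega
  refine Or.inr (Or.inr (Or.inr (Or.inl ⟨hsq, ?_, hT.trans ?_⟩)))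
  · rw [hM, hX, hY]
    exact mul_lt_sq_mul_of_le hx hg hε2 hy1
  · have := le_balancedValue (X := Y) (α := 0) (x := y)
      (show M = g₂ * g₁ + ε by rw [hM, mul_comm g₁]) (hε.le.trans hx) hX hx
      (by rw [hY, mul_comm]; omega) (Nat.zero_le _) hy
    refine le_trans (le_of_eq ?_) this
    ring

/-- The core `g₁ × g₂ × h` with an extra vertex of the third color. -/
theorem isCovered_of_box {M a b n X Y T g₁ g₂ h ε x y : ℕ} (s : SearchCondition M a b n X Y)
    (hn : h < n) (hga : g₁ ≤ a) (hgb : g₂ ≤ b) (hM : M = g₁ * g₂ + ε)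
    (hX : X = h * g₁ + x) (hY : Y = h * g₂ + y) (hx : x ≤ g₁) (hx1 : 1 ≤ x)
    (hy : y ≤ g₂) (hy1 : 1 ≤ y) (hεy : 0 < ε → g₁ = a ∨ ε < y) (hεx : 0 < ε → g₂ = b ∨ ε < x)
    (hT : T ≤ g₁ * g₂ * h + x * y) : IsCovered M a b n X Y T := by
  rcases le_total (g₁ * y) (g₂ * x) with hxy | hxy
  · exact isCovered_of_box_aux s hn hga hgb hM hX hY hx hx1 hy hy1 hεy hεx hT hxy
  · exact (isCovered_of_box_aux s.symm hn hgb hga (by rw [hM, mul_comm g₁]) hY hX hy hy1 hx hx1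
      hεx hεy (by rw [mul_comm g₂, mul_comm y]; exact hT) hxy).symm

/-- The case of `isCovered_of_cut` in which `√(M X / Y) < g₁`. -/
theorem isCovered_of_cut_aux {M a b n X Y T g₁ g₂ h η x y : ℕ} (s : SearchCondition M a b n X Y)
    (hn : h < n) (hga : g₁ ≤ a) (hgb : g₂ ≤ b) (hM : M + η = g₁ * g₂) (hη : η ≤ g₂)
    (hη0 : 0 < η)
    (hX : X = h * g₁ + x) (hY : Y = h * g₂ + y) (hx : x < g₁) (hy : y < g₂)
    (hT : T ≤ M * h + x * y) (hlt : M * X < g₁ ^ 2 * Y) :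
    IsCovered M a b n X Y T := by
  obtain ⟨G, rfl⟩ : ∃ G, g₁ = G + 1 := ⟨g₁ - 1, by omega⟩
  have hG : 1 ≤ G := by
    rcases Nat.eq_zero_or_pos G with rfl | h
    · have := s.hYMX; simp at hlt; omega
    · exact h
  obtain ⟨ε, rfl⟩ := Nat.exists_eq_add_of_le hη
  have hM' : M = G * (η + ε) + ε := by
    have : (G + 1) * (η + ε) = G * (η + ε) + ε + η := by ring
    omega
  have hGh : G ≤ h := by
    by_contra! hc
    have := s.hMY
    have : (h + 1) * (η + ε) ≤ G * (η + ε) := Nat.mul_le_mul_right _ hc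
    have : (h + 1) * (η + ε) = h * (η + ε) + (η + ε) := by ring
    omega
  refine isCovered_of_core hn hG (by omega) (by omega) hgb hM' (by omega) (α := h) (x := x)
    (by rw [hX]; ring) hY le_rfl (by omega) hy.le ?_ hlt (Or.inl (by omega)) ?_
  · rw [hM', hX, hY]
    have : G * G * y ≤ G * h * (η + ε) := Nat.mul_le_mul (Nat.mul_le_mul_left _ hGh) hy.le
    have := Nat.zero_le (G * (η + ε) * x)
    have := Nat.zero_le (ε * (h * (G + 1) + x))
    nlinarith
  · refine hT.trans (le_of_eq ?_)
    rw [hM']; ring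

/-- The box `g₁ × g₂ × h` with some edges between the first two colors missing, and an extra
vertex of the third color. -/
theorem isCovered_of_cut {M a b n X Y T g₁ g₂ h η x y : ℕ} (s : SearchCondition M a b n X Y)
    (hn : h < n) (hga : g₁ ≤ a) (hgb : g₂ ≤ b) (hM : M + η = g₁ * g₂) (hη : η ≤ g₂)
    (hη' : η ≤ g₁) (hη0 : 0 < η)
    (hX : X = h * g₁ + x) (hY : Y = h * g₂ + y) (hx : x < g₁) (hy : y < g₂)
    (hT : T ≤ M * h + x * y) : IsCovered M a b n X Y T := by
  by_cases hlt : M * X < g₁ ^ 2 * Y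
  · exact isCovered_of_cut_aux s hn hga hgb hM hη hη0 hX hY hx hy hT hlt
  refine (isCovered_of_cut_aux s.symm hn hgb hga (by rw [hM, mul_comm]) hη' hη0 hY hX hy hx
    (by rw [mul_comm y]; exact hT) ?_).symm
  by_contra hlt'
  push Not at hlt hlt'
  have hMlt : M < g₁ * g₂ := by omega
  have hX0 : 0 < X := s.hM.trans s.hMX
  have hY0 : 0 < Y := s.hM.trans s.hMY
  have e1 : (g₁ * g₂) ^ 2 * (X * Y) ≤ M ^ 2 * (X * Y) := by
    calc (g₁ * g₂) ^ 2 * (X * Y) = (g₁ ^ 2 * Y) * (g₂ ^ 2 * X) := by ring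
      _ ≤ (M * X) * (M * Y) := Nat.mul_le_mul hlt hlt'
      _ = _ := by ring
  have e2 : M ^ 2 * (X * Y) < (g₁ * g₂) ^ 2 * (X * Y) :=
    Nat.mul_lt_mul_of_pos_right (Nat.pow_lt_pow_left hMlt (by omega)) (by positivity)
  omega

/-! ### Normal forms whose last slot has full second factor -/

theorem sum_range_of_tail {F : ℕ → ℕ} {h n : ℕ} (hn : h < n) (tail : ∀ k, h < k → F k = 0) :
    ∑ k ∈ range n, F k = ∑ k ∈ range h, F k + F h := by
  rw [← Finset.sum_range_succ]
  refine (Finset.sum_subset (Finset.range_subset_range.2 hn) fun k _ hk => tail k ?_).symm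
  rw [mem_range] at hk
  omega

/-- `N` terms `G`, one term `x`, and zeros. -/
def stepSeq (N G x k : ℕ) : ℕ := if k < N then G else if k = N then x else 0

theorem sum_stepSeq {N n : ℕ} (hn : N < n) (F : ℕ → ℕ → ℕ) (hF : F 0 0 = 0) (G x g y : ℕ) :
    ∑ k ∈ range n, F (stepSeq N G x k) (stepSeq N g y k) = N * F G g + F x y := by
  rw [sum_range_of_tail hn fun k hk => by simp [stepSeq, hk.not_gt, hk.ne', hF]]
  congr 1
  · rw [Finset.sum_congr rfl fun k hk => by
      rw [stepSeq, stepSeq, if_pos (mem_range.1 hk), if_pos (mem_range.1 hk)]]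
    simp
  · simp [stepSeq]

theorem antitone_stepSeq {N G x : ℕ} (hx : x ≤ G) : Antitone (stepSeq N G x) := by
  intro i j hij
  unfold stepSeq
  split_ifs <;> omega

theorem stepSeq_le {N G x : ℕ} (hx : x ≤ G) (k : ℕ) : stepSeq N G x k ≤ G := by
  unfold stepSeq
  split_ifs <;> omega

theorem feasible_stepSeq {a b n X Y N G g x y : ℕ} (hn : N < n) (hx : x ≤ G) (hy : y ≤ g)
    (hG : G ≤ a) (hg : g ≤ b) (hX : N * G + x ≤ X) (hY : N * g + y ≤ Y) :
    Feasible a b n X Y (stepSeq N G x) (stepSeq N g y) where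
  antiA := antitone_stepSeq hx
  antiB := antitone_stepSeq hy
  leA k := (stepSeq_le hx k).trans hG
  leB k := (stepSeq_le hy k).trans hg
  zeroA k hk := by simp [stepSeq, show ¬ k < N by omega, show k ≠ N by omega]
  zeroB k hk := by simp [stepSeq, show ¬ k < N by omega, show k ≠ N by omega]
  sumA := by rw [sum_stepSeq hn (fun u _ => u) rfl G x G x]; exact hX
  sumB := by rw [sum_stepSeq hn (fun u _ => u) rfl g y g y]; exact hY

/-- The main case of `sq_mul_le_of_wide`: the capacity `M` is smaller than `(G + 1) g₂`. The
hypothesis `cfg` compares `T` with `N` slots `(G, g₂)` and one slot `(x', y)`. -/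
theorem sq_mul_le_of_wide_of_lt {M a b n X Y T G g₂ h x N x' μ : ℕ}
    (s : SearchCondition M a b n X Y) (hga : G + 1 ≤ a) (hgb : g₂ ≤ b) (hM : M = G * g₂ + μ)
    (hμ : μ < g₂) (hμ0 : 0 < μ) (hG : 1 ≤ G)
    (hX : X = h * (G + 1) + x) (hx : x ≤ G + 1)
    (hT1 : T ≤ h * M + M) (hT2 : T ≤ h * M + x * g₂)
    (cfg : ∀ y ≤ g₂, N * g₂ + y ≤ Y → N * (G * g₂) + x' * y ≤ T)
    (hNG : Y ≤ (N + 1) * g₂ → G ≤ N)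
    (hX' : X = N * G + x') (hx' : x' ≤ G) (hx1' : 1 ≤ x') :
    G ^ 2 * Y ≤ M * X ∧ Y ≤ (N + 1) * g₂ := by
  -- the capacity is smaller than `(G + 1) * g₂`, so that `T` is smaller than `g₂ * X`
  have hT3 : T + h * (g₂ - μ) ≤ X * g₂ := by
    obtain ⟨η, rfl⟩ := Nat.exists_eq_add_of_le hμ.le
    rw [Nat.add_sub_cancel_left, hX]
    rw [hM] at hT2
    linarith
  have hT4 : T < X * g₂ := by
    rcases Nat.eq_zero_or_pos h with rfl | h0
    · rcases hx.lt_or_eq with hx | hx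
      · exfalso
        have : M ≤ X := s.hMX
        have : G ≤ G * g₂ := Nat.le_mul_of_pos_right _ (by omega)
        omega
      · rw [hX, hx]; rw [hM] at hT1; linarith
    · have : 0 < h * (g₂ - μ) := Nat.mul_pos h0 (by omega)
      omega
  have hYlt : Y < (N + 1) * g₂ := by
    by_contra! hc
    have := cfg g₂ le_rfl (by linarith)
    rw [hX'] at hT4
    have : N * (G * g₂) + x' * g₂ = (N * G + x') * g₂ := by ring
    omega
  refine ⟨?_, hYlt.le⟩
  have hGN := hNG hYlt.le
  rcases le_or_gt Y (N * g₂) with hc | hc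
  · rw [hM, hX']
    have : G ^ 2 * Y ≤ G ^ 2 * (N * g₂) := Nat.mul_le_mul_left _ hc
    have := Nat.zero_le (G * g₂ * x' + μ * (N * G + x'))
    linarith
  obtain ⟨y, rfl⟩ := Nat.exists_eq_add_of_le hc.le
  have hy : y < g₂ := by linarith
  have key : G * G * y ≤ G * g₂ * x' + μ * G * N := by
    rcases le_or_gt y μ with hyμ | hyμ
    · have : G * G * y ≤ N * G * μ := Nat.mul_le_mul (Nat.mul_le_mul_right _ hGN) hyμ
      have := Nat.zero_le (G * g₂ * x')
      linarith
    rcases hx'.lt_or_eq with hxG | hxG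
    · exfalso
      have c := cfg y hy.le le_rfl
      obtain ⟨z, rfl⟩ := Nat.exists_eq_add_of_le hy.le
      have c2 : h * (y + z - μ) ≤ x' * z := by
        rw [hX'] at hT3
        generalize y + z - μ = r at *
        linarith
      have c3 : h < x' := by
        by_contra! hc
        have : x' * z < h * (y + z - μ) := by
          calc x' * z < x' * (y + z - μ) := Nat.mul_lt_mul_of_pos_left (by omega) hx1'
            _ ≤ _ := Nat.mul_le_mul_right _ hc
        omega
      have c4 : X ≤ (h + 1) * (G + 1) := by rw [hX]; linarith
      have c5 : (h + 1) * (G + 1) ≤ (G - 1) * (G + 1) := Nat.mul_le_mul_right _ (by omega)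
      have c6 : G * G ≤ N * G := Nat.mul_le_mul_right _ hGN
      obtain ⟨w, rfl⟩ := Nat.exists_eq_add_of_le hG
      rw [Nat.add_sub_cancel_left] at c5
      linarith
    · rw [hxG]
      have : G * G * y ≤ G * G * g₂ := Nat.mul_le_mul_left _ hy.le
      have := Nat.zero_le (μ * G * N)
      linarith
  rw [hM, hX']
  have := Nat.zero_le (μ * x')
  linarith

/-- In the situation of `isCovered_of_wide`, the optimality of the value `T` is compared with
slots `(g₁ - 1, g₂)` to bound `g₁ - 1` by `√(M X / Y)`. -/
theorem sq_mul_le_of_wide {M a b n X Y T G g₂ h x N x' μ : ℕ} (s : SearchCondition M a b n X Y)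
    (hga : G + 1 ≤ a) (hgb : g₂ ≤ b) (hM : M = G * g₂ + μ) (hμ : μ ≤ g₂) (hμ0 : 0 < μ)
    (hG : 1 ≤ G)
    (hX : X = h * (G + 1) + x) (hx : x ≤ G + 1)
    (hY : (h + 1) * g₂ ≤ Y) (hT1 : T ≤ h * M + M) (hT2 : T ≤ h * M + x * g₂)
    (hopt : ∀ A B, Feasible a b n X Y A B → seqValue M n A B ≤ T)
    (hN : N < n) (hX' : X = N * G + x') (hx' : x' ≤ G) (hx1' : 1 ≤ x') :
    G ^ 2 * Y ≤ M * X ∧ Y ≤ (N + 1) * g₂ := by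
  have hMG : G * g₂ < M := by omega
  have hMx : ∀ u v, u ≤ G → v ≤ g₂ → min M (u * v) = u * v := fun u v hu hv =>
    min_eq_right ((Nat.mul_le_mul hu hv).trans hMG.le)
  have cfg : ∀ y ≤ g₂, N * g₂ + y ≤ Y → N * (G * g₂) + x' * y ≤ T := by
    intro y hy hyY
    have := hopt _ _ (feasible_stepSeq (a := a) (b := b) hN hx' hy (by omega) hgb hX'.ge hyY)
    rw [seqValue, sum_stepSeq hN (fun u v => min M (u * v)) (by simp)] at this
    rwa [hMx G g₂ le_rfl le_rfl, hMx x' y hx' hy] at this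
  have hNG : Y ≤ (N + 1) * g₂ → G ≤ N := by
    intro hle
    by_contra! hc
    have := s.hMY
    have : (N + 1) * g₂ ≤ G * g₂ := Nat.mul_le_mul_right _ hc
    omega
  rcases hμ.lt_or_eq with hμ | rfl
  · exact sq_mul_le_of_wide_of_lt s hga hgb hM hμ hμ0 hG hX hx hT1 hT2 cfg hNG hX' hx' hx1'
  have hgb' : μ < b := by
    rcases hgb.lt_or_eq with hgb | hgb
    · exact hgb
    · exfalso
      subst hgb
      have := s.symm.test_a (p := G + 1) (q := h + 1) (by rw [hM]; linarith) hY
      rw [hX] at this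
      linarith
  -- otherwise `N` slots `(G, μ)` and one slot `(x', μ)`, with one more unit of the second kind in
  -- the first slot, are better than `T`
  have hYle : Y ≤ (N + 1) * μ := by
    by_contra! hc
    have f := feasible_stepSeq (a := a) (b := b) hN hx' le_rfl (by omega) hgb hX'.ge
      (show N * μ + μ ≤ Y by linarith)
    have hs := sum_stepSeq hN (fun _ v => v) rfl G x' μ μ
    have f2 := f.symm.add (k := 0) (w := 1) (by omega) (by simp)
      (by have := stepSeq_le (N := N) (le_refl μ) 0; omega) (by linarith)
    have o := hopt _ _ f2.symm
    have e := seqValue_update M (stepSeq N μ μ) (stepSeq N G x') (k := 0) (n := n) (by omega)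
      (stepSeq N μ μ 0 + 1)
    rw [seqValue_comm, seqValue_comm M n (stepSeq N μ μ)] at e
    have e2 : seqValue M n (stepSeq N G x') (stepSeq N μ μ) = N * (G * μ) + x' * μ := by
      rw [seqValue, sum_stepSeq hN (fun u v => min M (u * v)) (by simp),
        hMx G μ le_rfl le_rfl, hMx x' μ hx' le_rfl]
    have e3 : stepSeq N μ μ 0 = μ := by unfold stepSeq; split_ifs <;> omega
    have e4 : 1 ≤ stepSeq N G x' 0 := by unfold stepSeq; split_ifs <;> omega
    have e5 := stepSeq_le (N := N) hx' 0
    rw [e3] at e o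
    set u := stepSeq N G x' 0
    have e6 : min M (μ * u) = μ * u := by rw [mul_comm]; exact hMx u μ e5 le_rfl
    have e7 : μ * u < min M ((μ + 1) * u) := by
      have : u * μ ≤ G * μ := Nat.mul_le_mul_right _ e5
      refine lt_min ?_ ?_ <;> linarith
    have e8 : T ≤ N * (G * μ) + x' * μ := by
      refine hT2.trans (le_of_eq ?_)
      have : N * (G * μ) + x' * μ = X * μ := by rw [hX']; ring
      rw [this, hM, hX]; ring
    omega
  refine ⟨?_, hYle⟩
  have hGN := hNG hYle
  rw [hM, hX']
  have h1 : G ^ 2 * Y ≤ G ^ 2 * ((N + 1) * μ) := Nat.mul_le_mul_left _ hYle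
  have h2 : G * G * μ ≤ N * G * μ := Nat.mul_le_mul_right _ (Nat.mul_le_mul_right _ hGN)
  have := Nat.zero_le (G * μ * x' + μ * x')
  linarith

/-- The box `g₁ × g₂ × h`, possibly with some edges between the first two colors missing, and an
extra vertex of the third color that is adjacent to all `g₂` vertices of the second color. -/
theorem isCovered_of_wide {M a b n X Y T g₁ g₂ h x : ℕ} (s : SearchCondition M a b n X Y)
    (hn : h < n) (hga : g₁ ≤ a) (hgb : g₂ ≤ b) (hM : M ≤ g₁ * g₂) (hM' : (g₁ - 1) * g₂ < M)
    (hX : X = h * g₁ + x) (hx : x ≤ g₁) (hY : (h + 1) * g₂ ≤ Y)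
    (hlt : M * X < g₁ ^ 2 * Y) (hT1 : T ≤ h * M + M) (hT2 : T ≤ h * M + x * g₂)
    (hopt : ∀ A B, Feasible a b n X Y A B → seqValue M n A B ≤ T)
    (hflat : n * g₂ ≤ Y → T ≤ balancedValue M X Y n) : IsCovered M a b n X Y T := by
  have hYMX := s.hYMX
  obtain ⟨G, rfl⟩ : ∃ G, g₁ = G + 1 := ⟨g₁ - 1, by
    rcases Nat.eq_zero_or_pos g₁ with rfl | h0
    · simp at hlt
    · omega⟩
  have hG : 1 ≤ G := by
    rcases Nat.eq_zero_or_pos G with rfl | h0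
    · simp at hlt; omega
    · exact h0
  rw [Nat.add_sub_cancel] at hM'
  obtain ⟨μ, hμ⟩ := Nat.exists_eq_add_of_le hM'.le
  have hμ2 : μ ≤ g₂ := by linarith
  have hμ0 : 0 < μ := by omega
  have hX0 : 1 ≤ X := s.hM.trans s.hMX
  have hg0 : 1 ≤ g₂ := by omega
  obtain ⟨N, x', hX', hx', hx1'⟩ : ∃ N x', X = N * G + x' ∧ x' ≤ G ∧ 1 ≤ x' := by
    refine ⟨(X - 1) / G, (X - 1) % G + 1, ?_, Nat.mod_lt _ hG, by omega⟩
    have := Nat.div_add_mod' (X - 1) G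
    omega
  have hwide := fun hN => sq_mul_le_of_wide s hga hgb hμ hμ2 hμ0 hG hX hx hY hT1 hT2 hopt
    (N := N) hN hX' hx' hx1'
  -- if every vertex of the third color can have `g₂` neighbors, all of them are core vertices
  rcases le_or_gt (n * g₂) Y with hc | hYn
  · have h1 : n ≤ n * g₂ := Nat.le_mul_of_pos_right _ hg0
    refine Or.inr (Or.inr (Or.inl ⟨?_, h1.trans hc, hflat hc⟩))
    by_contra! hn'
    have hNG : N ≤ N * G := Nat.le_mul_of_pos_right _ hG
    have h2 := (hwide (by omega)).2
    have h3 : (N + 2) * g₂ ≤ n * g₂ := Nat.mul_le_mul_right _ (by omega)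
    have : (N + 2) * g₂ = (N + 1) * g₂ + g₂ := by ring
    omega
  -- otherwise `(G, g₂)` is a good size
  have key : G ^ 2 * Y ≤ M * X ∧ ∃ h, Y ≤ (h + 1) * g₂ ∧ G * h ≤ X := by
    rcases le_or_gt n N with hc | hc
    · constructor
      · have h1 : G ^ 2 * Y ≤ G ^ 2 * (n * g₂) := Nat.mul_le_mul_left _ hYn.le
        have h2 : G * n * (G * g₂) ≤ X * M := by
          refine Nat.mul_le_mul ?_ hM'.le
          rw [hX', mul_comm]
          have := Nat.mul_le_mul_right G hc
          omega
        linarith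
      · refine ⟨n - 1, by rw [Nat.sub_add_cancel s.n_pos]; exact hYn.le, ?_⟩
        have : G * (n - 1) ≤ G * N := Nat.mul_le_mul_left _ (by omega)
        rw [hX', mul_comm N]; omega
    · obtain ⟨k1, k2⟩ := hwide hc
      exact ⟨k1, N, k2, by rw [hX', mul_comm N]; omega⟩
  have hXh : X ≤ (G + 1) * (h + 1) := by rw [hX]; linarith
  refine Or.inl ⟨G, g₂, ⟨hG, hg0, key.1, hlt, by omega, hgb, hM'.le, hM,
    by rw [mul_comm]; exact hYn.le, hXh.trans (Nat.mul_le_mul_left _ hn), key.2,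
    ⟨h, by linarith, hXh⟩⟩, Or.inl (by omega), ?_⟩
  -- the balanced slots for `(G, g₂)` contain a core `G × g₂ × K`, unless all of them reach `X`
  obtain ⟨K, y, hK, hy⟩ : ∃ K y, Y = K * g₂ + y ∧ y < g₂ :=
    ⟨Y / g₂, Y % g₂, (Nat.div_add_mod' Y g₂).symm, Nat.mod_lt _ hg0⟩
  have hKh : h + 1 ≤ K := by
    by_contra! hc
    have : (K + 1) * g₂ ≤ (h + 1) * g₂ := Nat.mul_le_mul_right _ hc
    have : (K + 1) * g₂ = K * g₂ + g₂ := by ring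
    omega
  rcases le_or_gt (G * K) X with hc | hc
  · obtain ⟨α, hα⟩ := Nat.exists_eq_add_of_le hc
    have hαK : α ≤ K := by
      have : (G + 1) * (h + 1) ≤ (G + 1) * K := Nat.mul_le_mul_left _ hKh
      have : (G + 1) * K = G * K + K := by ring
      omega
    have := le_balancedValue (x := 0) hμ hμ2 hK hy.le
      (show G * K + α + 0 ≤ X by rw [hα, add_zero]) hαK (Nat.zero_le _)
    refine le_trans ?_ this
    obtain ⟨δ, rfl⟩ := Nat.exists_eq_add_of_le hKh
    have e : h + x = G + G * δ + α := by
      have : h * (G + 1) + x = G * (h + 1 + δ) + α := by rw [← hX, hα]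
      linarith
    have e1 : G * δ * μ ≤ G * δ * g₂ := Nat.mul_le_mul_left _ hμ2
    rcases hx.lt_or_eq with hx | hx
    · obtain ⟨w, rfl⟩ := Nat.exists_eq_add_of_le (show x ≤ G by omega)
      have e2 : h = w + (x + w) * δ + α := by omega
      have e3 : w * μ ≤ w * g₂ := Nat.mul_le_mul_left _ hμ2
      have e4 : h * μ = w * μ + (x + w) * δ * μ + α * μ := by
        conv_lhs => rw [e2]
        ring
      rw [hμ] at hT2
      refine hT2.trans ?_
      linarith
    · have e2 : h + 1 = G * δ + α := by omega
      have e4 : h * μ + μ = G * δ * μ + α * μ := by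
        calc h * μ + μ = (h + 1) * μ := by ring
          _ = _ := by rw [e2]; ring
      rw [hμ] at hT1
      refine hT1.trans ?_
      linarith
  · have h1 : ∀ k ∈ range g₂, X ≤ min X (balanced M g₂ k * balanced Y g₂ k) := fun k _ => by
      refine le_min le_rfl (hc.le.trans (Nat.mul_le_mul (le_balanced hM'.le hg0)
        (le_balanced (by omega) hg0)))
    have h2 : g₂ * X ≤ balancedValue X M Y g₂ := by
      have := Finset.card_nsmul_le_sum _ _ _ h1
      rwa [smul_eq_mul, card_range] at this
    refine le_trans (hT2.trans ?_) h2
    have : h * M ≤ h * ((G + 1) * g₂) := Nat.mul_le_mul_left _ hM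
    rw [hX]
    linarith

/-! ### Optimal pairs are covered by balanced slots -/

namespace NormalForm

variable {M a b n X Y : ℕ} {A B : ℕ → ℕ} {h α g₁ g₂ x y : ℕ}

theorem a_le (f : NormalForm M a b n X Y A B h α g₁ g₂ x y) : α ≤ h := by
  rcases f.hα with h0 | h0 <;> omega

theorem sum_A (f : NormalForm M a b n X Y A B h α g₁ g₂ x y) :
    ∑ k ∈ range n, A k = h * g₁ + α + x := by
  rw [sum_range_of_tail f.hn fun k hk => (f.tail k hk).1, f.lastA,
    Finset.sum_congr rfl fun k hk => f.eqA k (mem_range.1 hk), Finset.sum_add_distrib,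
    sum_ite_lt, min_eq_left f.a_le]
  simp

theorem sum_B (f : NormalForm M a b n X Y A B h α g₁ g₂ x y) :
    ∑ k ∈ range n, B k = h * g₂ + y := by
  rw [sum_range_of_tail f.hn fun k hk => (f.tail k hk).2, f.lastB,
    Finset.sum_congr rfl fun k hk => f.eqB k (mem_range.1 hk)]
  simp

theorem B_le (f : NormalForm M a b n X Y A B h α g₁ g₂ x y) (k : ℕ) : B k ≤ g₂ := by
  rcases lt_trichotomy k h with hk | rfl | hk
  · exact (f.eqB k hk).le
  · exact f.lastB.le.trans f.hyg
  · rw [(f.tail k hk).2]; omega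

theorem seqValue_eq (f : NormalForm M a b n X Y A B h α g₁ g₂ x y) :
    seqValue M n A B =
      ∑ k ∈ range h, min M ((g₁ + if k < α then 1 else 0) * g₂) + min M (x * y) := by
  rw [seqValue, sum_range_of_tail f.hn fun k hk => by simp [f.tail k hk], f.lastA, f.lastB]
  congr 1
  exact Finset.sum_congr rfl fun k hk => by
    rw [f.eqA k (mem_range.1 hk), f.eqB k (mem_range.1 hk)]

theorem seqValue_zero (f : NormalForm M a b n X Y A B h 0 g₁ g₂ x y) :
    seqValue M n A B = h * min M (g₁ * g₂) + min M (x * y) := by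
  rw [f.seqValue_eq]
  simp

/-- If all vertices of the third color can have `g₂` neighbors of the second color, it is best to
balance. -/
theorem le_flat (f : NormalForm M a b n X Y A B h α g₁ g₂ x y) (hY : n * g₂ ≤ Y) :
    seqValue M n A B ≤ balancedValue M X Y n :=
  seqValue_le_balancedValue ((Nat.zero_le h).trans_lt f.hn) f.sumA f.B_le hY

theorem symm (f : NormalForm M a b n X Y A B h 0 g₁ g₂ x y) :
    NormalForm M b a n Y X B A h 0 g₂ g₁ y x where
  toIsOptimal := f.toIsOptimal.symm
  hn := f.hn
  eqA k hk := by rw [f.eqB k hk]; simp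
  eqB k hk := by rw [f.eqA k hk]; simp
  lastA := f.lastB
  lastB := f.lastA
  tail k hk := (f.tail k hk).symm
  hx := f.hy
  hxg := f.hyg
  hy := f.hx
  hyg := f.hxg
  hga := f.hgb
  hgb := f.hga
  hα := Or.inl rfl
  single h0 := (f.single h0).symm
  extra h0 := absurd h0 (lt_irrefl 0)

/-- The case in which some slots have an extra unit of the first kind. -/
theorem isCovered_of_pos (s : SearchCondition M a b n X Y)
    (f : NormalForm M a b n X Y A B h α g₁ g₂ x y) (hα : 0 < α) :
    IsCovered M a b n X Y (seqValue M n A B) := by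
  obtain ⟨e1, e2, e3⟩ := f.extra hα
  obtain ⟨ε, hε⟩ := Nat.exists_eq_add_of_le e2.le
  have hαh : α < h := by rcases f.hα with h0 | h0 <;> omega
  have hx := f.hx
  have hxg := f.hxg
  have hy := f.hy
  have hyg := f.hyg
  have hgb := f.hgb
  have hxy : x * y ≤ g₁ * g₂ := Nat.mul_le_mul hxg hyg
  have eA : ∀ k < h, α ≤ k → A k = g₁ := fun k hk hka => by
    rw [f.eqA k hk, if_neg (by omega), add_zero]
  have eA' : ∀ k < α, A k = g₁ + 1 := fun k hk => by rw [f.eqA k (by omega), if_pos hk]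
  have eAα := eA α hαh le_rfl
  have hl : ∀ i, α - 1 < i → A i < A (α - 1) := fun i hi => by
    rw [eA' (α - 1) (by omega)]
    rcases lt_trichotomy i h with hk | rfl | hk
    · rw [eA i hk (by omega)]; omega
    · rw [f.lastA]; omega
    · rw [(f.tail i hk).1]; omega
  have g12 : (g₁ + 1) * g₂ = g₁ * g₂ + g₂ := by ring
  have hX : X = h * g₁ + α + x := by
    rw [← f.sum_A]
    refine le_antisymm ?_ f.sumA
    by_contra! hc
    have := f.add_le (k := α) (hαh.trans f.hn) (fun i hi => by rw [eAα, eA' i hi]; omega)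
      (by rw [eAα]; exact e1) hc
    rw [eAα, f.eqB α hαh, g12] at this
    omega
  have hT : seqValue M n A B = g₁ * g₂ * h + α * ε + x * y := by
    rw [f.seqValue_eq, min_eq_right (a := M) (b := x * y) (by omega)]
    congr 1
    have : ∀ k ∈ range h, min M ((g₁ + if k < α then 1 else 0) * g₂) =
        g₁ * g₂ + ε * if k < α then 1 else 0 := fun k _ => by
      split_ifs
      · rw [g12, mul_one]; omega
      · rw [add_zero, mul_zero]; omega
    rw [Finset.sum_congr rfl this, Finset.sum_add_distrib, Finset.sum_const, ← Finset.mul_sum,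
      sum_ite_lt, min_eq_left hαh.le, card_range, smul_eq_mul]
    ring
  -- if units of the second kind are left over, the last slot is `(g₁, g₂)`
  rcases f.sumB.lt_or_eq with hc | hc
  · have hyg2 : y = g₂ := by
      by_contra hne
      have := f.toIsOptimal.symm.add_le (k := h) f.hn
        (fun i hi => by rw [f.lastB, f.eqB i hi]; omega) (by rw [f.lastB]; omega) hc
      rw [f.lastA, f.lastB] at this
      have e : (y + 1) * x = x * y + x := by ring
      rw [e, mul_comm y] at this
      omega
    subst hyg2
    have hxg1 : x = g₁ := by
      by_contra hne
      have := f.toIsOptimal.move (k := h) (l := α - 1) f.hn (by have := f.hn; omega) (by omega)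
        (fun i hi => by rw [f.lastA, f.eqA i hi]; omega) (by rw [f.lastA]; omega) hl
        (fun _ => by rw [f.lastA, eA' (α - 1) (by omega)]; omega)
        (by rw [eA' (α - 1) (by omega)]; omega)
      rw [f.lastA, f.lastB, eA' (α - 1) (by omega), f.eqB (α - 1) (by omega),
        Nat.add_sub_cancel, g12] at this
      have e : (x + 1) * y = x * y + y := by ring
      have e' : (x + 1) * y ≤ g₁ * y := Nat.mul_le_mul_right _ (by omega)
      omega
    subst hxg1
    rw [f.sum_B] at hc
    rcases (show h + 1 ≤ n from f.hn).eq_or_lt with hn | hn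
    · have h1 : h ≤ h * x := Nat.le_mul_of_pos_right _ hx
      have h2 : h ≤ h * y := Nat.le_mul_of_pos_right _ hy
      refine Or.inr (Or.inr (Or.inl ⟨by omega, by omega, f.le_flat ?_⟩))
      rw [← hn]; linarith
    obtain ⟨υ, hυ⟩ := Nat.exists_eq_add_of_le hc.le
    have hυε : υ ≤ ε := by
      by_contra! hlt
      have := f.toIsOptimal.new_slot (k := h + 1) (l := α - 1) (w := ε + 1) hn (by omega)
        (f.tail _ (by omega)).1 (f.tail _ (by omega)).2
        (fun i hi => by
          rcases (show i < h ∨ i = h by omega) with hk | rfl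
          · rw [f.eqA i hk, f.eqB i hk]; omega
          · rw [f.lastA, f.lastB]; omega) hl (by rw [eA' (α - 1) (by omega)]; omega)
        (by rw [f.sum_B]; omega)
      rw [eA' (α - 1) (by omega), f.eqB (α - 1) (by omega), Nat.add_sub_cancel, g12] at this
      have : 0 < x * y := Nat.mul_pos hx hy
      omega
    refine isCovered_of_leftover s (N := h + 1) (α := α) hn hx e1 hgb hε (by rw [hX]; ring)
      (by rw [hυ]; ring) (by omega) (by omega) hυε (by omega) (hT.le.trans (le_of_eq ?_))
    ring
  · rw [f.sum_B] at hc
    exact isCovered_of_extra s f.hn e1 hgb hε hX hc.symm hαh hxg hx hyg (by omega) (by omega) hT.le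

theorem eq_zero (f : NormalForm M a b n X Y A B h 0 g₁ g₂ x y) : A 0 = g₁ ∧ B 0 = g₂ := by
  rcases Nat.eq_zero_or_pos h with rfl | h0
  · rw [f.lastA, f.lastB]; exact f.single rfl
  · rw [f.eqA 0 h0, f.eqB 0 h0]; simp

/-- The slots are not filled beyond the capacity, since a unit could be discarded. -/
theorem pred_mul_lt (f : NormalForm M a b n X Y A B h 0 g₁ g₂ x y) (hc : x < g₁ ∨ y = g₂) :
    (g₁ - 1) * g₂ < M := by
  have hx := f.hx
  have hxg := f.hxg
  have hn := f.hn
  by_cases hxg1 : x = g₁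
  · have hy : y = g₂ := by omega
    have := f.discard (l := h) f.hn (fun i hi => by rw [(f.tail i hi).1, f.lastA]; omega)
      (by rw [f.lastA]; omega)
    rw [f.lastA, f.lastB, hxg1, hy] at this
    omega
  · have h0 : h ≠ 0 := fun h0 => hxg1 (f.single h0).1
    have e : A (h - 1) = g₁ := by rw [f.eqA (h - 1) (by omega)]; simp
    have := f.discard (l := h - 1) (by omega) (fun i hi => by
      rw [e]
      rcases (show i = h ∨ h < i by omega) with rfl | hk
      · rw [f.lastA]; omega
      · rw [(f.tail i hk).1]; omega) (by omega)
    rw [e, f.eqB (h - 1) (by omega)] at this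
    omega

/-- If units of the first kind are left over, then no slot can make use of one. -/
theorem of_sum_lt (f : NormalForm M a b n X Y A B h 0 g₁ g₂ x y) (hX : h * g₁ + x < X) :
    x = g₁ ∧ (g₁ = a ∨ M ≤ g₁ * g₂) := by
  have hxg := f.hxg
  have hga := f.hga
  have hy := f.hy
  have hyg := f.hyg
  have hX' : ∑ k ∈ range n, A k < X := by rw [f.sum_A]; omega
  have hx : x = g₁ := by
    by_contra hne
    have d := f.pred_mul_lt (Or.inl (by omega))
    have := f.add_le (k := h) f.hn (fun i hi => by rw [f.lastA, f.eqA i hi]; omega)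
      (by rw [f.lastA]; omega) hX'
    rw [f.lastA, f.lastB] at this
    have e : (x + 1) * y = x * y + y := by ring
    have e' : x * y ≤ (g₁ - 1) * g₂ := Nat.mul_le_mul (by omega) hyg
    omega
  refine ⟨hx, ?_⟩
  by_contra! hc
  obtain ⟨z1, z2⟩ := f.eq_zero
  have := f.add_le (k := 0) ((Nat.zero_le h).trans_lt f.hn) (by simp) (by omega) hX'
  rw [z1, z2] at this
  have e : (g₁ + 1) * g₂ = g₁ * g₂ + g₂ := by ring
  omega

theorem isCovered_wide (s : SearchCondition M a b n X Y)
    (f : NormalForm M a b n X Y A B h 0 g₁ g₂ x g₂) (hM : M ≤ g₁ * g₂) (hX : X = h * g₁ + x)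
    (hlt : M < g₁ * g₂ ∨ (h + 1) * g₂ < Y) : IsCovered M a b n X Y (seqValue M n A B) := by
  have hY : (h + 1) * g₂ ≤ Y := by
    have := f.sumB
    rw [f.sum_B] at this
    linarith
  have hT := f.seqValue_zero
  have hmin : h * min M (g₁ * g₂) ≤ h * M := Nat.mul_le_mul_left _ (min_le_left _ _)
  have hx := f.hx
  have hxg := f.hxg
  have hXg : X ≤ g₁ * (h + 1) := by rw [hX]; linarith
  refine isCovered_of_wide s f.hn f.hga f.hgb hM (f.pred_mul_lt (Or.inr rfl)) hX f.hxg hY ?_ ?_ ?_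
    (fun _ _ h' => f.opt _ _ h') f.le_flat
  · rcases hlt with hlt | hlt
    · calc M * X < g₁ * g₂ * X := Nat.mul_lt_mul_of_pos_right hlt (s.hM.trans s.hMX)
        _ ≤ g₁ * g₂ * (g₁ * (h + 1)) := Nat.mul_le_mul_left _ hXg
        _ = g₁ ^ 2 * ((h + 1) * g₂) := by ring
        _ ≤ _ := Nat.mul_le_mul_left _ hY
    · calc M * X ≤ g₁ * g₂ * (g₁ * (h + 1)) := Nat.mul_le_mul hM hXg
        _ = g₁ ^ 2 * ((h + 1) * g₂) := by ring
        _ < _ := Nat.mul_lt_mul_of_pos_left hlt (pow_pos (by omega) 2)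
  · have := min_le_left M (x * g₂)
    omega
  · have := min_le_right M (x * g₂)
    omega

/-- Units of both kinds cannot be left over: there would be a further slot, or the vertex test for
the third color would succeed. -/
theorem false_of_leftover (s : SearchCondition M a b n X Y)
    (f : NormalForm M a b n X Y A B h 0 g₁ g₂ x y) (hX : h * g₁ + x < X) (hY : h * g₂ + y < Y) :
    False := by
  obtain ⟨rfl, h1⟩ := f.of_sum_lt hX
  obtain ⟨rfl, h2⟩ := f.symm.of_sum_lt hY
  have hx := f.hx
  have hy := f.hy
  rcases (show h + 1 ≤ n from f.hn).eq_or_lt with hn | hn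
  · have := s.test_n (p := x) (q := y) (by rw [← hn]; linarith) (by rw [← hn]; linarith)
    rw [mul_comm y] at h2
    have h1' : x = a := by omega
    have h2' : y = b := by omega
    have hab := s.hMab
    rw [← h1', ← h2'] at hab
    omega
  · exact f.not_add_both (k := h + 1) s.hM s.a_pos s.symm.a_pos hn (f.tail _ (by omega)).1
      (f.tail _ (by omega)).2 (fun i hi => by
        rcases (show i < h ∨ i = h by omega) with hk | rfl
        · rw [f.eqA i hk, f.eqB i hk]; omega
        · rw [f.lastA, f.lastB]; omega) (by rw [f.sum_A]; omega) (by rw [f.sum_B]; omega)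

/-- The case in which only units of the second kind are left over. -/
theorem isCovered_of_right_leftover (s : SearchCondition M a b n X Y)
    (f : NormalForm M a b n X Y A B h 0 g₁ g₂ x y) (hX : X = h * g₁ + x) (hY : h * g₂ + y < Y) :
    IsCovered M a b n X Y (seqValue M n A B) := by
  obtain ⟨rfl, h2⟩ := f.symm.of_sum_lt hY
  rw [mul_comm] at h2
  by_cases hM : M ≤ g₁ * y
  · exact f.isCovered_wide s hM hX (Or.inr (by linarith))
  · exfalso
    -- all vertices of the second color are used, so that its vertex test would succeed
    have hb : y = b := by omega
    subst hb
    have := s.symm.test_a (p := g₁) (q := h + 1) (by omega) (by linarith)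
    have := f.hxg
    linarith

theorem isCovered (s : SearchCondition M a b n X Y)
    (f : NormalForm M a b n X Y A B h α g₁ g₂ x y) : IsCovered M a b n X Y (seqValue M n A B) := by
  rcases Nat.eq_zero_or_pos α with rfl | hα
  swap
  · exact f.isCovered_of_pos s hα
  have sA := f.sumA
  have sB := f.sumB
  rw [f.sum_A, add_zero] at sA
  rw [f.sum_B] at sB
  rcases sA.lt_or_eq with sA | sA <;> rcases sB.lt_or_eq with sB | sB
  · exact (f.false_of_leftover s sA sB).elim
  · rw [seqValue_comm]
    exact (f.symm.isCovered_of_right_leftover s.symm sB.symm sA).symm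
  · exact f.isCovered_of_right_leftover s sA.symm sB
  have hT := f.seqValue_zero
  have hx := f.hx
  have hy := f.hy
  have hxg := f.hxg
  have hyg := f.hyg
  have hga := f.hga
  have hgb := f.hgb
  have hxy : x * y ≤ g₁ * g₂ := Nat.mul_le_mul hxg hyg
  obtain ⟨z1, z2⟩ := f.eq_zero
  rcases le_or_gt (g₁ * g₂) M with hM | hM
  · obtain ⟨ε, hε⟩ := Nat.exists_eq_add_of_le hM
    have hh : 0 < ε → 0 < h := by
      intro h0
      by_contra! hc
      obtain rfl : h = 0 := by omega
      obtain ⟨rfl, rfl⟩ := f.single rfl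
      have := s.hMX
      have : x ≤ x * y := Nat.le_mul_of_pos_right _ hy
      omega
    refine isCovered_of_box s f.hn hga hgb hε sA.symm sB.symm hxg hx hyg hy (fun h0 => ?_)
      (fun h0 => ?_) ?_
    · by_contra! hc
      have := f.near_full f.hn (by rw [f.lastA]; omega) (by rw [f.lastB]; omega)
        (fun k hk => (f.tail k hk).1) (hh h0) (by simp) (by omega)
      rw [z1, z2, f.lastB] at this
      omega
    · by_contra! hc
      have := f.symm.near_full f.hn (by rw [f.lastB]; omega) (by rw [f.lastA]; omega)
        (fun k hk => (f.tail k hk).2) (hh h0) (by simp) (by omega)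
      rw [z1, z2, f.lastA, mul_comm] at this
      omega
    · rw [hT, min_eq_right hM, min_eq_right (hxy.trans hM), mul_comm h]
  · rcases hyg.lt_or_eq with hyg | rfl
    · rcases hxg.lt_or_eq with hxg | rfl
      · have d1 := f.pred_mul_lt (Or.inl hxg)
        have d2 := f.symm.pred_mul_lt (Or.inl hyg)
        obtain ⟨η, hη⟩ := Nat.exists_eq_add_of_le hM.le
        rw [Nat.sub_mul, one_mul] at d1 d2
        rw [mul_comm g₂] at d2
        refine isCovered_of_cut s f.hn hga hgb hη.symm (by omega) (by omega) (by omega) sA.symm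
          sB.symm hxg hyg ?_
        rw [hT, min_eq_left hM.le, mul_comm h]
        have := min_le_right M (x * y)
        omega
      · rw [seqValue_comm]
        exact (f.symm.isCovered_wide s.symm (by rw [mul_comm]; exact hM.le) sB.symm
          (Or.inl (by rw [mul_comm]; exact hM))).symm
    · exact f.isCovered_wide s hM.le sA.symm (Or.inl hM)

end NormalForm

/-- Every pair of degree sequences is covered by the candidates. -/
theorem SearchCondition.isCovered {M a b n X Y : ℕ} (s : SearchCondition M a b n X Y) {A B : ℕ → ℕ}
    (f : Feasible a b n X Y A B) : IsCovered M a b n X Y (seqValue M n A B) := by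
  have mono : ∀ {T T'}, T' ≤ T → IsCovered M a b n X Y T → IsCovered M a b n X Y T' := by
    intro T T' hle hc
    rcases hc with ⟨c, t, h1, h2, h3⟩ | ⟨c, t, h1, h2, h3⟩ | ⟨h1, h2, h3⟩ |
      ⟨h1, h2, h3⟩ | ⟨h1, h2, h3⟩
    · exact Or.inl ⟨c, t, h1, h2, hle.trans h3⟩
    · exact Or.inr (Or.inl ⟨c, t, h1, h2, hle.trans h3⟩)
    · exact Or.inr (Or.inr (Or.inl ⟨h1, h2, hle.trans h3⟩))
    · exact Or.inr (Or.inr (Or.inr (Or.inl ⟨h1, h2, hle.trans h3⟩)))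
    · exact Or.inr (Or.inr (Or.inr (Or.inr ⟨h1, h2, hle.trans h3⟩)))
  obtain ⟨A', B', o⟩ := exists_isOptimal M a b n X Y
  refine mono (o.opt _ _ f) ?_
  obtain ⟨h, α, g₁, g₂, x, y, nf | nf⟩ := o.exists_normalForm s.hM s.a_pos s.symm.a_pos s.n_pos
    (s.hM.trans s.hMX) (s.hM.trans s.hMY)
  · exact nf.isCovered s
  · rw [seqValue_comm]
    exact (nf.isCovered s.symm).symm

/-! ### From complexes to sequences -/

section

variable {α β γ : Type*} [Fintype α] [Fintype β] [Fintype γ]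

open scoped Classical in
/-- The number of elements of `α` that are related to more than `l` elements of `γ`. -/
noncomputable def degreeCount (R : α → γ → Prop) (l : ℕ) : ℕ := #{u | l < #{w | R u w}}

theorem card_pairs (R : α → γ → Prop) : {x : α × γ | R x.1 x.2}.ncard = ∑ u, {w | R u w}.ncard := by
  classical
  have : ∀ u, {w | R u w}.ncard = #{w | R u w} := fun u => by
    rw [← Set.ncard_coe_finset]; simp
  rw [Finset.sum_congr rfl fun u _ => this u, ← Finset.card_sigma, ← Set.ncard_coe_finset]
  refine Set.ncard_congr (fun x _ => ⟨x.1, x.2⟩) ?_ ?_ ?_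
  · intro x hx; simpa using hx
  · rintro ⟨a, b⟩ ⟨a', b'⟩ - - h; simpa using h
  · rintro ⟨a, b⟩ h; exact ⟨(a, b), by simpa using h, rfl⟩

theorem antitone_degreeCount (R : α → γ → Prop) : Antitone (degreeCount R) := by
  classical
  intro l m hlm
  exact Finset.card_le_card (Finset.monotone_filter_right _ fun u _ h => hlm.trans_lt h)

theorem degreeCount_le (R : α → γ → Prop) (l : ℕ) : degreeCount R l ≤ Fintype.card α :=
  Finset.card_le_univ _

theorem degreeCount_eq_zero (R : α → γ → Prop) {l : ℕ} (hl : Fintype.card γ ≤ l) :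
    degreeCount R l = 0 := by
  classical
  rw [degreeCount, Finset.card_eq_zero, Finset.filter_eq_empty_iff]
  intro u _ h
  exact absurd (h.trans_le (Finset.card_le_univ _)) (by omega)

theorem sum_degreeCount (R : α → γ → Prop) :
    ∑ l ∈ range (Fintype.card γ), degreeCount R l = {x : α × γ | R x.1 x.2}.ncard := by
  classical
  rw [card_pairs]
  simp only [degreeCount, Finset.card_filter _ univ]
  rw [Finset.sum_comm]
  refine Finset.sum_congr rfl fun u _ => ?_
  have h : #{w | R u w} ≤ Fintype.card γ := Finset.card_le_univ _
  simp only [Finset.card_filter] at h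
  rw [sum_ite_lt, min_eq_left h, ← Finset.card_filter, ← Set.ncard_coe_finset]
  simp

/-- The number of triangles is bounded in terms of the degrees into the third vertex class: an edge
between the first two classes lies in at most as many triangles as the smaller of the degrees
of its ends. -/
theorem card_triples_le (R : α → β → Prop) (S : α → γ → Prop) (S' : β → γ → Prop)
    (F : Set (α × β × γ)) (hF : ∀ x ∈ F, R x.1 x.2.1 ∧ S x.1 x.2.2 ∧ S' x.2.1 x.2.2) :
    F.ncard ≤ seqValue {x : α × β | R x.1 x.2}.ncard (Fintype.card γ)
      (degreeCount S) (degreeCount S') := by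
  classical
  set E : Finset (α × β) := {x | R x.1 x.2} with hE
  have hEn : {x : α × β | R x.1 x.2}.ncard = #E := by
    rw [← Set.ncard_coe_finset]; simp [hE]
  have h1 : F.ncard ≤ ∑ e ∈ E, #{w | S e.1 w ∧ S' e.2 w} := by
    rw [← Finset.card_sigma, ← Set.ncard_coe_finset]
    refine Set.ncard_le_ncard_of_injOn (fun x => ⟨(x.1, x.2.1), x.2.2⟩) ?_ ?_
      (Finset.finite_toSet _)
    · intro x hx
      have := hF x hx
      simpa [hE] using this
    · rintro ⟨a, b, c⟩ - ⟨a', b', c'⟩ - h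
      simpa [and_assoc] using h
  have h2 : ∀ e ∈ E, #{w | S e.1 w ∧ S' e.2 w} ≤
      ∑ l ∈ range (Fintype.card γ), if l < #{w | S e.1 w} ∧ l < #{w | S' e.2 w} then 1 else 0 := by
    intro e _
    have := sum_ite_lt (Fintype.card γ) (min #{w | S e.1 w} #{w | S' e.2 w})
    simp only [lt_min_iff] at this
    rw [this]
    refine le_min (le_min ?_ ?_) (Finset.card_le_univ _)
    · exact Finset.card_le_card (Finset.monotone_filter_right _ fun w _ h => h.1)
    · exact Finset.card_le_card (Finset.monotone_filter_right _ fun w _ h => h.2)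
  refine (h1.trans (Finset.sum_le_sum h2)).trans ?_
  rw [Finset.sum_comm, seqValue, hEn]
  refine Finset.sum_le_sum fun l _ => ?_
  rw [← Finset.card_filter]
  refine le_min (Finset.card_filter_le _ _) ?_
  rw [degreeCount, degreeCount, ← Finset.card_product]
  refine Finset.card_le_card fun e he => ?_
  simp only [Finset.mem_filter, Finset.mem_product, mem_univ, true_and] at he ⊢
  exact he.2

/-- The counting functions of the degrees are conjugate to the degree sequences. -/
theorem feasible_degreeCount (S : α → γ → Prop) (S' : β → γ → Prop) :
    Feasible (Fintype.card α) (Fintype.card β) (Fintype.card γ) {x : α × γ | S x.1 x.2}.ncard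
      {x : β × γ | S' x.1 x.2}.ncard (degreeCount S) (degreeCount S') where
  antiA := antitone_degreeCount S
  antiB := antitone_degreeCount S'
  leA := degreeCount_le S
  leB := degreeCount_le S'
  zeroA _ := degreeCount_eq_zero S
  zeroB _ := degreeCount_eq_zero S'
  sumA := (sum_degreeCount S).le
  sumB := (sum_degreeCount S').le

end

/-- `φ` enumerates the vertices of color `i` without repetitions. -/
structure ColoredComplex.IsColorClass {n : ℕ} {V α : Type*} (Δ : ColoredComplex n V) (i : Fin n)
    (φ : α → V) : Prop where
  inj : Function.Injective φ
  color_eq : ∀ a, Δ.color (φ a) = i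
  surj : ∀ v, Δ.color v = i → ∃ a, φ a = v

namespace ColoredComplex

variable {n : ℕ} {V α β γ : Type*} {Δ : ColoredComplex n V} {i j k : Fin n}
  {φ : α → V} {ψ : β → V} {χ : γ → V}

theorem flagNumber_singleton (hφ : Δ.IsColorClass i φ) : Δ.flagNumber {i} = Nat.card α := by
  classical
  rw [flagNumber, ← Set.ncard_univ]
  symm
  refine Set.ncard_congr (fun a _ => {φ a}) ?_ ?_ ?_
  · intro a _
    exact ⟨Δ.singleton_mem _, by simp [hφ.color_eq]⟩
  · intro a b _ _ h
    exact hφ.inj (by simpa using h)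
  · rintro s ⟨hs, hc⟩
    obtain ⟨u, hu, hu'⟩ := Finset.mem_image.1 (hc.ge (mem_singleton_self i))
    obtain ⟨a, rfl⟩ := hφ.surj u hu'
    refine ⟨a, Set.mem_univ _, ?_⟩
    ext v
    rw [mem_singleton]
    constructor
    · rintro rfl; exact hu
    · intro hv
      have := hc.le (Finset.mem_image_of_mem _ hv)
      rw [mem_singleton] at this
      exact Δ.injOn_color s hs hv hu (this.trans hu'.symm)

theorem flagNumber_pair [DecidableEq V] (hφ : Δ.IsColorClass i φ) (hψ : Δ.IsColorClass j ψ)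
    (hij : i ≠ j) :
    Δ.flagNumber {i, j} = {x : α × β | ({φ x.1, ψ x.2} : Finset V) ∈ Δ.faces}.ncard := by
  rw [flagNumber]
  symm
  refine Set.ncard_congr (fun x _ => {φ x.1, ψ x.2}) ?_ ?_ ?_
  · intro x hx
    refine ⟨hx, ?_⟩
    simp [Finset.image_insert, hφ.color_eq, hψ.color_eq]
  · rintro ⟨a, b⟩ ⟨a', b'⟩ - - h
    have h1 : φ a ∈ ({φ a', ψ b'} : Finset V) := h ▸ by simp
    have h2 : ψ b ∈ ({φ a', ψ b'} : Finset V) := h ▸ by simp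
    simp only [mem_insert, mem_singleton] at h1 h2
    have e1 : φ a ≠ ψ b' := fun e => hij (by rw [← hφ.color_eq a, e, hψ.color_eq])
    have e2 : ψ b ≠ φ a' := fun e => hij (by rw [← hψ.color_eq b, e, hφ.color_eq])
    rw [hφ.inj (h1.resolve_right e1), hψ.inj (h2.resolve_left e2)]
  · rintro s ⟨hs, hc⟩
    obtain ⟨u, hu, hu'⟩ := Finset.mem_image.1 (hc.ge (mem_insert_self i _))
    obtain ⟨v, hv, hv'⟩ := Finset.mem_image.1 (hc.ge (mem_insert_of_mem (mem_singleton_self j)))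
    obtain ⟨a, rfl⟩ := hφ.surj u hu'
    obtain ⟨b, rfl⟩ := hψ.surj v hv'
    have e : ({φ a, ψ b} : Finset V) = s := by
      ext w
      simp only [mem_insert, mem_singleton]
      constructor
      · rintro (rfl | rfl) <;> assumption
      · intro hw
        have := hc.le (Finset.mem_image_of_mem _ hw)
        simp only [mem_insert, mem_singleton] at this
        rcases this with this | this
        · exact Or.inl (Δ.injOn_color s hs hw hu (this.trans hu'.symm))
        · exact Or.inr (Δ.injOn_color s hs hw hv (this.trans hv'.symm))
    exact ⟨(a, b), show ({φ a, ψ b} : Finset V) ∈ Δ.faces from e ▸ hs, e⟩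

theorem flagNumber_triple [DecidableEq V] (hφ : Δ.IsColorClass i φ) (hψ : Δ.IsColorClass j ψ)
    (hχ : Δ.IsColorClass k χ) (hij : i ≠ j) (hik : i ≠ k) (hjk : j ≠ k) :
    Δ.flagNumber {i, j, k} =
      {x : α × β × γ | ({φ x.1, ψ x.2.1, χ x.2.2} : Finset V) ∈ Δ.faces}.ncard := by
  rw [flagNumber]
  symm
  refine Set.ncard_congr (fun x _ => {φ x.1, ψ x.2.1, χ x.2.2}) ?_ ?_ ?_
  · intro x hx
    refine ⟨hx, ?_⟩
    simp [Finset.image_insert, hφ.color_eq, hψ.color_eq, hχ.color_eq]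
  · rintro ⟨a, b, c⟩ ⟨a', b', c'⟩ - - h
    have h1 : φ a ∈ ({φ a', ψ b', χ c'} : Finset V) := h ▸ by simp
    have h2 : ψ b ∈ ({φ a', ψ b', χ c'} : Finset V) := h ▸ by simp
    have h3 : χ c ∈ ({φ a', ψ b', χ c'} : Finset V) := h ▸ by simp
    simp only [mem_insert, mem_singleton] at h1 h2 h3
    have c1 := hφ.color_eq
    have c2 := hψ.color_eq
    have c3 := hχ.color_eq
    have e1 : φ a = φ a' := by
      rcases h1 with e | e | e
      · exact e
      · exact absurd (by rw [← c1 a, e, c2]) hij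
      · exact absurd (by rw [← c1 a, e, c3]) hik
    have e2 : ψ b = ψ b' := by
      rcases h2 with e | e | e
      · exact absurd (by rw [← c2 b, e, c1]) hij
      · exact e
      · exact absurd (by rw [← c2 b, e, c3]) hjk
    have e3 : χ c = χ c' := by
      rcases h3 with e | e | e
      · exact absurd (by rw [← c3 c, e, c1]) hik
      · exact absurd (by rw [← c3 c, e, c2]) hjk
      · exact e
    rw [hφ.inj e1, hψ.inj e2, hχ.inj e3]
  · rintro s ⟨hs, hc⟩
    obtain ⟨u, hu, hu'⟩ := Finset.mem_image.1 (hc.ge (mem_insert_self i _))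
    obtain ⟨v, hv, hv'⟩ := Finset.mem_image.1 (hc.ge (mem_insert_of_mem (mem_insert_self j _)))
    obtain ⟨w, hw, hw'⟩ := Finset.mem_image.1
      (hc.ge (mem_insert_of_mem (mem_insert_of_mem (mem_singleton_self k))))
    obtain ⟨a, rfl⟩ := hφ.surj u hu'
    obtain ⟨b, rfl⟩ := hψ.surj v hv'
    obtain ⟨c, rfl⟩ := hχ.surj w hw'
    have e : ({φ a, ψ b, χ c} : Finset V) = s := by
      ext z
      simp only [mem_insert, mem_singleton]
      constructor
      · rintro (rfl | rfl | rfl) <;> assumption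
      · intro hz
        have := hc.le (Finset.mem_image_of_mem _ hz)
        simp only [mem_insert, mem_singleton] at this
        rcases this with this | this | this
        · exact Or.inl (Δ.injOn_color s hs hz hu (this.trans hu'.symm))
        · exact Or.inr (Or.inl (Δ.injOn_color s hs hz hv (this.trans hv'.symm)))
        · exact Or.inr (Or.inr (Δ.injOn_color s hs hz hw (this.trans hw'.symm)))
    exact ⟨(a, b, c), show ({φ a, ψ b, χ c} : Finset V) ∈ Δ.faces from e ▸ hs, e⟩

theorem isColorClass_subtype (Δ : ColoredComplex n V) (i : Fin n) :
    Δ.IsColorClass i (Subtype.val : {v // Δ.color v = i} → V) :=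
  ⟨Subtype.val_injective, fun a => a.2, fun v hv => ⟨⟨v, hv⟩, rfl⟩⟩

end ColoredComplex

namespace EdgeData

/-- There is a 3-colored complex with the prescribed numbers of vertices and edges and with `k`
facets. -/
def Realizes (d : EdgeData) (k : ℕ) : Prop :=
  IsFlagVector (d.vert 0) (d.vert 1) (d.vert 2) (d.edge 0 1) (d.edge 0 2) (d.edge 1 2) k

theorem edge_comm (d : EdgeData) (i j : Fin 3) : d.edge i j = d.edge j i := by
  rw [edge, edge, third, third, add_comm]

theorem fin_three_cases {i j k : Fin 3} (hij : i ≠ j) (hik : i ≠ k) (hjk : j ≠ k) :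
    ({0, 1, 2} : Finset (Fin 3)) = {i, j, k} := by
  revert i j k; decide

theorem Realizes.exists_complex {d : EdgeData} {T : ℕ} (h : d.Realizes T) :
    ∃ (V : Type) (_ : Finite V) (Δ : ColoredComplex 3 V),
      (∀ i, Δ.flagNumber {i} = d.vert i) ∧ (∀ i j, i ≠ j → Δ.flagNumber {i, j} = d.edge i j) ∧
      ∀ i j k, i ≠ j → i ≠ k → j ≠ k → Δ.flagNumber {i, j, k} = T := by
  obtain ⟨V, hV, Δ, h0, h1, h2, h01, h02, h12, hT⟩ := h
  refine ⟨V, hV, Δ, ?_, ?_, ?_⟩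
  · intro i; fin_cases i <;> assumption
  · intro i j hij
    fin_cases i <;> fin_cases j <;> first
      | exact absurd rfl hij
      | assumption
      | (rw [Finset.pair_comm, edge_comm]; assumption)
  · intro i j k hij hik hjk
    rw [← fin_three_cases hij hik hjk]; exact hT

/-- The numbers of facets of complexes are values of sequences, for each choice of the color `k`
that plays the third role. -/
theorem Realizes.exists_feasible {d : EdgeData} {T : ℕ} (h : d.Realizes T) {i j k : Fin 3}
    (hij : i ≠ j) (hik : i ≠ k) (hjk : j ≠ k) :
    (∃ A B, Feasible (d.vert i) (d.vert j) (d.vert k) (d.edge i k) (d.edge j k) A B ∧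
      T ≤ seqValue (d.edge i j) (d.vert k) A B) ∧ d.edge i j ≤ d.vert i * d.vert j := by
  classical
  obtain ⟨V, hV, Δ, h1, h2, h3⟩ := h.exists_complex
  have := Fintype.ofFinite V
  have ci := Δ.isColorClass_subtype i
  have cj := Δ.isColorClass_subtype j
  have ck := Δ.isColorClass_subtype k
  have e1 := h1 i
  have e2 := h1 j
  have e3 := h1 k
  have e12 := h2 i j hij
  have e13 := h2 i k hik
  have e23 := h2 j k hjk
  have e := h3 i j k hij hik hjk
  rw [ColoredComplex.flagNumber_singleton ci, Nat.card_eq_fintype_card] at e1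
  rw [ColoredComplex.flagNumber_singleton cj, Nat.card_eq_fintype_card] at e2
  rw [ColoredComplex.flagNumber_singleton ck, Nat.card_eq_fintype_card] at e3
  rw [ColoredComplex.flagNumber_pair ci cj hij] at e12
  rw [ColoredComplex.flagNumber_pair ci ck hik] at e13
  rw [ColoredComplex.flagNumber_pair cj ck hjk] at e23
  rw [ColoredComplex.flagNumber_triple ci cj ck hij hik hjk] at e
  have sub : ∀ s ∈ Δ.faces, ∀ t ⊆ s, t.Nonempty → t ∈ Δ.faces := fun s hs t ht hne =>
    (Δ.isRelLowerSet_faces hs).2 ht hne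
  constructor
  · have f := feasible_degreeCount
      (fun (u : {v // Δ.color v = i}) (w : {v // Δ.color v = k}) =>
        ({u.1, w.1} : Finset V) ∈ Δ.faces)
      (fun (v : {v // Δ.color v = j}) (w : {v // Δ.color v = k}) =>
        ({v.1, w.1} : Finset V) ∈ Δ.faces)
    have c := card_triples_le
      (fun (u : {v // Δ.color v = i}) (v : {v // Δ.color v = j}) =>
        ({u.1, v.1} : Finset V) ∈ Δ.faces)
      (fun (u : {v // Δ.color v = i}) (w : {v // Δ.color v = k}) =>
        ({u.1, w.1} : Finset V) ∈ Δ.faces)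
      (fun (v : {v // Δ.color v = j}) (w : {v // Δ.color v = k}) =>
        ({v.1, w.1} : Finset V) ∈ Δ.faces)
      {x | ({x.1.1, x.2.1.1, x.2.2.1} : Finset V) ∈ Δ.faces} ?_
    · rw [e1, e2, e3, e13, e23] at f
      rw [e3, e12, e] at c
      exact ⟨_, _, f, c⟩
    rintro ⟨u, v, w⟩ hF
    refine ⟨sub _ hF _ ?_ (by simp), sub _ hF _ ?_ (by simp), sub _ hF _ ?_ (by simp)⟩ <;>
    · intro z hz
      simp only [mem_insert, mem_singleton] at hz ⊢
      tauto
  · rw [← e12, ← e1, ← e2, ← Fintype.card_prod, ← Nat.card_eq_fintype_card]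
    exact Set.ncard_le_card _

end EdgeData

/-! ### Realization of flag numbers, and the facets of structured complexes -/

namespace EdgeData

/-- A set of triples whose projections are small enough is the set of facets of a complex with the
prescribed numbers of vertices and edges. -/
theorem realizes_card (d : EdgeData) (ht : d.TrivialInequalities) (K : Finset (ℕ × ℕ × ℕ))
    (hK : ∀ x ∈ K, x.1 < d.vert 0 ∧ x.2.1 < d.vert 1 ∧ x.2.2 < d.vert 2)
    (h01 : #(K.image fun x => (x.1, x.2.1)) ≤ d.edge 0 1)
    (h02 : #(K.image fun x => (x.1, x.2.2)) ≤ d.edge 0 2)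
    (h12 : #(K.image fun x => (x.2.1, x.2.2)) ≤ d.edge 1 2) : d.Realizes #K := by
  have ex : ∀ {i j : Fin 3} (hij : i ≠ j) (I : Finset (ℕ × ℕ)),
      (∀ x ∈ I, x.1 < d.vert i ∧ x.2 < d.vert j) → #I ≤ d.edge i j →
      ∃ E : Finset (ℕ × ℕ), I ⊆ E ∧ (∀ x ∈ E, x.1 < d.vert i ∧ x.2 < d.vert j) ∧
        #E = d.edge i j := by
    intro i j hij I hI hcard
    obtain ⟨E, h1, h2, h3⟩ := Finset.exists_subsuperset_card_eq
      (s := I) (t := range (d.vert i) ×ˢ range (d.vert j)) (n := d.edge i j)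
      (fun x hx => by simpa using hI x hx) hcard (by simpa using ht i j hij)
    exact ⟨E, h1, fun x hx => by simpa using h2 hx, h3⟩
  obtain ⟨E01, s01, l01, c01⟩ := ex (show (0 : Fin 3) ≠ 1 by decide) _ (fun x hx => by
    obtain ⟨y, hy, rfl⟩ := mem_image.1 hx; exact ⟨(hK y hy).1, (hK y hy).2.1⟩) h01
  obtain ⟨E02, s02, l02, c02⟩ := ex (show (0 : Fin 3) ≠ 2 by decide) _ (fun x hx => by
    obtain ⟨y, hy, rfl⟩ := mem_image.1 hx; exact ⟨(hK y hy).1, (hK y hy).2.2⟩) h02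
  obtain ⟨E12, s12, l12, c12⟩ := ex (show (1 : Fin 3) ≠ 2 by decide) _ (fun x hx => by
    obtain ⟨y, hy, rfl⟩ := mem_image.1 hx; exact (hK y hy).2) h12
  let V := Σ i : Fin 3, Fin (d.vert i)
  let Δ : ColoredComplex 3 V :=
    { faces := {s | s.Nonempty ∧ Set.InjOn Sigma.fst (s : Set V) ∧
        (∀ a b, (⟨0, a⟩ : V) ∈ s → (⟨1, b⟩ : V) ∈ s → ((a : ℕ), (b : ℕ)) ∈ E01) ∧
        (∀ a c, (⟨0, a⟩ : V) ∈ s → (⟨2, c⟩ : V) ∈ s → ((a : ℕ), (c : ℕ)) ∈ E02) ∧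
        (∀ b c, (⟨1, b⟩ : V) ∈ s → (⟨2, c⟩ : V) ∈ s → ((b : ℕ), (c : ℕ)) ∈ E12) ∧
        (∀ a b c, (⟨0, a⟩ : V) ∈ s → (⟨1, b⟩ : V) ∈ s → (⟨2, c⟩ : V) ∈ s →
          ((a : ℕ), (b : ℕ), (c : ℕ)) ∈ K)}
      isRelLowerSet_faces := fun _ hs => ⟨hs.1, fun _ hts hne => ⟨hne,
        hs.2.1.mono (Finset.coe_subset.2 hts), fun a b ha hb => hs.2.2.1 a b (hts ha) (hts hb),
        fun a c ha hc => hs.2.2.2.1 a c (hts ha) (hts hc),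
        fun b c hb hc => hs.2.2.2.2.1 b c (hts hb) (hts hc),
        fun a b c ha hb hc => hs.2.2.2.2.2 a b c (hts ha) (hts hb) (hts hc)⟩⟩
      singleton_mem := fun v => ⟨Finset.singleton_nonempty v, by simp, by
        refine ⟨?_, ?_, ?_, ?_⟩ <;>
        · intros
          simp only [mem_singleton] at *
          subst_vars
          simp_all⟩
      color := Sigma.fst
      injOn_color := fun _ hs => hs.2.1 }
  have cc : ∀ i, Δ.IsColorClass i (fun a : Fin (d.vert i) => (⟨i, a⟩ : V)) := fun i =>
    ⟨fun a b h => eq_of_heq (Sigma.mk.inj h).2, fun _ => rfl,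
      by rintro ⟨j, b⟩ rfl; exact ⟨b, rfl⟩⟩
  have vert : ∀ i, Δ.flagNumber {i} = d.vert i := fun i => by
    rw [ColoredComplex.flagNumber_singleton (cc i), Nat.card_eq_fintype_card, Fintype.card_fin]
  have pair : ∀ {i j : Fin 3} (E : Finset (ℕ × ℕ)),
      (∀ x ∈ E, x.1 < d.vert i ∧ x.2 < d.vert j) →
      {x : Fin (d.vert i) × Fin (d.vert j) | ((x.1 : ℕ), (x.2 : ℕ)) ∈ E}.ncard = #E := by
    intro i j E hE
    rw [← Set.ncard_coe_finset]
    refine Set.ncard_congr (fun x _ => (x.1, x.2)) (fun x hx => hx) ?_ ?_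
    · rintro ⟨a, b⟩ ⟨a', b'⟩ - - h
      simpa [Fin.ext_iff] using h
    · rintro ⟨a, b⟩ h
      exact ⟨(⟨a, (hE _ h).1⟩, ⟨b, (hE _ h).2⟩), h, rfl⟩
  refine ⟨V, inferInstance, Δ, vert 0, vert 1, vert 2, ?_, ?_, ?_, ?_⟩
  · rw [ColoredComplex.flagNumber_pair (cc 0) (cc 1) (by decide), ← c01, ← pair E01 l01]
    congr 1
    ext ⟨a, b⟩
    simp [Δ, Set.InjOn]
  · rw [ColoredComplex.flagNumber_pair (cc 0) (cc 2) (by decide), ← c02, ← pair E02 l02]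
    congr 1
    ext ⟨a, b⟩
    simp [Δ, Set.InjOn]
  · rw [ColoredComplex.flagNumber_pair (cc 1) (cc 2) (by decide), ← c12, ← pair E12 l12]
    congr 1
    ext ⟨a, b⟩
    simp [Δ, Set.InjOn]
  · rw [ColoredComplex.flagNumber_triple (cc 0) (cc 1) (cc 2) (by decide) (by decide) (by decide),
      ← Set.ncard_coe_finset]
    refine Set.ncard_congr (fun x _ => (x.1, x.2.1, x.2.2)) ?_ ?_ ?_
    · rintro ⟨a, b, c⟩ h
      exact h.2.2.2.2.2 a b c (by simp) (by simp) (by simp)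
    · rintro ⟨a, b, c⟩ ⟨a', b', c'⟩ - - h
      simpa [Fin.ext_iff] using h
    · rintro ⟨a, b, c⟩ h
      have hl := hK _ h
      have m01 := s01 (mem_image_of_mem _ h)
      have m02 := s02 (mem_image_of_mem _ h)
      have m12 := s12 (mem_image_of_mem _ h)
      refine ⟨(⟨a, hl.1⟩, ⟨b, hl.2.1⟩, ⟨c, hl.2.2⟩), ?_, rfl⟩
      refine ⟨by simp, ?_, ?_, ?_, ?_, ?_⟩
      · simp [Set.InjOn]
      · simpa using m01
      · simpa using m02
      · simpa using m12
      · intro a' b' c' ha hb hc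
        simp at ha hb hc
        rwa [ha, hb, hc]

/-- Facets can be omitted one by one. -/
theorem realizes_of_le_card (d : EdgeData) (ht : d.TrivialInequalities) (K : Finset (ℕ × ℕ × ℕ))
    (hK : ∀ x ∈ K, x.1 < d.vert 0 ∧ x.2.1 < d.vert 1 ∧ x.2.2 < d.vert 2)
    (h01 : #(K.image fun x => (x.1, x.2.1)) ≤ d.edge 0 1)
    (h02 : #(K.image fun x => (x.1, x.2.2)) ≤ d.edge 0 2)
    (h12 : #(K.image fun x => (x.2.1, x.2.2)) ≤ d.edge 1 2) {k : ℕ} (hk : k ≤ #K) :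
    d.Realizes k := by
  obtain ⟨L, hL, rfl⟩ := Finset.exists_subset_card_eq hk
  exact d.realizes_card ht L (fun x hx => hK x (hL hx))
    ((Finset.card_le_card (Finset.image_subset_image hL)).trans h01)
    ((Finset.card_le_card (Finset.image_subset_image hL)).trans h02)
    ((Finset.card_le_card (Finset.image_subset_image hL)).trans h12)

end EdgeData

namespace Params

variable {d : EdgeData} {P : Params}

/-- Adjacency in the structured complex of the `a`-th vertex of color `i` and the `b`-th vertex of
color `j`. -/
def AdjAt (d : EdgeData) (P : Params) (i j : Fin 3) (a b : ℕ) : Prop :=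
  (a < P.g i ∧ b < P.g j) ∨
  ((i = P.p ∧ a = P.g i ∧ b < P.firstDeg d j) ∨ (i = P.q ∧ a = P.g i ∧ b < P.secondDeg d j)) ∨
  ((j = P.p ∧ b = P.g j ∧ a < P.firstDeg d i) ∨ (j = P.q ∧ b = P.g j ∧ a < P.secondDeg d i))

theorem AdjAt.symm {i j : Fin 3} {a b : ℕ} (h : AdjAt d P i j a b) : AdjAt d P j i b a := by
  unfold AdjAt at *; tauto

theorem adj_iff {i j : Fin 3} (hij : i ≠ j) (a : Fin (P.numVert d i)) (b : Fin (P.numVert d j)) :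
    P.Adj d ⟨i, a⟩ ⟨j, b⟩ ↔ AdjAt d P i j a b := by
  simp only [Adj, AdjAt, Joins, ne_eq, hij, not_false_eq_true, true_and]

theorem Adj.symm {u v : P.Vertex d} (h : P.Adj d u v) : P.Adj d v u := by
  unfold Adj at *
  exact ⟨h.1.symm, by tauto⟩

theorem isColorClass (d : EdgeData) (P : Params) (i : Fin 3) :
    (P.complex d).IsColorClass i (fun a : Fin (P.numVert d i) => (⟨i, a⟩ : P.Vertex d)) :=
  ⟨fun a b h => by simpa using h, fun _ => rfl, by rintro ⟨j, b⟩ rfl; exact ⟨b, rfl⟩⟩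

/-- The facets of a structured complex as triples of numbers. -/
def facetSet (d : EdgeData) (P : Params) (i j k : Fin 3) : Set (ℕ × ℕ × ℕ) :=
  {x | (x.1 < P.numVert d i ∧ x.2.1 < P.numVert d j ∧ x.2.2 < P.numVert d k) ∧
    AdjAt d P i j x.1 x.2.1 ∧ AdjAt d P i k x.1 x.2.2 ∧ AdjAt d P j k x.2.1 x.2.2}

theorem facets_eq_ncard {i j k : Fin 3} (hij : i ≠ j) (hik : i ≠ k) (hjk : j ≠ k) :
    P.facets d = (facetSet d P i j k).ncard := by
  rw [facets, EdgeData.fin_three_cases hij hik hjk,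
    ColoredComplex.flagNumber_triple (isColorClass d P i) (isColorClass d P j)
      (isColorClass d P k) hij hik hjk]
  refine Set.ncard_congr (fun x _ => (x.1, x.2.1, x.2.2)) ?_ ?_ ?_
  · rintro ⟨a, b, c⟩ h
    refine ⟨⟨a.2, b.2, c.2⟩, ?_, ?_, ?_⟩
    · exact (adj_iff hij a b).1 (h.2 _ (by simp) _ (by simp) (by simp [hij]))
    · exact (adj_iff hik a c).1 (h.2 _ (by simp) _ (by simp) (by simp [hik]))
    · exact (adj_iff hjk b c).1 (h.2 _ (by simp) _ (by simp) (by simp [hjk]))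
  · rintro ⟨a, b, c⟩ ⟨a', b', c'⟩ - - h
    simpa [Fin.ext_iff] using h
  · rintro ⟨a, b, c⟩ ⟨⟨h1, h2, h3⟩, h12, h13, h23⟩
    refine ⟨(⟨a, h1⟩, ⟨b, h2⟩, ⟨c, h3⟩), ⟨by simp, ?_⟩, rfl⟩
    have e12 := (adj_iff hij ⟨a, h1⟩ ⟨b, h2⟩).2 h12
    have e13 := (adj_iff hik ⟨a, h1⟩ ⟨c, h3⟩).2 h13
    have e23 := (adj_iff hjk ⟨b, h2⟩ ⟨c, h3⟩).2 h23
    intro u hu v hv huv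
    simp only [mem_insert, mem_singleton] at hu hv
    rcases hu with rfl | rfl | rfl <;> rcases hv with rfl | rfl | rfl <;> first
      | exact absurd rfl huv
      | assumption
      | exact Adj.symm ‹_›

theorem WellDefined.numVert_le (h : P.WellDefined d) (i : Fin 3) : P.numVert d i ≤ d.vert i := by
  unfold numVert
  have := (h.2.1 i).2
  split_ifs <;> omega

/-- The edges of a structured complex with given colors, as pairs of numbers. -/
def edgeSet (d : EdgeData) (P : Params) (i j : Fin 3) : Set (ℕ × ℕ) :=
  {x | (x.1 < P.numVert d i ∧ x.2 < P.numVert d j) ∧ AdjAt d P i j x.1 x.2}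

theorem ncard_edgeSet_comm (d : EdgeData) (P : Params) (i j : Fin 3) :
    (edgeSet d P i j).ncard = (edgeSet d P j i).ncard :=
  Set.ncard_congr (fun x _ => (x.2, x.1)) (fun _ h => ⟨h.1.symm, h.2.symm⟩)
    (by rintro ⟨a, b⟩ ⟨a', b'⟩ - - h; simpa [and_comm] using h)
    (by rintro ⟨a, b⟩ h; exact ⟨(b, a), ⟨h.1.symm, h.2.symm⟩, rfl⟩)

theorem p_ne_r (h : P.p ≠ P.q) : P.p ≠ P.r := by
  have : ∀ p q : Fin 3, p ≠ q → p ≠ third p q := by decide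
  exact this _ _ h

theorem q_ne_r (h : P.p ≠ P.q) : P.q ≠ P.r := by
  have : ∀ p q : Fin 3, p ≠ q → q ≠ third p q := by decide
  exact this _ _ h

theorem eq_or_eq_or_eq_r (h : P.p ≠ P.q) (i : Fin 3) : i = P.p ∨ i = P.q ∨ i = P.r := by
  have : ∀ p q i : Fin 3, p ≠ q → i = p ∨ i = q ∨ i = third p q := by decide
  exact this _ _ i h

theorem ncard_edgeSet_le_of_subset {i j : Fin 3} {u w : ℕ}
    (h : edgeSet d P i j ⊆ ((range (P.g i) ×ˢ range (P.g j) ∪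
      ({P.g i} ×ˢ range u ∪ range w ×ˢ {P.g j}) : Finset (ℕ × ℕ)) : Set (ℕ × ℕ))) :
    (edgeSet d P i j).ncard ≤ P.g i * P.g j + (u + w) := by
  refine (Set.ncard_le_ncard h (Finset.finite_toSet _)).trans ?_
  rw [Set.ncard_coe_finset]
  refine (Finset.card_union_le _ _).trans (add_le_add (by simp) ?_)
  exact (Finset.card_union_le _ _).trans (add_le_add (by simp) (by simp))

/-- A structured complex has no more edges than prescribed. -/
theorem WellDefined.ncard_edgeSet_le (h : P.WellDefined d) {i j : Fin 3} (hij : i ≠ j) :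
    (edgeSet d P i j).ncard ≤ d.edge i j := by
  have hpq := h.1
  have hpr := p_ne_r hpq
  have hqr := q_ne_r hpq
  have cpq : (edgeSet d P P.p P.q).ncard ≤ d.edge P.p P.q := by
    have hc := h.2.2 _ _ hpq
    refine (ncard_edgeSet_le_of_subset (u := P.firstDeg d P.q) (w := P.secondDeg d P.p) ?_).trans ?_
    · rintro ⟨a, b⟩ ⟨-, h⟩
      simp only [AdjAt, hpq, hpq.symm, true_and, false_and, or_false, false_or] at h
      simp only [coe_union, coe_product, coe_range, coe_singleton, Set.mem_union, Set.mem_prod,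
        Set.mem_Iio, Set.mem_singleton_iff]
      tauto
    · have e1 : P.firstDeg d P.q ≤ d.edge P.p P.q - P.g P.p * P.g P.q := by
        unfold firstDeg; split_ifs <;> omega
      have e2 : P.secondDeg d P.p ≤
          d.edge P.p P.q - P.g P.p * P.g P.q - P.firstDeg d P.q := by
        unfold secondDeg
        rw [if_pos rfl, EdgeData.edge_comm, mul_comm]
        exact min_le_right _ _
      omega
  have cpr : (edgeSet d P P.p P.r).ncard ≤ d.edge P.p P.r := by
    have hc := h.2.2 _ _ hpr
    refine (ncard_edgeSet_le_of_subset (u := P.firstDeg d P.r) (w := 0) ?_).trans ?_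
    · rintro ⟨a, b⟩ ⟨-, h⟩
      simp only [AdjAt, hpq, hpr.symm, hqr.symm, true_and, false_and, or_false] at h
      simp only [coe_union, coe_product, coe_range, coe_singleton, Set.mem_union, Set.mem_prod,
        Set.mem_Iio, Set.mem_singleton_iff]
      tauto
    · have e1 : P.firstDeg d P.r ≤ d.edge P.p P.r - P.g P.p * P.g P.r := by
        unfold firstDeg; split_ifs <;> omega
      omega
  have cqr : (edgeSet d P P.q P.r).ncard ≤ d.edge P.q P.r := by
    have hc := h.2.2 _ _ hqr
    refine (ncard_edgeSet_le_of_subset (u := P.secondDeg d P.r) (w := 0) ?_).trans ?_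
    · rintro ⟨a, b⟩ ⟨-, h⟩
      simp only [AdjAt, hpq.symm, hpr.symm, hqr.symm, true_and, false_and, or_false, false_or] at h
      simp only [coe_union, coe_product, coe_range, coe_singleton, Set.mem_union, Set.mem_prod,
        Set.mem_Iio, Set.mem_singleton_iff]
      tauto
    · have e1 : P.secondDeg d P.r ≤ d.edge P.q P.r - P.g P.q * P.g P.r := by
        unfold secondDeg
        rw [if_neg hpr.symm]
        exact min_le_right _ _
      omega
  rcases eq_or_eq_or_eq_r hpq i with rfl | rfl | rfl <;>
    rcases eq_or_eq_or_eq_r hpq j with rfl | rfl | rfl <;> first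
    | exact absurd rfl hij
    | assumption
    | (rw [ncard_edgeSet_comm, EdgeData.edge_comm]; assumption)

/-- Every number up to the number of facets of a structured complex is realized. -/
theorem WellDefined.realizes (h : P.WellDefined d) (ht : d.TrivialInequalities) {k : ℕ}
    (hk : k ≤ P.facets d) : d.Realizes k := by
  have hfin : ∀ i j, (edgeSet d P i j).Finite := fun i j =>
    ((range (P.numVert d i) ×ˢ range (P.numVert d j)).finite_toSet).subset
      (by rintro ⟨a, b⟩ h; simpa using h.1)
  have hfin' : (facetSet d P 0 1 2).Finite :=
    ((range (P.numVert d 0) ×ˢ range (P.numVert d 1) ×ˢ range (P.numVert d 2)).finite_toSet).subset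
      (by rintro ⟨a, b, c⟩ h; simpa using h.1)
  have hmem : ∀ x, x ∈ hfin'.toFinset ↔ x ∈ facetSet d P 0 1 2 := fun x => hfin'.mem_toFinset
  have bound : ∀ {i j : Fin 3} (_ : i ≠ j) (I : Finset (ℕ × ℕ)), (↑I ⊆ edgeSet d P i j) →
      #I ≤ d.edge i j := fun hij I hI => by
    rw [← Set.ncard_coe_finset]
    exact (Set.ncard_le_ncard hI (hfin _ _)).trans (h.ncard_edgeSet_le hij)
  refine d.realizes_of_le_card ht hfin'.toFinset (fun x hx => ?_) (bound (by decide) _ ?_)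
    (bound (by decide) _ ?_) (bound (by decide) _ ?_) ?_
  · have := ((hmem x).1 hx).1
    exact ⟨this.1.trans_le (h.numVert_le 0), this.2.1.trans_le (h.numVert_le 1),
      this.2.2.trans_le (h.numVert_le 2)⟩
  · intro y hy
    obtain ⟨x, hx, rfl⟩ := mem_image.1 (Finset.mem_coe.1 hy)
    obtain ⟨h1, h2⟩ := (hmem x).1 hx
    exact ⟨⟨h1.1, h1.2.1⟩, h2.1⟩
  · intro y hy
    obtain ⟨x, hx, rfl⟩ := mem_image.1 (Finset.mem_coe.1 hy)
    obtain ⟨h1, h2⟩ := (hmem x).1 hx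
    exact ⟨⟨h1.1, h1.2.2⟩, h2.2.1⟩
  · intro y hy
    obtain ⟨x, hx, rfl⟩ := mem_image.1 (Finset.mem_coe.1 hy)
    obtain ⟨h1, h2⟩ := (hmem x).1 hx
    exact ⟨h1.2, h2.2.2⟩
  · rw [facets_eq_ncard (i := 0) (j := 1) (k := 2) (by decide) (by decide) (by decide),
      Set.ncard_eq_toFinset_card _ hfin'] at hk
    exact hk

/-- The number of facets of a structured complex: those of the core, those with the first extra
vertex only, those with the second extra vertex only, and those with both. -/
theorem facets_eq (h : P.p ≠ P.q) :
    P.facets d = P.g P.p * P.g P.q * P.g P.r + P.firstDeg d P.q * P.firstDeg d P.r +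
      if P.g P.q < d.vert P.q then min (P.g P.p) (P.secondDeg d P.p) * P.secondDeg d P.r +
        if P.g P.p < P.secondDeg d P.p then min (P.firstDeg d P.r) (P.secondDeg d P.r) else 0
      else 0 := by
  have hpr := p_ne_r h
  have hqr := q_ne_r h
  rw [facets_eq_ncard h hpr hqr]
  have nr : P.numVert d P.r = P.g P.r := by
    unfold numVert; rw [if_neg]; rintro ⟨h1 | h1, -⟩ <;> simp_all
  have np : P.numVert d P.p = if P.g P.p < d.vert P.p then P.g P.p + 1 else P.g P.p := by
    unfold numVert; simp
  have nq : P.numVert d P.q = if P.g P.q < d.vert P.q then P.g P.q + 1 else P.g P.q := by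
    unfold numVert; simp
  have fq : P.firstDeg d P.q ≤ P.g P.q := by unfold firstDeg; split_ifs <;> omega
  have fr : P.firstDeg d P.r ≤ P.g P.r := by unfold firstDeg; split_ifs <;> omega
  have fq0 : ¬ P.g P.p < d.vert P.p → P.firstDeg d P.q = 0 := fun h => by
    unfold firstDeg; rw [if_neg h]
  have sp : P.secondDeg d P.p ≤ P.numVert d P.p := by
    unfold secondDeg; rw [if_pos rfl]; exact min_le_left _ _
  have sr : P.secondDeg d P.r ≤ P.g P.r := by
    unfold secondDeg; rw [if_neg hpr.symm]; exact min_le_left _ _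
  rw [np] at sp
  set gp := P.g P.p
  set gq := P.g P.q
  set gr := P.g P.r
  set fdq := P.firstDeg d P.q
  set fdr := P.firstDeg d P.r
  set sdp := P.secondDeg d P.p
  set sdr := P.secondDeg d P.r
  set sdr' := if gq < d.vert P.q then sdr else 0 with hsdr'
  set top := if gp < sdp then min fdr sdr' else 0 with htop
  have key : facetSet d P P.p P.q P.r =
      (((range gp ×ˢ range gq ×ˢ range gr ∪ {gp} ×ˢ range fdq ×ˢ range fdr) ∪
        (range (min gp sdp) ×ˢ {gq} ×ˢ range sdr' ∪ {gp} ×ˢ {gq} ×ˢ range top) :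
        Finset (ℕ × ℕ × ℕ)) : Set (ℕ × ℕ × ℕ)) := by
    ext ⟨a, b, c⟩
    simp only [facetSet, AdjAt, h, h.symm, hpr.symm, hqr.symm, true_and, false_and,
      or_false, false_or, Set.mem_ofPred_eq, nr, np, nq, Finset.mem_coe, mem_union, mem_product,
      mem_range, mem_singleton]
    change _ ∧ (a < gp ∧ b < gq ∨ (a = gp ∧ b < fdq) ∨ (b = gq ∧ a < sdp)) ∧
      (a < gp ∧ c < gr ∨ a = gp ∧ c < fdr) ∧ (b < gq ∧ c < gr ∨ b = gq ∧ c < sdr) ↔ _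
    clear_value gp gq gr fdq fdr sdp sdr
    rw [htop, hsdr']
    clear htop hsdr' top sdr'
    by_cases h1 : gp < d.vert P.p <;> by_cases h2 : gq < d.vert P.q <;> by_cases h3 : gp < sdp <;>
      simp only [h1, h2, h3, if_true, if_false, forall_const, not_false_eq_true, not_true_eq_false,
        false_imp_iff, lt_min_iff] at sp fq0 ⊢ <;> omega
  rw [key, Set.ncard_coe_finset, Finset.card_union_of_disjoint, Finset.card_union_of_disjoint,
    Finset.card_union_of_disjoint]
  · simp only [card_product, card_range, card_singleton, one_mul]
    rw [htop, hsdr']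
    split_ifs <;> simp <;> ring
  · rw [Finset.disjoint_left]
    rintro ⟨a, b, c⟩ h1 h2
    simp only [mem_product, mem_range, mem_singleton] at h1 h2
    omega
  · rw [Finset.disjoint_left]
    rintro ⟨a, b, c⟩ h1 h2
    simp only [mem_product, mem_range, mem_singleton] at h1 h2
    omega
  · rw [Finset.disjoint_left]
    rintro ⟨a, b, c⟩ h1 h2
    simp only [mem_union, mem_product, mem_range, mem_singleton] at h1 h2
    omega

/-- Relabeling of the colors: the color `i` becomes the color `σ i`. -/
def map (σ : Equiv.Perm (Fin 3)) (P : Params) : Params := ⟨P.g ∘ σ.symm, σ P.p, σ P.q⟩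

end Params

theorem EdgeData.edge_relabel (d : EdgeData) (σ : Equiv.Perm (Fin 3)) (i j : Fin 3) :
    (d.relabel σ).edge i j = d.edge (σ i) (σ j) := by
  have : ∀ (σ : Equiv.Perm (Fin 3)) (i j : Fin 3), σ (third i j) = third (σ i) (σ j) := by decide
  simp only [edge, relabel, this]

namespace Params

variable {d : EdgeData} {P : Params}

theorem wellDefined_map (σ : Equiv.Perm (Fin 3)) (h : P.WellDefined (d.relabel σ)) :
    (P.map σ).WellDefined d := by
  obtain ⟨h1, h2, h3⟩ := h
  refine ⟨fun e => h1 (σ.injective e), fun i => ?_, fun i j hij => ?_⟩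
  · simpa [map, EdgeData.relabel] using h2 (σ.symm i)
  · have := h3 (σ.symm i) (σ.symm j) (fun e => hij (σ.symm.injective e))
    simpa [map, EdgeData.edge_relabel] using this

theorem facets_map (σ : Equiv.Perm (Fin 3)) : (P.map σ).facets d = P.facets (d.relabel σ) := by
  have nv : ∀ i, (P.map σ).numVert d (σ i) = P.numVert (d.relabel σ) i := fun i => by
    simp [numVert, map, EdgeData.relabel]
    congr
  have fd : ∀ i, (P.map σ).firstDeg d (σ i) = P.firstDeg (d.relabel σ) i := fun i => by
    simp only [firstDeg, EdgeData.edge_relabel]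
    simp [map, EdgeData.relabel]
    congr
  have sd : ∀ i, (P.map σ).secondDeg d (σ i) = P.secondDeg (d.relabel σ) i := fun i => by
    simp only [secondDeg, EdgeData.edge_relabel, ← nv, ← fd]
    simp [map]
  have adj : ∀ i j a b, AdjAt d (P.map σ) (σ i) (σ j) a b ↔ AdjAt (d.relabel σ) P i j a b :=
    fun i j a b => by
      simp only [AdjAt, fd, sd]
      simp [map]
  rw [facets_eq_ncard (d := d.relabel σ) (i := 0) (j := 1) (k := 2) (by decide) (by decide)
      (by decide), facets_eq_ncard (d := d) (i := σ 0) (j := σ 1) (k := σ 2) (by simp) (by simp)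
      (by simp)]
  simp only [facetSet, adj, nv]

end Params

/-! ### Structured complexes reach the value of balanced slots -/

/-- One slot of the distribution in which the first extra vertex takes `min w ε` and the second one
`min (u + 1) (ε - min w ε)` of the `ε` edges that are left over. -/
theorem min_slot_le {u w ε α β k : ℕ} (hβ : β ≤ α) :
    min (u * w + ε) ((u + if k < α then 1 else 0) * (w + if k < β then 1 else 0)) ≤
      u * w + min w ε * (if k < α then 1 else 0) +
        min (u + 1) (ε - min w ε) * (if k < β then 1 else 0) := by
  have e1 : (u + 1) * (w + 1) = u * w + (u + w + 1) := by ring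
  have e2 : (u + 1) * w = u * w + w := by ring
  split_ifs
  · rw [e1]; omega
  · simp only [add_zero]; rw [e2]; omega
  · omega
  · simp

namespace Params

variable {d : EdgeData} {P : Params}

/-- A structured complex without extra vertex of color `r` has as many facets as balanced slots. -/
theorem balancedValue_le_facets (hpq : P.p ≠ P.q) {α β ε : ℕ}
    (hM : d.edge P.p P.q = P.g P.p * P.g P.q + ε)
    (hP : d.edge P.p P.r = P.g P.p * P.g P.r + α) (hα : α ≤ P.g P.r)
    (hQ : d.edge P.q P.r = P.g P.q * P.g P.r + β) (hβ : β ≤ α)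
    (hp : 0 < α → P.g P.p < d.vert P.p) (hq : 0 < β → P.g P.q < d.vert P.q) :
    balancedValue (d.edge P.p P.q) (d.edge P.p P.r) (d.edge P.q P.r) (P.g P.r) ≤
      P.facets d := by
  rw [facets_eq hpq]
  have hpr := p_ne_r hpq
  have fq : 0 < α → P.firstDeg d P.q = min (P.g P.q) ε := fun h => by
    unfold firstDeg; rw [if_pos (hp h), hM, Nat.add_sub_cancel_left]
  have fr : 0 < α → P.firstDeg d P.r = α := fun h => by
    unfold firstDeg; rw [if_pos (hp h), hP, Nat.add_sub_cancel_left, min_eq_right hα]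
  have sr : P.secondDeg d P.r = β := by
    unfold secondDeg
    rw [if_neg hpr.symm, hQ, Nat.add_sub_cancel_left, min_eq_right (hβ.trans hα)]
  have sp : 0 < α → P.secondDeg d P.p = min (P.g P.p + 1) (ε - min (P.g P.q) ε) := fun h => by
    unfold secondDeg
    rw [if_pos rfl, fq h, EdgeData.edge_comm, hM, mul_comm, Nat.add_sub_cancel_left, numVert,
      if_pos ⟨Or.inl rfl, hp h⟩]
  set u := P.g P.p
  set w := P.g P.q
  set h := P.g P.r
  have h1 : balancedValue (d.edge P.p P.q) (d.edge P.p P.r) (d.edge P.q P.r) h ≤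
      ∑ k ∈ range h, (u * w + min w ε * (if k < α then 1 else 0) +
        min (u + 1) (ε - min w ε) * (if k < β then 1 else 0)) := by
    refine Finset.sum_le_sum fun k hk => ?_
    rw [balanced_eq hP hα (mem_range.1 hk), balanced_eq hQ (hβ.trans hα) (mem_range.1 hk), hM]
    exact min_slot_le hβ
  refine h1.trans ?_
  rw [Finset.sum_add_distrib, Finset.sum_add_distrib, Finset.sum_const, ← Finset.mul_sum,
    ← Finset.mul_sum, sum_ite_lt, sum_ite_lt, min_eq_left hα, min_eq_left (hβ.trans hα), card_range,
    smul_eq_mul, sr]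
  rcases Nat.eq_zero_or_pos α with h0 | h0
  · have : β = 0 := by omega
    rw [h0, this, mul_comm h]
    simp
  rw [fq h0, fr h0, sp h0]
  set s := min (u + 1) (ε - min w ε) with hs
  rcases Nat.eq_zero_or_pos β with h0' | h0'
  · rw [h0', mul_comm h]; simp
  rw [if_pos (hq h0'), min_eq_right hβ]
  have : s * β = min u s * β + if u < s then β else 0 := by
    split_ifs with hc
    · have : s = u + 1 := by omega
      rw [min_eq_left hc.le, this]; ring
    · rw [min_eq_right (not_lt.1 hc), add_zero]
  rw [this, mul_comm h]

end Params

namespace EdgeData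

variable (d : EdgeData) (r : Fin 3) (h : ℕ)

theorem other_ne : other₁ r ≠ other₂ r ∧ other₁ r ≠ r ∧ other₂ r ≠ r := by
  revert r; decide

theorem eq_other (r i : Fin 3) : i = r ∨ i = other₁ r ∨ i = other₂ r := by
  revert r i; decide

theorem third_other : third (other₁ r) (other₂ r) = r ∧ third (other₂ r) (other₁ r) = r := by
  revert r; decide

theorem known_g : (d.known r h).g r = h ∧ (d.known r h).g (other₁ r) = d.known₁ r h ∧
    (d.known r h).g (other₂ r) = d.known₂ r h := by
  obtain ⟨h1, h2, h3⟩ := other_ne r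
  unfold known
  dsimp only
  split_ifs <;> simp [h1.symm, h2, h3]

theorem known_pq :
    ((d.known r h).p = other₁ r ∧ (d.known r h).q = other₂ r ∧
      d.edge (other₂ r) r - d.known₂ r h * h ≤ d.edge (other₁ r) r - d.known₁ r h * h) ∨
    ((d.known r h).p = other₂ r ∧ (d.known r h).q = other₁ r ∧
      d.edge (other₁ r) r - d.known₁ r h * h ≤ d.edge (other₂ r) r - d.known₂ r h * h) := by
  obtain ⟨h1, h2, h3⟩ := other_ne r
  unfold known
  simp only [h1.symm, h2, h3, if_true, if_false]
  split_ifs with hc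
  · exact Or.inl ⟨rfl, rfl, hc⟩
  · exact Or.inr ⟨rfl, rfl, by omega⟩

theorem known_r : (d.known r h).p ≠ (d.known r h).q ∧ (d.known r h).r = r := by
  obtain ⟨h1, h2, h3⟩ := other_ne r
  obtain ⟨t1, t2⟩ := third_other r
  rcases d.known_pq r h with ⟨e1, e2, -⟩ | ⟨e1, e2, -⟩ <;> rw [Params.r, e1, e2]
  · exact ⟨h1, t1⟩
  · exact ⟨h1.symm, t2⟩

variable {d r h}

/-- The excess of the number of edges over the core is between `0` and the number `h` of vertices.
-/
theorem exists_eq_of_div {m g : ℕ} (hh : 0 < h) (c : Prop) [Decidable c]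
    (hg : g = if h ∣ m ∧ c then m / h - 1 else m / h) : ∃ α, m = g * h + α ∧ α ≤ h := by
  have h1 := Nat.div_add_mod' m h
  have h2 := Nat.mod_lt m hh
  split_ifs at hg with hc
  · rcases Nat.eq_zero_or_pos (m / h) with h0 | h0
    · rw [hg, h0]; rw [h0] at h1; exact ⟨m % h, by simpa using h1.symm, h2.le⟩
    · refine ⟨h, ?_, le_rfl⟩
      rw [Nat.mod_eq_zero_of_dvd hc.1] at h1
      have : (m / h - 1) * h + h = m / h * h := by
        obtain ⟨z, hz⟩ := Nat.exists_eq_add_of_le h0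
        rw [hz, Nat.add_sub_cancel_left]; ring
      rw [hg]; omega
  · exact ⟨m % h, by rw [hg]; omega, h2.le⟩

/-- The candidates `known r h` have as many facets as balanced slots. -/
theorem balancedValue_le_facets_known (hw : (d.known r h).WellDefined d)
    (hi : d.edge (other₁ r) r ≤ d.vert (other₁ r) * h)
    (hj : d.edge (other₂ r) r ≤ d.vert (other₂ r) * h) :
    balancedValue (d.edge (other₁ r) (other₂ r)) (d.edge (other₁ r) r) (d.edge (other₂ r) r) h ≤
      (d.known r h).facets d := by
  obtain ⟨gr, g1, g2⟩ := d.known_g r h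
  obtain ⟨hpq, hr⟩ := d.known_r r h
  obtain ⟨n1, n2, n3⟩ := other_ne r
  have hh : 0 < h := by have := (hw.2.1 r).1; rw [gr] at this; exact this
  have hM := hw.2.2 _ _ n1
  rw [g1, g2] at hM
  obtain ⟨α, hα, hαh⟩ := exists_eq_of_div (h := h) (m := d.edge (other₁ r) r) hh _
    (show d.known₁ r h = _ from rfl)
  obtain ⟨β, hβ, hβh⟩ := exists_eq_of_div (h := h) (m := d.edge (other₂ r) r) hh _
    (show d.known₂ r h = _ from rfl)
  obtain ⟨ε, hε⟩ := Nat.exists_eq_add_of_le hM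
  have v1 : 0 < α → d.known₁ r h < d.vert (other₁ r) := fun h0 => by
    by_contra! hc
    have : d.vert (other₁ r) * h ≤ d.known₁ r h * h := Nat.mul_le_mul_right _ hc
    omega
  have v2 : 0 < β → d.known₂ r h < d.vert (other₂ r) := fun h0 => by
    by_contra! hc
    have : d.vert (other₂ r) * h ≤ d.known₂ r h * h := Nat.mul_le_mul_right _ hc
    omega
  rcases d.known_pq r h with ⟨e1, e2, e3⟩ | ⟨e1, e2, e3⟩
  · rw [hα, hβ, Nat.add_sub_cancel_left, Nat.add_sub_cancel_left] at e3
    have := Params.balancedValue_le_facets (d := d) hpq (α := α) (β := β) (ε := ε)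
    rw [hr, e1, e2, gr, g1, g2] at this
    exact this hε hα hαh hβ e3 v1 v2
  · rw [hα, hβ, Nat.add_sub_cancel_left, Nat.add_sub_cancel_left] at e3
    have := Params.balancedValue_le_facets (d := d) hpq (α := β) (β := α) (ε := ε)
    rw [hr, e1, e2, gr, g1, g2, edge_comm, balancedValue_comm] at this
    exact this (by rw [hε, mul_comm]) hβ hβh hα e3 v2 v1

/-- Here the numbers of edges are divided by `h` with remainders in `{1, …, h}`, so that `p₀` and
`q₀` are the smaller of the two possible numbers of core vertices. -/
theorem known_wellDefined {p₀ q₀ α β : ℕ} (hP : d.edge (other₁ r) r = p₀ * h + α) (hα : α ≤ h)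
    (hα0 : 0 < α) (hQ : d.edge (other₂ r) r = q₀ * h + β) (hβ : β ≤ h) (hβ0 : 0 < β)
    (hPh : h ≤ d.edge (other₁ r) r) (hQh : h ≤ d.edge (other₂ r) r) (hr : h ≤ d.vert r)
    (hi : d.edge (other₁ r) r ≤ d.vert (other₁ r) * h)
    (hj : d.edge (other₂ r) r ≤ d.vert (other₂ r) * h)
    (hpq : p₀ * q₀ ≤ d.edge (other₁ r) (other₂ r))
    (hp0 : p₀ = 0 → q₀ ≤ d.edge (other₁ r) (other₂ r))
    (hq0 : q₀ = 0 → p₀ + 1 ≤ d.edge (other₁ r) (other₂ r)) : (d.known r h).WellDefined d := by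
  obtain ⟨gr, g1, g2⟩ := d.known_g r h
  obtain ⟨hne, -⟩ := d.known_r r h
  obtain ⟨n1, n2, n3⟩ := other_ne r
  have hh : 0 < h := by omega
  have div : ∀ {m u α : ℕ}, m = u * h + α → α ≤ h → 0 < α →
      (α = h ∧ h ∣ m ∧ m / h = u + 1) ∨ (α < h ∧ ¬ h ∣ m ∧ m / h = u) := by
    intro m u α hm hα hα0
    rcases hα.lt_or_eq with hlt | rfl
    · refine Or.inr ⟨hlt, ?_, ?_⟩
      · rw [hm, Nat.dvd_add_right (Dvd.intro_left u rfl)]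
        exact Nat.not_dvd_of_pos_of_lt hα0 hlt
      · rw [hm, mul_comm, Nat.mul_add_div hh, Nat.div_eq_of_lt hlt, add_zero]
    · refine Or.inl ⟨rfl, ?_, ?_⟩
      · rw [hm]; exact ⟨u + 1, by ring⟩
      · rw [hm, mul_comm, Nat.mul_add_div hh, Nat.div_self hh]
  have ceil : d.edge (other₂ r) r ⌈/⌉ h - 1 = q₀ := by
    rw [Nat.ceilDiv_eq_add_pred_div, hQ]
    have : (q₀ * h + β + h - 1) / h = q₀ + 1 := by
      rw [show q₀ * h + β + h - 1 = h * (q₀ + 1) + (β - 1) by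
        have : h * (q₀ + 1) = q₀ * h + h := by ring
        omega, Nat.mul_add_div hh, Nat.div_eq_of_lt (by omega), add_zero]
    omega
  have e1 : d.known₁ r h =
      if h ∣ d.edge (other₁ r) r ∧ d.edge (other₁ r) (other₂ r) < d.edge (other₁ r) r / h * q₀ then
        d.edge (other₁ r) r / h - 1 else d.edge (other₁ r) r / h := by
    rw [← ceil]; rfl
  have e2 : d.known₂ r h =
      if h ∣ d.edge (other₂ r) r ∧
        d.edge (other₁ r) (other₂ r) < d.edge (other₂ r) r / h * d.known₁ r h then
        d.edge (other₂ r) r / h - 1 else d.edge (other₂ r) r / h := rfl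
  obtain ⟨a', ha', -⟩ := exists_eq_of_div (h := h) hh _ e1
  obtain ⟨b', hb', -⟩ := exists_eq_of_div (h := h) hh _ e2
  set M := d.edge (other₁ r) (other₂ r) with hM
  set X := d.edge (other₁ r) r
  set Y := d.edge (other₂ r) r
  set u := d.known₁ r h
  set w := d.known₂ r h
  have hX1 : 1 ≤ X / h := Nat.div_pos hPh hh
  have hY1 : 1 ≤ Y / h := Nat.div_pos hQh hh
  have huq : 1 ≤ u ∧ u ≤ p₀ + 1 ∧ u * q₀ ≤ M := by
    rcases div hP hα hα0 with ⟨-, f1, f2⟩ | ⟨-, f1, f2⟩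
    · by_cases hc : M < X / h * q₀
      · rw [if_pos ⟨f1, hc⟩, f2, Nat.add_sub_cancel] at e1
        refine ⟨?_, by omega, by rw [e1]; exact hpq⟩
        by_contra! h0
        have h0' : p₀ = 0 := by omega
        rw [f2, h0'] at hc
        have := hp0 h0'
        omega
      · rw [if_neg (fun hh => hc hh.2)] at e1
        exact ⟨by omega, by omega, by rw [e1]; omega⟩
    · rw [if_neg (fun hh => f1 hh.1)] at e1
      exact ⟨by omega, by omega, by rw [e1, f2]; exact hpq⟩
  have hw : 1 ≤ w ∧ u * w ≤ M := by
    rcases div hQ hβ hβ0 with ⟨-, f1, f2⟩ | ⟨-, f1, f2⟩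
    · by_cases hc : M < Y / h * u
      · rw [if_pos ⟨f1, hc⟩, f2, Nat.add_sub_cancel] at e2
        refine ⟨?_, by rw [e2]; exact huq.2.2⟩
        by_contra! h0
        have h0' : q₀ = 0 := by omega
        rw [f2, h0'] at hc
        have := hq0 h0'
        omega
      · rw [if_neg (fun hh => hc hh.2)] at e2
        exact ⟨by omega, by rw [e2, mul_comm]; omega⟩
    · rw [if_neg (fun hh => f1 hh.1)] at e2
      exact ⟨by omega, by rw [e2, f2]; exact huq.2.2⟩
  have hui : u ≤ d.vert (other₁ r) := Nat.le_of_mul_le_mul_right (by omega) hh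
  have hwj : w ≤ d.vert (other₂ r) := Nat.le_of_mul_le_mul_right (by omega) hh
  refine ⟨hne, fun i => ?_, fun i j hij => ?_⟩
  · rcases eq_other r i with rfl | rfl | rfl
    · rw [gr]; exact ⟨hh, hr⟩
    · rw [g1]; exact ⟨huq.1, hui⟩
    · rw [g2]; exact ⟨hw.1, hwj⟩
  · have c12 : (d.known r h).g (other₁ r) * (d.known r h).g (other₂ r) ≤ M := by
      rw [g1, g2]; exact hw.2
    have c1 : (d.known r h).g (other₁ r) * (d.known r h).g r ≤ X := by
      rw [g1, gr]; omega
    have c2 : (d.known r h).g (other₂ r) * (d.known r h).g r ≤ Y := by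
      rw [g2, gr]; omega
    rcases eq_other r i with hi' | hi' | hi' <;> rcases eq_other r j with hj' | hj' | hj' <;> first
      | exact absurd (hi'.trans hj'.symm) hij
      | (rw [hi', hj']; assumption)
      | (rw [hi', hj', mul_comm, edge_comm]; assumption)

end EdgeData

/-! ### The conditions of the search -/

namespace EdgeData

/-- The situation in which the procedure searches for the maximum. -/
structure IsSearchCase (d : EdgeData) : Prop where
  trivial_ineq : d.TrivialInequalities
  edge_pos : ∀ i j, 0 < d.edge i j
  not_vertexTest : ∀ i, ¬ d.VertexTest i
  sorted : d.IsSorted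
  b_zero : d.b 0 ≠ 0

theorem le_b_iff {d : EdgeData} (hpos : ∀ i j, 0 < d.edge i j) {c : ℕ} (i : Fin 3) :
    c ≤ d.b i ↔ c ^ 2 * d.edge (i + 1) (i + 2) ≤ d.edge i (i + 1) * d.edge i (i + 2) := by
  rw [b, Nat.le_sqrt', Nat.le_div_iff_mul_le (hpos _ _)]

theorem vertexTest_iff {d : EdgeData} {i j k : Fin 3} (hij : i ≠ j) (hik : i ≠ k) (hjk : j ≠ k) :
    d.VertexTest i ↔ d.edge j k ≤ (d.edge i j / d.vert i) * (d.edge i k / d.vert i) := by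
  have : (j = i + 1 ∧ k = i + 2) ∨ (j = i + 2 ∧ k = i + 1) := by
    revert i j k; decide
  rcases this with ⟨rfl, rfl⟩ | ⟨rfl, rfl⟩
  · rfl
  · rw [VertexTest, d.edge_comm (i + 1), mul_comm]

namespace IsSearchCase

variable {d : EdgeData}

theorem le_b_zero_iff (s : d.IsSearchCase) {c : ℕ} :
    c ≤ d.b 0 ↔ c ^ 2 * d.edge 1 2 ≤ d.edge 0 1 * d.edge 0 2 := le_b_iff s.edge_pos 0

theorem le_b_one_iff (s : d.IsSearchCase) {c : ℕ} :
    c ≤ d.b 1 ↔ c ^ 2 * d.edge 0 2 ≤ d.edge 0 1 * d.edge 1 2 := by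
  rw [le_b_iff s.edge_pos 1]
  change c ^ 2 * d.edge 2 0 ≤ d.edge 1 2 * d.edge 1 0 ↔ _
  rw [d.edge_comm 2 0, d.edge_comm 1 0, mul_comm (d.edge 1 2)]

theorem eq_b_zero (s : d.IsSearchCase) {c : ℕ} (h1 : c ^ 2 * d.edge 1 2 ≤ d.edge 0 1 * d.edge 0 2)
    (h2 : d.edge 0 1 * d.edge 0 2 < (c + 1) ^ 2 * d.edge 1 2) : c = d.b 0 := by
  have e1 := s.le_b_zero_iff.2 h1
  have e2 := mt (s.le_b_zero_iff (c := c + 1)).1 (by omega)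
  omega

theorem eq_b_one (s : d.IsSearchCase) {c : ℕ} (h1 : c ^ 2 * d.edge 0 2 ≤ d.edge 0 1 * d.edge 1 2)
    (h2 : d.edge 0 1 * d.edge 1 2 < (c + 1) ^ 2 * d.edge 0 2) : c = d.b 1 := by
  have e1 := s.le_b_one_iff.2 h1
  have e2 := mt (s.le_b_one_iff (c := c + 1)).1 (by omega)
  omega

theorem b_zero_spec (s : d.IsSearchCase) : d.b 0 ^ 2 * d.edge 1 2 ≤ d.edge 0 1 * d.edge 0 2 ∧
    d.edge 0 1 * d.edge 0 2 < (d.b 0 + 1) ^ 2 * d.edge 1 2 := by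
  refine ⟨s.le_b_zero_iff.1 le_rfl, ?_⟩
  have := mt (s.le_b_zero_iff (c := d.b 0 + 1)).2 (by omega)
  omega

theorem b_one_spec (s : d.IsSearchCase) : d.b 1 ^ 2 * d.edge 0 2 ≤ d.edge 0 1 * d.edge 1 2 ∧
    d.edge 0 1 * d.edge 1 2 < (d.b 1 + 1) ^ 2 * d.edge 0 2 := by
  refine ⟨s.le_b_one_iff.1 le_rfl, ?_⟩
  have := mt (s.le_b_one_iff (c := d.b 1 + 1)).2 (by omega)
  omega

theorem searchCondition (s : d.IsSearchCase) : SearchCondition (d.edge 0 1) (d.vert 0) (d.vert 1)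
    (d.vert 2) (d.edge 0 2) (d.edge 1 2) where
  hM := s.edge_pos _ _
  hMX := s.sorted.1
  hMY := s.sorted.1.trans s.sorted.2
  hXan := s.trivial_ineq 0 2 (by decide)
  hYbn := s.trivial_ineq 1 2 (by decide)
  hMab := s.trivial_ineq 0 1 (by decide)
  testA := by
    have := s.not_vertexTest 0
    rw [vertexTest_iff (j := 1) (k := 2) (by decide) (by decide) (by decide)] at this
    omega
  testB := by
    have := s.not_vertexTest 1
    rw [vertexTest_iff (j := 0) (k := 2) (by decide) (by decide) (by decide),
      d.edge_comm 1 0] at this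
    omega
  testN := by
    have := s.not_vertexTest 2
    rw [vertexTest_iff (j := 0) (k := 1) (by decide) (by decide) (by decide), d.edge_comm 2 0,
      d.edge_comm 2 1] at this
    omega
  hYMX := by
    have := (s.le_b_zero_iff (c := 1)).1 (by have := s.b_zero; omega)
    rwa [one_pow, one_mul] at this
  hXMY := s.sorted.2.trans (Nat.le_mul_of_pos_left _ (s.edge_pos _ _))

end IsSearchCase

/-- The numbers of core vertices of color 2 over which the procedure searches. -/
def IsCandidate (d : EdgeData) (t : ℕ) : Prop :=
  IsGoodSize (d.edge 0 1) (d.vert 0) (d.vert 1) (d.vert 2) (d.edge 0 2) (d.edge 1 2) (d.b 0) t ∧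
    (d.b 0 < d.vert 0 ∨ d.edge 0 1 = d.b 0 * t)

/-- If all vertices of color 1 are core vertices, the number of core vertices of color 2 is
determined, and is in the range. -/
theorem isCandidate_of_eq {d : EdgeData} (s : d.IsSearchCase) {t : ℕ} (ha : d.vert 0 = d.b 0)
    (hM : d.edge 0 1 = d.b 0 * t) : d.IsCandidate t := by
  have c := s.searchCondition
  obtain ⟨q1, q2⟩ := s.b_zero_spec
  have hb := s.b_zero
  unfold IsCandidate
  set M := d.edge 0 1
  set X := d.edge 0 2
  set Y := d.edge 1 2
  set b₁ := d.b 0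
  have hb1 : 1 ≤ b₁ := by omega
  have ht : 1 ≤ t := by
    rcases Nat.eq_zero_or_pos t with h0 | h0
    · rw [h0] at hM; have := c.hM; omega
    · exact h0
  have e1 : b₁ * Y ≤ t * X := by
    have : b₁ * (b₁ * Y) ≤ b₁ * (t * X) := by rw [hM] at q1; linarith
    exact Nat.le_of_mul_le_mul_left this hb1
  have hXn := c.hXan
  rw [ha] at hXn
  refine ⟨⟨hb1, ht, q1, q2, ha.ge, ?_, hM.ge, by rw [hM]; linarith, ?_, by linarith,
    ⟨X / b₁, ?_, Nat.mul_div_le _ _⟩, ⟨Y / t, Nat.div_mul_le_self _ _, ?_⟩⟩, Or.inr hM⟩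
  · have := c.hMab
    rw [ha, hM] at this
    exact Nat.le_of_mul_le_mul_left this hb1
  · have : b₁ * Y ≤ b₁ * (t * d.vert 2) := by
      refine e1.trans ?_
      calc t * X ≤ t * (b₁ * d.vert 2) := Nat.mul_le_mul_left _ hXn
        _ = _ := by ring
    exact Nat.le_of_mul_le_mul_left this hb1
  · have h1 : X < b₁ * (X / b₁ + 1) := by
      have := Nat.div_add_mod X b₁
      have := Nat.mod_lt X hb1
      rw [mul_add, mul_one]; omega
    have : b₁ * Y ≤ b₁ * ((X / b₁ + 1) * t) := by
      calc b₁ * Y ≤ t * X := e1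
        _ ≤ t * (b₁ * (X / b₁ + 1)) := Nat.mul_le_mul_left _ h1.le
        _ = _ := by ring
    exact Nat.le_of_mul_le_mul_left this hb1
  · have h1 := c.test_a (p := t) (q := X / b₁) (by rw [ha, hM, mul_comm])
      (by rw [ha]; exact Nat.div_mul_le_self _ _)
    have h2 : X / b₁ ≤ Y / t := (Nat.le_div_iff_mul_le ht).2 (by rw [mul_comm]; exact h1.le)
    have h3 := Nat.div_add_mod X b₁
    have h4 := Nat.mod_lt X hb1
    have h5 : b₁ * (X / b₁) ≤ b₁ * (Y / t) := Nat.mul_le_mul_left _ h2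
    have : (b₁ + 1) * (Y / t + 1) = b₁ * (Y / t) + b₁ + (Y / t + 1) := by ring
    have := Nat.zero_le (Y / t)
    omega

theorem isCandidate_iff_of_lt {d : EdgeData} (s : d.IsSearchCase) (hlt : d.b 0 < d.vert 0) {t : ℕ} :
    d.IsCandidate t ↔ d.edge 0 2 ≤ d.vert 2 * (d.b 0 + 1) ∧
      max (max (d.edge 0 1 ⌈/⌉ d.vert 0) (d.edge 0 1 ⌈/⌉ (d.b 0 + 1)))
        (max (d.edge 1 2 ⌈/⌉ (d.edge 0 2 / d.b 0 + 1)) (d.edge 1 2 ⌈/⌉ d.vert 2)) ≤ t ∧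
      t ≤ (if d.edge 0 2 ⌈/⌉ (d.b 0 + 1) - 1 = 0 then min (d.edge 0 1 / d.b 0) (d.vert 1) else
        min (min (d.edge 0 1 / d.b 0) (d.vert 1))
          (d.edge 1 2 / (d.edge 0 2 ⌈/⌉ (d.b 0 + 1) - 1))) := by
  have c := s.searchCondition
  have q := s.b_zero_spec
  have hb : 0 < d.b 0 := Nat.pos_of_ne_zero s.b_zero
  have hn := c.n_pos
  have hM := c.hM
  unfold IsCandidate
  set M := d.edge 0 1
  set X := d.edge 0 2
  set Y := d.edge 1 2
  set b₁ := d.b 0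
  have e1 : (∃ h, Y ≤ (h + 1) * t ∧ b₁ * h ≤ X) ↔ Y ≤ (X / b₁ + 1) * t := by
    constructor
    · rintro ⟨h, h1, h2⟩
      have : h ≤ X / b₁ := (Nat.le_div_iff_mul_le hb).2 (by rw [mul_comm]; exact h2)
      exact h1.trans (Nat.mul_le_mul_right _ (by omega))
    · intro h
      exact ⟨_, h, Nat.mul_div_le _ _⟩
  have ceil : ∀ {k m z : ℕ}, 0 < k → (m ⌈/⌉ k ≤ z ↔ m ≤ k * z) := fun hk => by
    rw [ceilDiv_le_iff_le_mul hk]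
  have e2 : (∃ h, h * t ≤ Y ∧ X ≤ (b₁ + 1) * (h + 1)) ↔ (X ⌈/⌉ (b₁ + 1) - 1) * t ≤ Y := by
    constructor
    · rintro ⟨h, h1, h2⟩
      have := (ceil (show 0 < b₁ + 1 by omega)).2 h2
      exact (Nat.mul_le_mul_right _ (by omega)).trans h1
    · intro h
      exact ⟨_, h, (ceil (show 0 < b₁ + 1 by omega)).1 (by omega)⟩
  have e3 : t ≤ (if X ⌈/⌉ (b₁ + 1) - 1 = 0 then min (M / b₁) (d.vert 1) else
        min (min (M / b₁) (d.vert 1)) (Y / (X ⌈/⌉ (b₁ + 1) - 1))) ↔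
      b₁ * t ≤ M ∧ t ≤ d.vert 1 ∧ (X ⌈/⌉ (b₁ + 1) - 1) * t ≤ Y := by
    split_ifs with h0
    · rw [le_min_iff, h0, Nat.le_div_iff_mul_le hb, mul_comm t]
      simp
    · rw [le_min_iff, le_min_iff, Nat.le_div_iff_mul_le hb, mul_comm t,
        Nat.le_div_iff_mul_le (Nat.pos_of_ne_zero h0), mul_comm t, and_assoc]
  rw [e3, max_le_iff, max_le_iff, max_le_iff, ceil c.a_pos, ceil (show 0 < b₁ + 1 by omega),
    ceil (Nat.succ_pos _), ceil hn, ← e1, ← e2]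
  constructor
  · rintro ⟨g, -⟩
    refine ⟨by rw [mul_comm]; exact g.hXn, ⟨⟨g.hMc.trans (Nat.mul_le_mul_right _ hlt), g.hMc⟩,
      g.lower, by rw [mul_comm]; exact g.hYn⟩, g.hcM, g.htb, g.upper⟩
  · rintro ⟨h1, ⟨⟨h2, h3⟩, h4, h5⟩, h6, h7, h8⟩
    refine ⟨⟨hb, ?_, q.1, q.2, hlt.le, h7, h6, h3, by rw [mul_comm]; exact h5,
      by rw [mul_comm]; exact h1, h4, h8⟩, Or.inl hlt⟩
    by_contra! h0
    have : t = 0 := by omega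
    rw [this] at h2
    omega

/-- The range computed by the procedure consists of the candidates. -/
theorem range₂_spec {d : EdgeData} (s : d.IsSearchCase) :
    (d.range₂ = none ∧ ∀ t, ¬ d.IsCandidate t) ∨
    ∃ lo hi, d.range₂ = some (lo, hi) ∧ lo ≤ hi ∧ ∀ t, d.IsCandidate t ↔ lo ≤ t ∧ t ≤ hi := by
  have hb := Nat.pos_of_ne_zero s.b_zero
  unfold range₂
  dsimp only
  by_cases h1 : d.vert 0 < d.b 0
  · rw [if_pos h1]
    refine Or.inl ⟨rfl, fun t h => ?_⟩
    have := h.1.hca; omega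
  rw [if_neg h1]
  by_cases h2 : d.vert 0 = d.b 0
  · rw [if_pos h2]
    split_ifs with h3
    · refine Or.inr ⟨_, _, rfl, le_rfl, fun t => ?_⟩
      rw [h2] at h3 ⊢
      constructor
      · rintro ⟨-, h | h⟩
        · omega
        · rw [h, Nat.mul_div_cancel_left _ hb]; exact ⟨le_rfl, le_rfl⟩
      · intro h
        obtain rfl : t = d.edge 0 1 / d.b 0 := by omega
        exact isCandidate_of_eq s h2 (Nat.mul_div_cancel' h3).symm
    · refine Or.inl ⟨rfl, fun t h => ?_⟩
      rcases h.2 with h | h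
      · omega
      · exact h3 (by rw [h2, h]; exact Nat.dvd_mul_right _ _)
  rw [if_neg h2]
  have iff := fun t => isCandidate_iff_of_lt s (show d.b 0 < d.vert 0 by omega) (t := t)
  set hi := if d.edge 0 2 ⌈/⌉ (d.b 0 + 1) - 1 = 0 then min (d.edge 0 1 / d.b 0) (d.vert 1) else
    min (min (d.edge 0 1 / d.b 0) (d.vert 1)) (d.edge 1 2 / (d.edge 0 2 ⌈/⌉ (d.b 0 + 1) - 1))
  clear_value hi
  split_ifs with h4
  · refine Or.inr ⟨_, _, rfl, h4.2, fun t => ?_⟩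
    rw [iff]
    exact ⟨fun h => h.2, fun h => ⟨h4.1, h⟩⟩
  · exact Or.inl ⟨rfl, fun t h => h4 ⟨((iff t).1 h).1, ((iff t).1 h).2.1.trans ((iff t).1 h).2.2⟩⟩

end EdgeData

/-! ### The search finds the maximum -/

namespace EdgeData

/-- Division with a remainder in `{1, …, h}`. -/
theorem exists_eq_add_of_pos {m h : ℕ} (hm : 0 < m) (hh : 0 < h) :
    ∃ p α, m = p * h + α ∧ α ≤ h ∧ 0 < α := by
  refine ⟨(m - 1) / h, (m - 1) % h + 1, ?_, Nat.mod_lt _ hh, Nat.succ_pos _⟩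
  have := Nat.div_add_mod' (m - 1) h
  omega

theorem exists_mem_best (d : EdgeData) {L : List Params} (hL : L ≠ []) :
    ∃ P ∈ L, P.facets d = d.best L := by
  induction L with
  | nil => exact absurd rfl hL
  | cons P L ih =>
    have e : d.best (P :: L) = max (P.facets d) (d.best L) := rfl
    rcases eq_or_ne L [] with rfl | hne
    · exact ⟨P, by simp, by rw [e]; simp [best]⟩
    · obtain ⟨Q, hQ, hQ'⟩ := ih hne
      rcases le_total (P.facets d) (d.best L) with h | h
      · exact ⟨Q, List.mem_cons_of_mem _ hQ, by rw [e, max_eq_right h, hQ']⟩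
      · exact ⟨P, by simp, by rw [e, max_eq_left h]⟩

theorem le_best (d : EdgeData) {L : List Params} {P : Params} (hP : P ∈ L) :
    P.facets d ≤ d.best L := by
  induction L with
  | nil => simp at hP
  | cons Q L ih =>
    have e : d.best (Q :: L) = max (Q.facets d) (d.best L) := rfl
    rw [e]
    rcases List.mem_cons.1 hP with rfl | h
    · exact le_max_left _ _
    · exact (ih h).trans (le_max_right _ _)

theorem descend_succ (d : EdgeData) (lo t : ℕ) (L : List Params) :
    d.descend lo (t + 1) L = if lo ≤ t + 1 ∧ (d.known 1 (t + 1)).WellDefined d then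
      if d.v t ≤ d.best (L ++ [d.known 1 (t + 1)]) then L ++ [d.known 1 (t + 1)]
      else d.descend lo t (L ++ [d.known 1 (t + 1)]) else L := rfl

theorem ascend_succ (d : EdgeData) (n t : ℕ) (L : List Params) :
    d.ascend (n + 1) t L = if (d.known 1 t).WellDefined d then
      if d.v (t + 1) ≤ d.best (L ++ [d.known 1 t]) then L ++ [d.known 1 t]
      else d.ascend n (t + 1) (L ++ [d.known 1 t]) else L := rfl

theorem subset_descend (d : EdgeData) (lo t : ℕ) (L : List Params) : L ⊆ d.descend lo t L := by
  induction t generalizing L with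
  | zero => exact List.Subset.refl _
  | succ t ih =>
    rw [descend_succ]
    split_ifs
    · exact List.subset_append_left _ _
    · exact List.Subset.trans (List.subset_append_left _ _) (ih _)
    · exact List.Subset.refl _

theorem subset_ascend (d : EdgeData) (n t : ℕ) (L : List Params) : L ⊆ d.ascend n t L := by
  induction n generalizing L t with
  | zero => exact List.Subset.refl _
  | succ n ih =>
    rw [ascend_succ]
    split_ifs
    · exact List.subset_append_left _ _
    · exact List.Subset.trans (List.subset_append_left _ _) (ih _ _)
    · exact List.Subset.refl _

theorem wellDefined_of_mem_descend {d : EdgeData} {lo t : ℕ} {L : List Params}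
    (hL : ∀ P ∈ L, P.WellDefined d) : ∀ P ∈ d.descend lo t L, P.WellDefined d := by
  induction t generalizing L with
  | zero => exact hL
  | succ t ih =>
    rw [descend_succ]
    split_ifs with h1 h2
    · simpa [or_imp, forall_and] using ⟨hL, h1.2⟩
    · exact ih (by simpa [or_imp, forall_and] using ⟨hL, h1.2⟩)
    · exact hL

theorem wellDefined_of_mem_ascend {d : EdgeData} {n t : ℕ} {L : List Params}
    (hL : ∀ P ∈ L, P.WellDefined d) : ∀ P ∈ d.ascend n t L, P.WellDefined d := by
  induction n generalizing L t with
  | zero => exact hL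
  | succ n ih =>
    rw [ascend_succ]
    split_ifs with h1 h2
    · simpa [or_imp, forall_and] using ⟨hL, h1⟩
    · exact ih (by simpa [or_imp, forall_and] using ⟨hL, h1⟩)
    · exact hL

theorem wellDefined_of_mem_evaluated {d : EdgeData} : ∀ P ∈ d.evaluated, P.WellDefined d := by
  have h0 : ∀ P ∈ d.firstCandidates.filter fun P => P.WellDefined d, P.WellDefined d :=
    fun P hP => by simpa using (List.mem_filter.1 hP).2
  unfold evaluated
  split
  · exact h0
  · split_ifs
    · exact wellDefined_of_mem_ascend (wellDefined_of_mem_descend h0)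
    · exact wellDefined_of_mem_ascend h0
    · exact wellDefined_of_mem_descend h0

theorem firstCandidates_subset_evaluated (d : EdgeData) :
    (d.firstCandidates.filter fun P => P.WellDefined d) ⊆ d.evaluated := by
  unfold evaluated
  split
  · exact List.Subset.refl _
  · split_ifs
    · exact List.Subset.trans (d.subset_descend _ _ _) (d.subset_ascend _ _ _)
    · exact d.subset_ascend _ _ _
    · exact d.subset_descend _ _ _

/-- The descending search stops only when nothing is to be gained. -/
theorem exists_mem_descend {d : EdgeData} {lo s t T : ℕ} {L : List Params}
    (hw : ∀ s', s ≤ s' → s' ≤ t → (d.known 1 s').WellDefined d)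
    (hv : ∀ s', s ≤ s' → s' ≤ t → d.v s ≤ d.v s') (hlo : lo ≤ s) (hst : s ≤ t) (hs : 1 ≤ s)
    (hT : (T : ℚ) ≤ d.v s) (hT' : T ≤ (d.known 1 s).facets d) :
    ∃ P ∈ d.descend lo t L, T ≤ P.facets d := by
  induction t generalizing L with
  | zero => omega
  | succ t ih =>
    rw [descend_succ, if_pos ⟨hlo.trans hst, hw _ hst le_rfl⟩]
    rcases hst.lt_or_eq with hlt | rfl
    · split_ifs with hc
      · obtain ⟨P, hP, e⟩ := d.exists_mem_best (L := L ++ [d.known 1 (t + 1)]) (by simp)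
        refine ⟨P, hP, ?_⟩
        rw [e]
        exact_mod_cast hT.trans ((hv t (by omega) (by omega)).trans hc)
      · exact ih (fun s' h1 h2 => hw s' h1 (by omega)) (fun s' h1 h2 => hv s' h1 (by omega))
          (by omega)
    · split_ifs
      · exact ⟨_, by simp, hT'⟩
      · exact ⟨_, d.subset_descend _ _ _ (by simp), hT'⟩

/-- The ascending search stops only when nothing is to be gained. -/
theorem exists_mem_ascend {d : EdgeData} {n s t T : ℕ} {L : List Params}
    (hw : ∀ s', t ≤ s' → s' ≤ s → (d.known 1 s').WellDefined d)
    (hv : ∀ s', t ≤ s' → s' ≤ s → d.v s ≤ d.v s') (hts : t ≤ s) (hsn : s < t + n)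
    (hT : (T : ℚ) ≤ d.v s) (hT' : T ≤ (d.known 1 s).facets d) :
    ∃ P ∈ d.ascend n t L, T ≤ P.facets d := by
  induction n generalizing L t with
  | zero => omega
  | succ n ih =>
    rw [ascend_succ, if_pos (hw _ le_rfl hts)]
    rcases hts.lt_or_eq with hlt | rfl
    · split_ifs with hc
      · obtain ⟨P, hP, e⟩ := d.exists_mem_best (L := L ++ [d.known 1 t]) (by simp)
        refine ⟨P, hP, ?_⟩
        rw [e]
        exact_mod_cast hT.trans ((hv (t + 1) (by omega) (by omega)).trans hc)
      · exact ih (fun s' h1 h2 => hw s' (by omega) h2) (fun s' h1 h2 => hv s' (by omega) h2)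
          (by omega) (by omega)
    · split_ifs
      · exact ⟨_, by simp, hT'⟩
      · exact ⟨_, d.subset_ascend _ _ _ (by simp), hT'⟩

/-- Up to a constant, `v` is the negative of a multiple of `t ↦ t X + M Y / t`. -/
theorem v_eq (d : EdgeData) {t : ℕ} (ht : 0 < t) :
    d.v t = d.b 0 * d.edge 1 2 + d.edge 0 1 * d.edge 0 2 + d.b 0 ^ 2 * d.edge 1 2 -
      d.b 0 * (t * d.edge 0 2 + d.edge 0 1 * d.edge 1 2 / t) := by
  have : (t : ℚ) ≠ 0 := by positivity
  unfold v
  field_simp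
  ring

/-- The function `v` is monotone on either side of its maximum. -/
theorem v_le_v (d : EdgeData) {s t : ℕ} (hs : 0 < s) (ht : 0 < t)
    (h : (s ≤ t ∧ s * t * d.edge 0 2 ≤ d.edge 0 1 * d.edge 1 2) ∨
      (t ≤ s ∧ d.edge 0 1 * d.edge 1 2 ≤ s * t * d.edge 0 2)) : d.v s ≤ d.v t := by
  rw [d.v_eq hs, d.v_eq ht]
  have hs' : (0 : ℚ) < s := by exact_mod_cast hs
  have ht' : (0 : ℚ) < t := by exact_mod_cast ht
  have key : (0 : ℚ) ≤ (t - s) * (d.edge 0 1 * d.edge 1 2 - s * t * d.edge 0 2) := by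
    rcases h with ⟨h1, h2⟩ | ⟨h1, h2⟩
    · have h1' : (s : ℚ) ≤ t := by exact_mod_cast h1
      have h2' : (s * t * d.edge 0 2 : ℚ) ≤ d.edge 0 1 * d.edge 1 2 := by exact_mod_cast h2
      exact mul_nonneg (by linarith) (by linarith)
    · have h1' : (t : ℚ) ≤ s := by exact_mod_cast h1
      have h2' : (d.edge 0 1 * d.edge 1 2 : ℚ) ≤ s * t * d.edge 0 2 := by exact_mod_cast h2
      exact mul_nonneg_of_nonpos_of_nonpos (by linarith) (by linarith)
  have e : (s * d.edge 0 2 + d.edge 0 1 * d.edge 1 2 / s : ℚ) -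
      (t * d.edge 0 2 + d.edge 0 1 * d.edge 1 2 / t) =
      (t - s) * (d.edge 0 1 * d.edge 1 2 - s * t * d.edge 0 2) / (s * t) := by
    field_simp
    ring
  have : (t * d.edge 0 2 + d.edge 0 1 * d.edge 1 2 / t : ℚ) ≤
      s * d.edge 0 2 + d.edge 0 1 * d.edge 1 2 / s := by
    have : 0 ≤ (t - s) * (d.edge 0 1 * d.edge 1 2 - s * t * d.edge 0 2) / (s * t : ℚ) := by
      positivity
    linarith
  have := mul_le_mul_of_nonneg_left this (Nat.cast_nonneg (α := ℚ) (d.b 0))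
  linarith

theorem IsSearchCase.v_le_v_of_le {d : EdgeData} (s : d.IsSearchCase) {t t' : ℕ} (ht : 0 < t)
    (h : t ≤ t') (hb : t' ≤ d.b 1) : d.v t ≤ d.v t' := by
  refine d.v_le_v ht (by omega) (Or.inl ⟨h, ?_⟩)
  refine le_trans (Nat.mul_le_mul_right _ ?_) s.b_one_spec.1
  rw [sq]
  exact Nat.mul_le_mul (h.trans hb) hb

theorem IsSearchCase.v_le_v_of_ge {d : EdgeData} (s : d.IsSearchCase) {t t' : ℕ} (hb : d.b 1 < t')
    (h : t' ≤ t) : d.v t ≤ d.v t' := by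
  refine d.v_le_v (by omega) (by omega) (Or.inr ⟨h, ?_⟩)
  refine s.b_one_spec.2.le.trans (Nat.mul_le_mul_right _ ?_)
  rw [sq]
  exact Nat.mul_le_mul (by omega) hb

/-- The first `e` of `t` balanced slots contain at least their proportional share. -/
theorem sum_balanced_le {Y t e : ℕ} (ht : 0 < t) (he : e ≤ t) :
    t * ∑ k ∈ range e, balanced Y t k ≥ e * Y := by
  obtain ⟨h, y, hY, hy, -⟩ : ∃ h y, Y = h * t + y ∧ y ≤ t ∧ True :=
    ⟨Y / t, Y % t, (Nat.div_add_mod' Y t).symm, (Nat.mod_lt _ ht).le, trivial⟩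
  have : ∑ k ∈ range e, balanced Y t k = e * h + min y e := by
    rw [Finset.sum_congr rfl fun k hk => balanced_eq hY hy ((mem_range.1 hk).trans_le he),
      Finset.sum_add_distrib, sum_ite_lt]
    simp
  rw [this, hY]
  rcases le_total y e with hc | hc
  · rw [min_eq_left hc]
    have := Nat.mul_le_mul_right y he
    linarith
  · rw [min_eq_right hc]
    have := Nat.mul_le_mul_left e hy
    linarith

/-- `v` bounds the value of balanced slots. -/
theorem balancedValue_le_v {d : EdgeData} {t : ℕ} (ht : 0 < t) (h1 : d.b 0 * t ≤ d.edge 0 1)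
    (h2 : d.edge 0 1 ≤ (d.b 0 + 1) * t) :
    (balancedValue (d.edge 0 2) (d.edge 0 1) (d.edge 1 2) t : ℚ) ≤ d.v t := by
  obtain ⟨e, he⟩ := Nat.exists_eq_add_of_le h1
  have het : e ≤ t := by linarith
  set X := d.edge 0 2
  set Y := d.edge 1 2
  set c := d.b 0
  have b1 : ∀ k ∈ range t, min X (balanced (d.edge 0 1) t k * balanced Y t k) ≤
      if k < e then X else c * balanced Y t k := fun k hk => by
    rw [balanced_eq he het (mem_range.1 hk)]
    split_ifs
    · exact min_le_left _ _
    · rw [add_zero]; exact min_le_right _ _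
  have b2 : balancedValue X (d.edge 0 1) Y t + c * ∑ k ∈ range e, balanced Y t k ≤
      e * X + c * Y := by
    have h3 : ∑ k ∈ range t, (if k < e then X else c * balanced Y t k) +
        c * ∑ k ∈ range e, balanced Y t k = e * X + c * Y := by
      obtain ⟨w, hw⟩ := Nat.exists_eq_add_of_le het
      have s1 := sum_balanced Y ht
      rw [hw, Finset.sum_range_add] at s1 ⊢
      have e1 : ∑ k ∈ range e, (if k < e then X else c * balanced Y (e + w) k) = e * X := by
        rw [Finset.sum_congr rfl fun k hk => if_pos (mem_range.1 hk)]; simp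
      have e2 : ∑ k ∈ range w, (if e + k < e then X else c * balanced Y (e + w) (e + k)) =
          c * ∑ k ∈ range w, balanced Y (e + w) (e + k) := by
        rw [Finset.mul_sum]
        exact Finset.sum_congr rfl fun k _ => if_neg (by omega)
      rw [e1, e2, add_assoc, ← mul_add, add_comm (∑ k ∈ range w, _), s1]
    rw [← h3]
    exact Nat.add_le_add_right (Finset.sum_le_sum b1) _
  have b3 := sum_balanced_le (Y := Y) ht het
  set V := balancedValue X (d.edge 0 1) Y t
  set S := ∑ k ∈ range e, balanced Y t k
  have b2' : (V : ℚ) + c * S ≤ e * X + c * Y := by exact_mod_cast b2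
  have b3' : (e * Y : ℚ) / t ≤ S := by
    rw [div_le_iff₀ (by exact_mod_cast ht), mul_comm (S : ℚ)]
    exact_mod_cast b3
  have he' : (d.edge 0 1 : ℚ) = c * t + e := by exact_mod_cast he
  have b4 := mul_le_mul_of_nonneg_left b3' (Nat.cast_nonneg (α := ℚ) c)
  unfold v
  rw [he']
  change (V : ℚ) ≤ c * Y + (c * t + e - c * t) * (X - c * Y / t)
  have : (c * t + e - c * t) * (X - c * Y / t) = e * X - c * (e * Y / t : ℚ) := by ring
  linarith

/-- For a good size, the corresponding candidate is well-defined, and has as many facets as balanced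
slots. -/
theorem IsSearchCase.known_one {d : EdgeData} (s : d.IsSearchCase) {t : ℕ} (h : d.IsCandidate t) :
    (d.known 1 t).WellDefined d ∧
      balancedValue (d.edge 0 2) (d.edge 0 1) (d.edge 1 2) t ≤ (d.known 1 t).facets d := by
  obtain ⟨g, hc⟩ := h
  have sc := s.searchCondition
  obtain ⟨p, α, hp, hα, hα0⟩ := exists_eq_add_of_pos sc.hM g.ht
  obtain ⟨q, β, hq, hβ, hβ0⟩ := exists_eq_add_of_pos (s.edge_pos 1 2) g.ht
  obtain ⟨k, hk, hk'⟩ := g.lower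
  have hpc : p ≤ d.b 0 := by
    by_contra! hlt
    have := g.hMc
    have : (d.b 0 + 1) * t ≤ p * t := Nat.mul_le_mul_right _ hlt
    omega
  have hqk : q ≤ k := by
    by_contra! hlt
    have : (k + 1) * t ≤ q * t := Nat.mul_le_mul_right _ hlt
    omega
  have hcq : d.b 0 * q ≤ d.edge 0 2 := (Nat.mul_le_mul_left _ hqk).trans hk'
  have htM : t ≤ d.edge 0 1 := (Nat.le_mul_of_pos_left t g.hc).trans g.hcM
  have hMa : d.edge 0 1 ≤ d.vert 0 * t := by
    rcases hc with hc | hc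
    · exact g.hMc.trans (Nat.mul_le_mul_right _ hc)
    · rw [hc]; exact Nat.mul_le_mul_right _ g.hca
  have hw : (d.known 1 t).WellDefined d := by
    refine known_wellDefined (r := 1) (p₀ := p) (q₀ := q) hp hα hα0
      (show d.edge 2 1 = _ by rw [d.edge_comm]; exact hq) hβ hβ0 htM
      (show t ≤ d.edge 2 1 by rw [d.edge_comm]; exact htM.trans sc.hMY) g.htb hMa
      (show d.edge 2 1 ≤ d.vert 2 * t by rw [d.edge_comm, mul_comm]; exact g.hYn)
      (show p * q ≤ d.edge 0 2 from (Nat.mul_le_mul_right _ hpc).trans hcq)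
      (fun _ => (Nat.le_mul_of_pos_left q g.hc).trans hcq)
      (fun _ => le_trans ?_ (show d.edge 0 1 ≤ d.edge 0 2 from sc.hMX))
    rw [hp]
    exact add_le_add (Nat.le_mul_of_pos_right p g.ht) hα0
  refine ⟨hw, ?_⟩
  have := balancedValue_le_facets_known hw hMa
    (show d.edge 2 1 ≤ d.vert 2 * t by rw [d.edge_comm, mul_comm]; exact g.hYn)
  rw [d.edge_comm (other₂ 1)] at this
  exact this

/-- The search finds the best candidate. -/
theorem IsSearchCase.exists_of_isCandidate {d : EdgeData} (s : d.IsSearchCase) {t T : ℕ}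
    (ht : d.IsCandidate t)
    (hT : T ≤ balancedValue (d.edge 0 2) (d.edge 0 1) (d.edge 1 2) t) :
    ∃ P ∈ d.evaluated, T ≤ P.facets d := by
  obtain ⟨hw, hf⟩ := s.known_one ht
  have hv : (T : ℚ) ≤ d.v t := le_trans (by exact_mod_cast hT)
    (balancedValue_le_v ht.1.ht ht.1.hcM ht.1.hMc)
  have hf' := hT.trans hf
  rcases range₂_spec s with ⟨-, h⟩ | ⟨lo, hi, h1, h2, h3⟩
  · exact absurd ht (h t)
  obtain ⟨l1, l2⟩ := (h3 t).1 ht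
  have hwd : ∀ s', lo ≤ s' → s' ≤ hi → (d.known 1 s').WellDefined d := fun s' g1 g2 =>
    (s.known_one ((h3 s').2 ⟨g1, g2⟩)).1
  unfold evaluated
  rw [h1]
  dsimp only
  split_ifs with c1 c2
  · rcases le_or_gt t (d.b 1) with hb | hb
    · obtain ⟨P, hP, hP'⟩ := exists_mem_descend (d := d) (lo := lo) (s := t) (t := d.b 1)
        (L := d.firstCandidates.filter fun P => P.WellDefined d)
        (fun s' g1 g2 => hwd s' (by omega) (by omega))
        (fun s' g1 g2 => s.v_le_v_of_le ht.1.ht g1 g2) l1 hb ht.1.ht hv hf'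
      exact ⟨P, d.subset_ascend _ _ _ hP, hP'⟩
    · exact exists_mem_ascend (fun s' g1 g2 => hwd s' (by omega) (by omega))
        (fun s' g1 g2 => s.v_le_v_of_ge (by omega) g2) hb (by omega) hv hf'
  · exact exists_mem_ascend (fun s' g1 g2 => hwd s' (by omega) (by omega))
      (fun s' g1 g2 => s.v_le_v_of_ge (by omega) g2) l1 (by omega) hv hf'
  · exact exists_mem_descend (fun s' g1 g2 => hwd s' (by omega) (by omega))
        (fun s' g1 g2 => s.v_le_v_of_le ht.1.ht g1 (by omega)) l1 l2 ht.1.ht hv hf'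

theorem exists_of_mem_firstCandidates {d : EdgeData} {P : Params} {T : ℕ}
    (hP : P ∈ d.firstCandidates) (hw : P.WellDefined d) (hT : T ≤ P.facets d) :
    ∃ P ∈ d.evaluated, T ≤ P.facets d :=
  ⟨P, d.firstCandidates_subset_evaluated (List.mem_filter.2 ⟨hP, by simpa using hw⟩), hT⟩

theorem mem_twoCandidates {d : EdgeData} {i r : Fin 3} {t : ℕ}
    (h1 : d.edge i r ⌈/⌉ (d.b i + 1) ≤ t) (h2 : t ≤ d.edge i r / d.b i)
    (h3 : d.edge i r / d.b i ≤ d.edge i r ⌈/⌉ (d.b i + 1) + 1) :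
    d.known r t ∈ d.twoCandidates i r := by
  unfold twoCandidates
  dsimp only
  rcases h1.lt_or_eq with h | h
  · have e : t = d.edge i r / d.b i := by omega
    rw [if_pos (h.trans_le h2), e]
    simp
  · split_ifs with hc hc
    · rw [h]; simp
    · rw [h]; simp
    · omega

/-- A good size with the first two colors exchanged is among the `firstCandidates`. -/
theorem IsSearchCase.exists_of_isGoodSize {d : EdgeData} (s : d.IsSearchCase) {c t T : ℕ}
    (g : IsGoodSize (d.edge 0 1) (d.vert 1) (d.vert 0) (d.vert 2) (d.edge 1 2) (d.edge 0 2) c t)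
    (hc : c < d.vert 1 ∨ d.edge 0 1 = c * t)
    (hT : T ≤ balancedValue (d.edge 1 2) (d.edge 0 1) (d.edge 0 2) t) :
    ∃ P ∈ d.evaluated, T ≤ P.facets d := by
  have sc := s.searchCondition
  obtain rfl := s.eq_b_one g.sq_le g.lt_sq
  set c := d.b 1 with hcdef
  obtain ⟨p, α, hp, hα, hα0⟩ := exists_eq_add_of_pos sc.hM g.ht
  obtain ⟨q, β, hq, hβ, hβ0⟩ := exists_eq_add_of_pos (s.edge_pos 0 2) g.ht
  obtain ⟨k, hk, hk'⟩ := g.lower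
  have hpc : p ≤ c := by
    by_contra! hlt
    have := g.hMc
    have : (c + 1) * t ≤ p * t := Nat.mul_le_mul_right _ hlt
    omega
  have hqk : q ≤ k := by
    by_contra! hlt
    have : (k + 1) * t ≤ q * t := Nat.mul_le_mul_right _ hlt
    omega
  have hcq : c * q ≤ d.edge 1 2 := (Nat.mul_le_mul_left _ hqk).trans hk'
  have htM : t ≤ d.edge 0 1 := (Nat.le_mul_of_pos_left t g.hc).trans g.hcM
  have hMb : d.edge 0 1 ≤ d.vert 1 * t := by
    rcases hc with hc | hc
    · exact g.hMc.trans (Nat.mul_le_mul_right _ hc)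
    · rw [hc]; exact Nat.mul_le_mul_right _ g.hca
  have hi : d.edge 1 0 ≤ d.vert 1 * t := by rw [d.edge_comm]; exact hMb
  have hj : d.edge 2 0 ≤ d.vert 2 * t := by rw [d.edge_comm, mul_comm]; exact g.hYn
  have hw : (d.known 0 t).WellDefined d := by
    refine known_wellDefined (r := 0) (p₀ := p) (q₀ := q)
      (show d.edge 1 0 = _ by rw [d.edge_comm]; exact hp) hα hα0
      (show d.edge 2 0 = _ by rw [d.edge_comm]; exact hq) hβ hβ0
      (show t ≤ d.edge 1 0 by rw [d.edge_comm]; exact htM)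
      (show t ≤ d.edge 2 0 by rw [d.edge_comm]; exact htM.trans sc.hMX) g.htb hi hj
      (show p * q ≤ d.edge 1 2 from (Nat.mul_le_mul_right _ hpc).trans hcq)
      (fun _ => (Nat.le_mul_of_pos_left q g.hc).trans hcq)
      (fun _ => le_trans ?_ (show d.edge 0 1 ≤ d.edge 1 2 from sc.hMY))
    rw [hp]
    exact add_le_add (Nat.le_mul_of_pos_right p g.ht) hα0
  have hf := balancedValue_le_facets_known hw hi hj
  rw [d.edge_comm (other₁ 0) 0, d.edge_comm (other₂ 0) 0] at hf
  have hmem : d.known 0 t ∈ d.twoCandidates 1 0 := by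
    have hc0 := g.hc
    refine mem_twoCandidates ?_ ?_ ?_ <;> rw [d.edge_comm 1 0, ← hcdef]
    · rw [ceilDiv_le_iff_le_mul (by omega)]; exact g.hMc
    · rw [Nat.le_div_iff_mul_le hc0, mul_comm]; exact g.hcM
    · -- the bounds on `t` differ by less than `2`, as `d.edge 0 1 < (c + 1) ^ 2`
      by_contra! hlt
      set l := d.edge 0 1 ⌈/⌉ (c + 1) with hl
      have h1 : d.edge 0 1 ≤ (c + 1) * l := (ceilDiv_le_iff_le_mul (by omega)).1 hl.ge
      have h2 : (l + 2) * c ≤ d.edge 0 1 := (Nat.le_div_iff_mul_le hc0).1 hlt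
      have h3 : d.edge 0 1 < (c + 1) ^ 2 := by
        by_contra! h
        have h4 := g.lt_sq
        have : (c + 1) ^ 2 * d.edge 0 2 ≤ d.edge 0 1 * d.edge 1 2 := Nat.mul_le_mul h s.sorted.2
        omega
      have h4 : 2 * c ≤ l := by linarith
      have h5 : (2 * c + 2) * c ≤ (l + 2) * c := Nat.mul_le_mul_right _ (by omega)
      nlinarith
  refine exists_of_mem_firstCandidates ?_ hw (hT.trans hf)
  unfold firstCandidates
  simp only [List.mem_append]
  exact Or.inl (Or.inr hmem)

theorem le_div_of_eq {m p h α : ℕ} (hh : 0 < h) (e : m = p * h + α) : p ≤ m / h := by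
  rw [Nat.le_div_iff_mul_le hh]; omega

/-- All vertices of color 3 are core vertices. -/
theorem IsSearchCase.exists_of_flat {d : EdgeData} (s : d.IsSearchCase) {T : ℕ}
    (h1 : d.vert 2 ≤ d.edge 0 2) (h2 : d.vert 2 ≤ d.edge 1 2)
    (hT : T ≤ balancedValue (d.edge 0 1) (d.edge 0 2) (d.edge 1 2) (d.vert 2)) :
    ∃ P ∈ d.evaluated, T ≤ P.facets d := by
  have sc := s.searchCondition
  have sorted := s.sorted.2
  have hX0 := s.edge_pos 0 2
  have hY0 := s.edge_pos 1 2
  have hM0 := s.edge_pos 0 1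
  have hn := sc.n_pos
  obtain ⟨p, α, hp, hα, hα0⟩ := exists_eq_add_of_pos hX0 hn
  obtain ⟨q, β, hq, hβ, hβ0⟩ := exists_eq_add_of_pos hY0 hn
  have hXn : 1 ≤ d.edge 0 2 / d.vert 2 := Nat.div_pos h1 hn
  have hYn : 1 ≤ d.edge 1 2 / d.vert 2 := Nat.div_pos h2 hn
  have hpX := le_div_of_eq hn hp
  have hqY := le_div_of_eq hn hq
  have test := sc.testN
  have hpq : p * q ≤ d.edge 0 1 := (Nat.mul_le_mul hpX hqY).trans test.le
  have hq1 : q ≤ d.edge 0 1 := hqY.trans ((Nat.le_mul_of_pos_left _ hXn).trans test.le)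
  have hp1 : p + 1 ≤ d.edge 0 1 := by
    have := Nat.le_mul_of_pos_right (d.edge 0 2 / d.vert 2) hYn
    omega
  have o1 : other₁ 2 = 0 := by decide
  have o2 : other₂ 2 = 1 := by decide
  have hw : (d.known 2 (d.vert 2)).WellDefined d := by
    have := @known_wellDefined d 2 (d.vert 2) p q α β
    rw [o1, o2] at this
    exact this hp hα hα0 hq hβ hβ0 h1 h2 le_rfl sc.hXan sc.hYbn hpq (fun _ => hq1) (fun _ => hp1)
  have hf := @balancedValue_le_facets_known d 2 (d.vert 2) hw
  rw [o1, o2] at hf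
  refine exists_of_mem_firstCandidates ?_ hw (hT.trans (hf sc.hXan sc.hYbn))
  exact List.mem_append_right _ (List.mem_singleton_self _)

/-- All vertices of color 1 are core vertices, and color 1 has no extra vertex. -/
theorem IsSearchCase.exists_of_vert_zero {d : EdgeData} (s : d.IsSearchCase) {T : ℕ}
    (h1 : d.vert 0 ^ 2 * d.edge 1 2 ≤ d.edge 0 1 * d.edge 0 2)
    (h2 : d.edge 0 1 * d.edge 0 2 < (d.vert 0 + 1) ^ 2 * d.edge 1 2)
    (hT : T ≤ balancedValue (d.edge 1 2) (d.edge 0 1) (d.edge 0 2) (d.vert 0)) :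
    ∃ P ∈ d.evaluated, T ≤ P.facets d := by
  have sc := s.searchCondition
  have sorted := s.sorted.2
  have hX0 := s.edge_pos 0 2
  have hY0 := s.edge_pos 1 2
  have hM0 := s.edge_pos 0 1
  have ha := sc.a_pos
  have e := s.eq_b_zero h1 h2
  have haM : d.vert 0 ≤ d.edge 0 1 := by
    have : d.vert 0 ^ 2 * d.edge 0 2 ≤ d.edge 0 1 * d.edge 0 2 :=
      (Nat.mul_le_mul_left _ sorted).trans h1
    have := Nat.le_of_mul_le_mul_right this hX0
    nlinarith
  obtain ⟨p, α, hp, hα, hα0⟩ := exists_eq_add_of_pos hM0 ha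
  obtain ⟨q, β, hq, hβ, hβ0⟩ := exists_eq_add_of_pos hX0 ha
  have hi : d.edge 1 0 ≤ d.vert 1 * d.vert 0 := by rw [d.edge_comm, mul_comm]; exact sc.hMab
  have hj : d.edge 2 0 ≤ d.vert 2 * d.vert 0 := by rw [d.edge_comm, mul_comm]; exact sc.hXan
  have hw : (d.known 0 (d.vert 0)).WellDefined d := by
    refine known_wellDefined (r := 0) (p₀ := p) (q₀ := q)
      (show d.edge 1 0 = _ by rw [d.edge_comm]; exact hp) hα hα0
      (show d.edge 2 0 = _ by rw [d.edge_comm]; exact hq) hβ hβ0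
      (show _ ≤ d.edge 1 0 by rw [d.edge_comm]; exact haM)
      (show _ ≤ d.edge 2 0 by rw [d.edge_comm]; exact haM.trans sc.hMX) le_rfl hi hj
      ((Nat.mul_le_mul (le_div_of_eq ha hp) (le_div_of_eq ha hq)).trans sc.testA.le) (fun h0 => ?_)
      (fun h0 => ?_)
    · change q ≤ d.edge 1 2
      have : q ≤ q * d.vert 0 := Nat.le_mul_of_pos_right _ ha
      omega
    · change p + 1 ≤ d.edge 1 2
      have : p ≤ p * d.vert 0 := Nat.le_mul_of_pos_right _ ha
      have := sc.hMY
      omega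
  have hf := balancedValue_le_facets_known hw hi hj
  rw [d.edge_comm (other₁ 0) 0, d.edge_comm (other₂ 0) 0] at hf
  refine exists_of_mem_firstCandidates ?_ hw (hT.trans hf)
  simp [firstCandidates, ← e]

/-- All vertices of color 2 are core vertices, and color 2 has no extra vertex. -/
theorem IsSearchCase.exists_of_vert_one {d : EdgeData} (s : d.IsSearchCase) {T : ℕ}
    (h1 : d.vert 1 ^ 2 * d.edge 0 2 ≤ d.edge 0 1 * d.edge 1 2)
    (h2 : d.edge 0 1 * d.edge 1 2 < (d.vert 1 + 1) ^ 2 * d.edge 0 2)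
    (hT : T ≤ balancedValue (d.edge 0 2) (d.edge 0 1) (d.edge 1 2) (d.vert 1)) :
    ∃ P ∈ d.evaluated, T ≤ P.facets d := by
  have sc := s.searchCondition
  have sorted := s.sorted.2
  have hX0 := s.edge_pos 0 2
  have hY0 := s.edge_pos 1 2
  have hM0 := s.edge_pos 0 1
  have hb := sc.symm.a_pos
  have e := s.eq_b_one h1 h2
  have hbM : d.vert 1 ≤ d.edge 0 1 := by
    have : d.vert 1 ^ 2 * d.edge 0 2 ≤ d.edge 0 1 ^ 2 * d.edge 0 2 := by
      refine h1.trans ?_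
      rw [sq, mul_assoc]
      exact Nat.mul_le_mul_left _ sc.hYMX
    exact (Nat.pow_le_pow_iff_left (by norm_num)).1 (Nat.le_of_mul_le_mul_right this hX0)
  obtain ⟨p, α, hp, hα, hα0⟩ := exists_eq_add_of_pos hM0 hb
  obtain ⟨q, β, hq, hβ, hβ0⟩ := exists_eq_add_of_pos hY0 hb
  have hj : d.edge 2 1 ≤ d.vert 2 * d.vert 1 := by rw [d.edge_comm, mul_comm]; exact sc.hYbn
  have hMb : 1 ≤ d.edge 0 1 / d.vert 1 := Nat.div_pos hbM hb
  have hqY := le_div_of_eq hb hq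
  have hw : (d.known 1 (d.vert 1)).WellDefined d := by
    refine known_wellDefined (r := 1) (p₀ := p) (q₀ := q) hp hα hα0
      (show d.edge 2 1 = _ by rw [d.edge_comm]; exact hq) hβ hβ0 hbM
      (show _ ≤ d.edge 2 1 by rw [d.edge_comm]; exact hbM.trans sc.hMY) le_rfl sc.hMab hj
      ((Nat.mul_le_mul (le_div_of_eq hb hp) hqY).trans sc.testB.le) (fun h0 => ?_)
      (fun h0 => ?_)
    · exact hqY.trans ((Nat.le_mul_of_pos_left _ hMb).trans sc.testB.le)
    · change p + 1 ≤ d.edge 0 2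
      have : p ≤ p * d.vert 1 := Nat.le_mul_of_pos_right _ hb
      have := sc.hMX
      omega
  have hf := balancedValue_le_facets_known hw sc.hMab hj
  rw [d.edge_comm (other₂ 1)] at hf
  refine exists_of_mem_firstCandidates ?_ hw (hT.trans hf)
  simp [firstCandidates, ← e]

/-- The procedure finds a complex with at least as many facets as any given one. -/
theorem IsSearchCase.exists_of_isCovered {d : EdgeData} (s : d.IsSearchCase) {T : ℕ}
    (h : IsCovered (d.edge 0 1) (d.vert 0) (d.vert 1) (d.vert 2) (d.edge 0 2) (d.edge 1 2) T) :
    ∃ P ∈ d.evaluated, T ≤ P.facets d := by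
  rcases h with ⟨c, t, g, hc, hT⟩ | ⟨c, t, g, hc, hT⟩ | ⟨h1, h2, hT⟩ | ⟨h1, h2, hT⟩ | ⟨h1, h2, hT⟩
  · obtain rfl := s.eq_b_zero g.sq_le g.lt_sq
    exact s.exists_of_isCandidate ⟨g, hc⟩ hT
  · exact s.exists_of_isGoodSize g hc hT
  · exact s.exists_of_flat h1 h2 hT
  · exact s.exists_of_vert_zero h1 h2 hT
  · exact s.exists_of_vert_one h1 h2 hT

theorem IsSearchCase.exists_of_realizes {d : EdgeData} (s : d.IsSearchCase) {T : ℕ}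
    (h : d.Realizes T) : ∃ P ∈ d.evaluated, T ≤ P.facets d := by
  obtain ⟨⟨A, B, f, hT⟩, -⟩ := h.exists_feasible (i := 0) (j := 1) (k := 2) (by decide) (by decide)
    (by decide)
  obtain ⟨P, hP, hP'⟩ := s.exists_of_isCovered (s.searchCondition.isCovered f)
  exact ⟨P, hP, hT.trans hP'⟩

end EdgeData

/-! ### How far the search goes -/

namespace EdgeData

variable {d : EdgeData}

theorem best_le_best_append {L L' : List Params} (hL : L ≠ []) : d.best L ≤ d.best (L ++ L') := by
  obtain ⟨P, hP, e⟩ := d.exists_mem_best hL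
  rw [← e]
  exact d.le_best (List.mem_append_left _ hP)

/-- The last of several complexes evaluated by the descending search has been evaluated because `v`
exceeded the number of facets of the first one. -/
theorem length_descend {lo t F : ℕ} {L : List Params} (hF : F ≤ d.best (L ++ [d.known 1 t])) :
    ∃ n, (d.descend lo t L).length = L.length + n ∧
      (n = 0 ∨ (lo ≤ t + 1 - n ∧ n ≤ t ∧ (n = 1 ∨ (F : ℚ) < d.v (t + 1 - n)))) := by
  induction t generalizing L with
  | zero => exact ⟨0, rfl, Or.inl rfl⟩
  | succ t ih =>
    rw [descend_succ]
    split_ifs with h1 h2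
    · exact ⟨1, by simp, Or.inr ⟨by omega, by omega, Or.inl rfl⟩⟩
    · obtain ⟨n, h3, h4⟩ := ih (L := L ++ [d.known 1 (t + 1)])
        (hF.trans (best_le_best_append (by simp)))
      refine ⟨n + 1, by rw [h3]; simp; omega, Or.inr ?_⟩
      rcases h4 with rfl | ⟨h4, h5, h6⟩
      · exact ⟨by omega, by omega, Or.inl rfl⟩
      · have e : t + 1 + 1 - (n + 1) = t + 1 - n := by omega
        rw [e]
        refine ⟨h4, by omega, Or.inr ?_⟩
        rcases h6 with rfl | h6
        · rw [Nat.add_sub_cancel]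
          exact lt_of_le_of_lt (by exact_mod_cast hF) (not_le.1 h2)
        · exact h6
    · exact ⟨0, rfl, Or.inl rfl⟩

/-- The last of several complexes evaluated by the ascending search has been evaluated because `v`
exceeded the number of facets of the first one. -/
theorem length_ascend {m t F : ℕ} {L : List Params} (hF : F ≤ d.best (L ++ [d.known 1 t])) :
    ∃ n, (d.ascend m t L).length = L.length + n ∧
      (n = 0 ∨ (n ≤ m ∧ (n = 1 ∨ (F : ℚ) < d.v (t + (n - 1))))) := by
  induction m generalizing L t with
  | zero => exact ⟨0, rfl, Or.inl rfl⟩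
  | succ m ih =>
    rw [ascend_succ]
    split_ifs with h1 h2
    · exact ⟨1, by simp, Or.inr ⟨by omega, Or.inl rfl⟩⟩
    · obtain ⟨n, h3, h4⟩ := ih (L := L ++ [d.known 1 t]) (t := t + 1)
        (hF.trans (best_le_best_append (by simp)))
      refine ⟨n + 1, by rw [h3]; simp; omega, Or.inr ?_⟩
      rcases h4 with rfl | ⟨h5, h6⟩
      · exact ⟨by omega, Or.inl rfl⟩
      · rcases Nat.eq_zero_or_pos n with rfl | hn
        · exact ⟨by omega, Or.inl rfl⟩
        refine ⟨by omega, Or.inr ?_⟩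
        rcases h6 with rfl | h6
        · exact lt_of_le_of_lt (by exact_mod_cast hF) (not_le.1 h2)
        · have e : t + (n + 1 - 1) = t + 1 + (n - 1) := by omega
          rw [e]; exact h6
    · exact ⟨0, rfl, Or.inl rfl⟩

/-- The balanced slots reach the bound `v` up to the number of edges of the first two colors: a slot
falls short by at most the number of its vertices of the first color. -/
theorem v_le_balancedValue_add {t : ℕ} (g : IsGoodSize (d.edge 0 1) (d.vert 0) (d.vert 1) (d.vert 2)
    (d.edge 0 2) (d.edge 1 2) (d.b 0) t) :
    d.v t ≤ balancedValue (d.edge 0 2) (d.edge 0 1) (d.edge 1 2) t + d.edge 0 1 := by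
  have ht := g.ht
  obtain ⟨e, he⟩ := Nat.exists_eq_add_of_le g.hcM
  have het : e ≤ t := by have := g.hMc; linarith
  obtain ⟨k₁, lo1, lo2⟩ := g.lower
  obtain ⟨k₂, up1, up2⟩ := g.upper
  obtain ⟨h, y, hY, hy⟩ : ∃ h y, d.edge 1 2 = h * t + y ∧ y < t :=
    ⟨_ / t, _ % t, (Nat.div_add_mod' _ t).symm, Nat.mod_lt _ ht⟩
  have hk2 : k₂ ≤ h := by
    by_contra! hc
    have : (h + 1) * t ≤ k₂ * t := Nat.mul_le_mul_right _ hc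
    have : (h + 1) * t = h * t + t := by ring
    omega
  set X := d.edge 0 2
  set c := d.b 0
  have hX1 : X ≤ (c + 1) * h + (c + 1) := by
    have : (c + 1) * (k₂ + 1) ≤ (c + 1) * (h + 1) := Nat.mul_le_mul_left _ (by omega)
    linarith
  have hX2 : 0 < y → c * h ≤ X := by
    intro h0
    have : h ≤ k₁ := by
      by_contra! hc
      have : (k₁ + 1) * t ≤ h * t := Nat.mul_le_mul_right _ hc
      omega
    exact (Nat.mul_le_mul_left _ this).trans lo2
  have hX3 : c * h ≤ X + c := by
    rcases Nat.eq_zero_or_pos y with h0 | h0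
    · have : h ≤ k₁ + 1 := by
        by_contra! hc
        have : (k₁ + 1 + 1) * t ≤ h * t := Nat.mul_le_mul_right _ hc
        have : (k₁ + 1 + 1) * t = (k₁ + 1) * t + t := by ring
        omega
      have := Nat.mul_le_mul_left c this
      linarith
    · have := hX2 h0; omega
  obtain ⟨w, hw⟩ := Nat.exists_eq_add_of_le het
  -- the value of the slots with `c + 1` and with `c` vertices of the first color
  set s : ℕ → ℕ := fun k => min X (balanced (d.edge 0 1) t k * balanced (d.edge 1 2) t k)
  have hV : balancedValue X (d.edge 0 1) (d.edge 1 2) t =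
      ∑ k ∈ range e, s k + ∑ k ∈ range w, s (e + k) := by
    rw [← Finset.sum_range_add, ← hw]
    rfl
  have slot₁ : ∀ k ∈ range e, X + (c + 1) * (if k < y then 1 else 0) ≤ s k + (c + 1) := by
    intro k hk
    have hk := mem_range.1 hk
    have e2 : (c + 1) * (h + 1) = (c + 1) * h + (c + 1) := by ring
    simp only [s, balanced_eq he het (hk.trans_le het), balanced_eq hY hy.le (hk.trans_le het),
      if_pos hk]
    split_ifs
    · rw [e2]; omega
    · simp only [add_zero, mul_zero]; omega
  have slot₂ : ∀ k ∈ range w, c * h ≤ s (e + k) + if y = 0 then c else 0 := by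
    intro k hk
    have hk : e + k < t := by have := mem_range.1 hk; omega
    have e1 : c * (h + 1) = c * h + c := by ring
    simp only [s, balanced_eq he het hk, balanced_eq hY hy.le hk,
      if_neg (show ¬ e + k < e by omega), add_zero]
    split_ifs with h1 h2 h2
    · omega
    · rw [e1]; have := hX2 (by omega); omega
    · simp only [add_zero]; omega
    · simp only [add_zero]; have := hX2 (by omega); omega
  have sum₁ := Finset.sum_le_sum slot₁
  have sum₂ := Finset.sum_le_sum slot₂
  simp only [Finset.sum_add_distrib, ← Finset.mul_sum, sum_ite_lt, Finset.sum_const, card_range,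
    smul_eq_mul] at sum₁ sum₂
  have key : c * d.edge 1 2 + e * X ≤ balancedValue X (d.edge 0 1) (d.edge 1 2) t + c * e * h +
      d.edge 0 1 := by
    rw [hV, he, hY, hw]
    rcases Nat.eq_zero_or_pos y with h0 | h0
    · subst h0
      simp only [if_true] at sum₂
      have : (c + 1) * min 0 e = 0 := by simp
      linarith
    · rw [if_neg h0.ne'] at sum₂
      rcases le_total y e with hc | hc
      · rw [min_eq_left hc] at sum₁
        have := Nat.zero_le (c * w)
        linarith
      · rw [min_eq_right hc] at sum₁
        have := Nat.mul_le_mul_left c hy.le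
        rw [hw] at this
        linarith
  have key' : (c * d.edge 1 2 + e * X : ℚ) ≤ balancedValue X (d.edge 0 1) (d.edge 1 2) t +
      c * e * h + d.edge 0 1 := by exact_mod_cast key
  have ht' : (0 : ℚ) < t := by exact_mod_cast ht
  have h1 : (h : ℚ) ≤ d.edge 1 2 / t := by
    rw [le_div_iff₀ ht']
    exact_mod_cast (by omega : h * t ≤ d.edge 1 2)
  have h2 := mul_le_mul_of_nonneg_left h1 (by positivity : (0 : ℚ) ≤ c * e)
  have he' : (d.edge 0 1 : ℚ) = c * t + e := by exact_mod_cast he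
  have h3 : d.v t = c * d.edge 1 2 + e * X - c * e * (d.edge 1 2 / t) := by
    unfold v
    rw [he']
    change (c * d.edge 1 2 + (c * t + e - c * t) * (X - c * d.edge 1 2 / t) : ℚ) = _
    ring
  linarith

end EdgeData

/-! ### The number of evaluated complexes -/

/-- If `v` has decreased by less than `M` after `w` steps to `x`, then `w` is bounded in terms
of `x` and `R = √(M Y) / X`. -/
theorem pow_four_mul_lt {c M X Y w x R : ℝ} (hc : 0 < c) (hM : 0 < M) (hX : 0 < X) (hx : 0 < x)
    (h1 : M * X < 4 * c ^ 2 * Y) (hR : R ^ 2 * X ^ 2 = M * Y) (h : c * w ^ 2 * X < M * x) :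
    w ^ 4 * X < 4 * R ^ 2 * x ^ 2 := by
  have h2 : (c * w ^ 2 * X) ^ 2 < (M * x) ^ 2 := pow_lt_pow_left₀ h (by positivity) (by norm_num)
  have h3 := mul_lt_mul_of_pos_right h2 hX
  have h4 := mul_lt_mul_of_pos_left h1 (show 0 < M * x ^ 2 by positivity)
  have h5 : c ^ 2 * X ^ 2 * (w ^ 4 * X) < c ^ 2 * X ^ 2 * (4 * R ^ 2 * x ^ 2) := by
    have : M * x ^ 2 * (4 * c ^ 2 * Y) = 4 * c ^ 2 * x ^ 2 * (R ^ 2 * X ^ 2) := by rw [hR]; ring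
    linarith
  exact lt_of_mul_lt_mul_left h5 (by positivity)

/-- The number of steps of the descending search. -/
theorem steps_lt_of_sq_le {w x R X : ℝ} (hR : 0 < R) (hX : 0 < X)
    (h : w ^ 4 * X < 4 * R ^ 2 * x ^ 2) (hx : x ^ 2 ≤ R ^ 2 * X) : w < √2 * R := by
  have h1 := mul_le_mul_of_nonneg_left hx (show 0 ≤ 4 * R ^ 2 by positivity)
  have h2 : w ^ 4 < 4 * R ^ 4 := by
    refine lt_of_mul_lt_mul_right (a := X) ?_ hX.le
    linarith
  have h3 : w ^ 2 < 2 * R ^ 2 := by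
    refine lt_of_pow_lt_pow_left₀ 2 (by positivity) ?_
    linarith
  refine lt_of_pow_lt_pow_left₀ 2 (by positivity) ?_
  rwa [mul_pow, Real.sq_sqrt (by norm_num)]

/-- The number of steps of the ascending search from `s + 1`, where `s ≤ √(M Y / X)`. -/
theorem steps_lt_of_le_add {w s x R X : ℝ} (hR : 0 < R) (hX : 0 < X) (hw : 0 ≤ w) (hx0 : 0 ≤ x)
    (h : w ^ 4 * X < 4 * R ^ 2 * x ^ 2) (hs : s ^ 2 ≤ R ^ 2 * X) (hx : x ≤ s + 1 + w)
    (hRX : R ^ 2 ≤ X) : w < 3 + √2 * R := by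
  obtain ⟨r, hr, rfl⟩ : ∃ r, 0 < r ∧ X = r ^ 2 :=
    ⟨√X, Real.sqrt_pos.2 hX, (Real.sq_sqrt hX.le).symm⟩
  have h1 : w ^ 2 * r < 2 * R * x := by
    refine lt_of_pow_lt_pow_left₀ 2 (by positivity) ?_
    linarith
  have h2 : s ≤ R * r := by
    refine le_of_sq_le_sq ?_ (by positivity)
    linarith
  have h3 : R ≤ r := le_of_sq_le_sq hRX hr.le
  have h4 : w ^ 2 * r < (2 * R ^ 2 + 2 * (1 + w)) * r := by
    have a1 : 2 * R * x ≤ 2 * R * (R * r + (1 + w)) :=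
      mul_le_mul_of_nonneg_left (by linarith) (by positivity)
    have a2 : R * (1 + w) ≤ r * (1 + w) := mul_le_mul_of_nonneg_right h3 (by linarith)
    linarith
  have h5 : w ^ 2 < 2 * R ^ 2 + 2 * (1 + w) := lt_of_mul_lt_mul_right h4 hr.le
  have h6 : w - 1 < 2 + √2 * R := by
    refine lt_of_pow_lt_pow_left₀ 2 (by positivity) ?_
    have : (√2 * R) ^ 2 = 2 * R ^ 2 := by rw [mul_pow, Real.sq_sqrt (by norm_num)]
    have : 0 < √2 * R := by positivity
    linarith
  linarith

namespace EdgeData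

variable {d : EdgeData}

/-- The quantity `√(f₁₂ f₂₃) / f₁₃`, which governs the number of evaluated complexes. -/
noncomputable def ratio (d : EdgeData) : ℝ := √((d.edge 0 1 : ℝ) * d.edge 1 2) / d.edge 0 2

/-- As long as `v` exceeds the number of facets for the candidate `t`, it has decreased by less
than `M`, which bounds the distance `w` from `t`. -/
theorem IsSearchCase.mul_sq_lt (s : d.IsSearchCase) {t x w : ℕ} (h : d.IsCandidate t) (hx : 0 < x)
    (hv : ((d.known 1 t).facets d : ℚ) < d.v x)
    (hw : (t = x + w ∧ t ^ 2 * d.edge 0 2 ≤ d.edge 0 1 * d.edge 1 2) ∨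
      (x = t + w ∧ d.edge 0 1 * d.edge 1 2 ≤ t ^ 2 * d.edge 0 2)) :
    (d.b 0 * w ^ 2 * d.edge 0 2 : ℝ) < d.edge 0 1 * x := by
  have h1 := v_le_balancedValue_add h.1
  have h2 : (balancedValue (d.edge 0 2) (d.edge 0 1) (d.edge 1 2) t : ℚ) ≤
    (d.known 1 t).facets d := by exact_mod_cast (s.known_one h).2
  have ht := h.1.ht
  rw [d.v_eq hx] at hv
  rw [d.v_eq ht] at h1
  have hx' : (0 : ℚ) < x := by exact_mod_cast hx
  have ht' : (0 : ℚ) < t := by exact_mod_cast ht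
  have e : (x * d.edge 0 2 + d.edge 0 1 * d.edge 1 2 / x : ℚ) -
      (t * d.edge 0 2 + d.edge 0 1 * d.edge 1 2 / t) =
      (t - x) * (d.edge 0 1 * d.edge 1 2 - x * t * d.edge 0 2) / (x * t) := by
    field_simp
    ring
  have key : (w ^ 2 * t * d.edge 0 2 : ℚ) ≤
      (t - x) * (d.edge 0 1 * d.edge 1 2 - x * t * d.edge 0 2) := by
    have hw0 : (0 : ℚ) ≤ w := by positivity
    rcases hw with ⟨h3, h4⟩ | ⟨h3, h4⟩
    · have h4' : (t ^ 2 * d.edge 0 2 : ℚ) ≤ d.edge 0 1 * d.edge 1 2 := by exact_mod_cast h4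
      have h3' : (t : ℚ) = x + w := by exact_mod_cast h3
      have := mul_le_mul_of_nonneg_left h4' hw0
      have e : (t : ℚ) - x = w := by linarith
      have e' : (x : ℚ) = t - w := by linarith
      rw [e, e']
      linarith
    · have h4' : (d.edge 0 1 * d.edge 1 2 : ℚ) ≤ t ^ 2 * d.edge 0 2 := by exact_mod_cast h4
      have h3' : (x : ℚ) = t + w := by exact_mod_cast h3
      have := mul_le_mul_of_nonneg_left h4' hw0
      rw [h3']
      linarith
  have key' : (w ^ 2 * d.edge 0 2 / x : ℚ) ≤
      (t - x) * (d.edge 0 1 * d.edge 1 2 - x * t * d.edge 0 2) / (x * t) := by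
    rw [div_le_div_iff₀ hx' (by positivity)]
    have := mul_le_mul_of_nonneg_right key hx'.le
    linarith
  rw [← e] at key'
  have h3 := mul_le_mul_of_nonneg_left key' (Nat.cast_nonneg (α := ℚ) (d.b 0))
  have h4 : (d.b 0 * (w ^ 2 * d.edge 0 2 / x) : ℚ) < d.edge 0 1 := by linarith
  have h5 : (d.b 0 * w ^ 2 * d.edge 0 2 : ℚ) < d.edge 0 1 * x := by
    rw [← div_lt_iff₀ hx']
    refine lt_of_eq_of_lt ?_ h4
    ring
  exact_mod_cast h5

theorem IsSearchCase.ratio_pos (s : d.IsSearchCase) : 0 < d.ratio := by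
  have h1 : (0 : ℝ) < d.edge 0 1 := by exact_mod_cast s.edge_pos 0 1
  have h2 : (0 : ℝ) < d.edge 0 2 := by exact_mod_cast s.edge_pos 0 2
  have h3 : (0 : ℝ) < d.edge 1 2 := by exact_mod_cast s.edge_pos 1 2
  unfold ratio; positivity

theorem IsSearchCase.ratio_sq (s : d.IsSearchCase) :
    d.ratio ^ 2 * d.edge 0 2 ^ 2 = d.edge 0 1 * d.edge 1 2 := by
  have h2 : (0 : ℝ) < d.edge 0 2 := by exact_mod_cast s.edge_pos 0 2
  rw [ratio, div_pow, Real.sq_sqrt (by positivity)]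
  field_simp

theorem IsSearchCase.sq_le (s : d.IsSearchCase) {x : ℕ}
    (hx : x ^ 2 * d.edge 0 2 ≤ d.edge 0 1 * d.edge 1 2) :
    (x : ℝ) ^ 2 ≤ d.ratio ^ 2 * d.edge 0 2 := by
  have h2 : (0 : ℝ) < d.edge 0 2 := by exact_mod_cast s.edge_pos 0 2
  have h3 : (x ^ 2 * d.edge 0 2 : ℝ) ≤ d.edge 0 1 * d.edge 1 2 := by exact_mod_cast hx
  rw [← s.ratio_sq] at h3
  refine le_of_mul_le_mul_right (a := (d.edge 0 2 : ℝ)) ?_ h2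
  linarith

theorem IsSearchCase.lt_four_mul (s : d.IsSearchCase) :
    (d.edge 0 1 * d.edge 0 2 : ℝ) < 4 * d.b 0 ^ 2 * d.edge 1 2 := by
  have h1 := s.b_zero_spec.2
  have h2 : (d.b 0 + 1) ^ 2 ≤ 4 * d.b 0 ^ 2 := by
    have := Nat.pow_le_pow_left (show d.b 0 + 1 ≤ 2 * d.b 0 by have := s.b_zero; omega) 2
    linarith
  exact_mod_cast h1.trans_le (Nat.mul_le_mul_right _ h2)

theorem IsSearchCase.pow_four_lt (s : d.IsSearchCase) {t x w : ℕ} (h : d.IsCandidate t) (hx : 0 < x)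
    (hv : ((d.known 1 t).facets d : ℚ) < d.v x)
    (hw : (t = x + w ∧ t ^ 2 * d.edge 0 2 ≤ d.edge 0 1 * d.edge 1 2) ∨
      (x = t + w ∧ d.edge 0 1 * d.edge 1 2 ≤ t ^ 2 * d.edge 0 2)) :
    (w : ℝ) ^ 4 * d.edge 0 2 < 4 * d.ratio ^ 2 * x ^ 2 :=
  pow_four_mul_lt (by exact_mod_cast h.1.hc) (by exact_mod_cast s.edge_pos 0 1)
    (by exact_mod_cast s.edge_pos 0 2) (by exact_mod_cast hx) s.lt_four_mul s.ratio_sq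
    (s.mul_sq_lt h hx hv hw)

theorem IsSearchCase.length_descend_lt (s : d.IsSearchCase) {lo t : ℕ} {L : List Params}
    (h : d.IsCandidate t) (hb : t ≤ d.b 1) :
    ((d.descend lo t L).length : ℝ) < L.length + (1 + √2 * d.ratio) := by
  have hR := s.ratio_pos
  have hR2 : 0 < √2 * d.ratio := by positivity
  obtain ⟨n, h1, h2⟩ := length_descend (lo := lo) (t := t) (L := L)
    (F := (d.known 1 t).facets d) (d.le_best (by simp))
  rw [h1, Nat.cast_add, add_lt_add_iff_left]
  rcases h2 with rfl | ⟨-, h3, rfl | h4⟩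
  · rw [Nat.cast_zero]; linarith
  · rw [Nat.cast_one]; linarith
  · rcases Nat.eq_zero_or_pos n with rfl | hn
    · rw [Nat.cast_zero]; linarith
    obtain ⟨w, rfl⟩ := Nat.exists_eq_add_of_le' hn
    have e : t + 1 - (w + 1) = t - w := by omega
    rw [e] at h4
    have hsq : ∀ {x}, x ≤ t → x ^ 2 * d.edge 0 2 ≤ d.edge 0 1 * d.edge 1 2 := fun hx =>
      (Nat.mul_le_mul_right _ (Nat.pow_le_pow_left (hx.trans hb) 2)).trans s.b_one_spec.1
    have h5 := s.pow_four_lt (w := w) h (by omega) h4 (Or.inl ⟨by omega, hsq le_rfl⟩)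
    have h6 := steps_lt_of_sq_le hR (by exact_mod_cast s.edge_pos 0 2) h5
      (s.sq_le (hsq (by omega)))
    push_cast
    linarith

theorem IsSearchCase.sq_ge (s : d.IsSearchCase) {t : ℕ} (hb : d.b 1 < t) :
    d.edge 0 1 * d.edge 1 2 ≤ t ^ 2 * d.edge 0 2 :=
  s.b_one_spec.2.le.trans (Nat.mul_le_mul_right _ (Nat.pow_le_pow_left hb 2))

theorem IsSearchCase.length_ascend_lt (s : d.IsSearchCase) {m : ℕ} {L : List Params}
    (h : m ≠ 0 → d.IsCandidate (d.b 1 + 1)) :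
    ((d.ascend m (d.b 1 + 1) L).length : ℝ) < L.length + (4 + √2 * d.ratio) := by
  have hR := s.ratio_pos
  have hR2 : 0 < √2 * d.ratio := by positivity
  obtain ⟨n, h1, h2⟩ := length_ascend (m := m) (t := d.b 1 + 1) (L := L)
    (F := (d.known 1 (d.b 1 + 1)).facets d) (d.le_best (by simp))
  rw [h1, Nat.cast_add, add_lt_add_iff_left]
  rcases h2 with rfl | ⟨h3, rfl | h4⟩
  · rw [Nat.cast_zero]; linarith
  · rw [Nat.cast_one]; linarith
  · rcases Nat.eq_zero_or_pos n with rfl | hn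
    · rw [Nat.cast_zero]; linarith
    obtain ⟨w, rfl⟩ := Nat.exists_eq_add_of_le' hn
    rw [Nat.add_sub_cancel] at h4
    have h5 := s.pow_four_lt (w := w) (h (by omega)) (by omega) h4
      (Or.inr ⟨rfl, s.sq_ge (by omega)⟩)
    have hX : (0 : ℝ) < d.edge 0 2 := by exact_mod_cast s.edge_pos 0 2
    have hRX : d.ratio ^ 2 ≤ d.edge 0 2 := by
      have sc := s.searchCondition
      have h6 : d.edge 0 1 * d.edge 1 2 ≤ d.edge 0 2 * d.edge 0 2 ^ 2 := by
        calc d.edge 0 1 * d.edge 1 2 ≤ d.edge 0 1 * (d.edge 0 1 * d.edge 0 2) :=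
              Nat.mul_le_mul_left _ sc.hYMX
          _ ≤ d.edge 0 2 * (d.edge 0 2 * d.edge 0 2) :=
              Nat.mul_le_mul sc.hMX (Nat.mul_le_mul_right _ sc.hMX)
          _ = _ := by ring
      have h7 : (d.edge 0 1 * d.edge 1 2 : ℝ) ≤ d.edge 0 2 * d.edge 0 2 ^ 2 := by exact_mod_cast h6
      rw [← s.ratio_sq] at h7
      exact le_of_mul_le_mul_right h7 (by positivity)
    have h6 := steps_lt_of_le_add hR hX (Nat.cast_nonneg w) (Nat.cast_nonneg _) h5
      (s.sq_le s.b_one_spec.1) (by push_cast; rfl) hRX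
    push_cast
    linarith

theorem IsSearchCase.length_ascend_lt_of_lt (s : d.IsSearchCase) {lo m : ℕ} {L : List Params}
    (h : d.IsCandidate lo) (hb : d.b 1 < lo)
    (hm : ∀ t, lo ≤ t → t < lo + m → d.b 0 * t ≤ d.edge 0 1) :
    ((d.ascend m lo L).length : ℝ) < L.length + (1 + 2 * d.ratio) := by
  have hR := s.ratio_pos
  obtain ⟨n, h1, h2⟩ := length_ascend (m := m) (t := lo) (L := L)
    (F := (d.known 1 lo).facets d) (d.le_best (by simp))
  rw [h1, Nat.cast_add, add_lt_add_iff_left]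
  rcases h2 with rfl | ⟨h3, rfl | h4⟩
  · rw [Nat.cast_zero]; linarith
  · rw [Nat.cast_one]; linarith
  · rcases Nat.eq_zero_or_pos n with rfl | hn
    · rw [Nat.cast_zero]; linarith
    obtain ⟨w, rfl⟩ := Nat.exists_eq_add_of_le' hn
    rw [Nat.add_sub_cancel] at h4
    have h5 := s.mul_sq_lt (w := w) h (by omega) h4 (Or.inr ⟨rfl, s.sq_ge hb⟩)
    have h6 : (d.b 0 * (lo + w : ℕ) : ℝ) ≤ d.edge 0 1 := by
      exact_mod_cast hm (lo + w) (by omega) (by omega)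
    have hM : (0 : ℝ) < d.edge 0 1 := by exact_mod_cast s.edge_pos 0 1
    have hX : (0 : ℝ) < d.edge 0 2 := by exact_mod_cast s.edge_pos 0 2
    have hc : (0 : ℝ) < d.b 0 := by exact_mod_cast h.1.hc
    have h7 := mul_lt_mul_of_pos_left h5 (mul_pos hc hX)
    have h8 := mul_le_mul_of_nonneg_left h6 (mul_pos hM hX).le
    have h9 := mul_lt_mul_of_pos_left s.lt_four_mul hM
    have h10 : (w : ℝ) ^ 2 < (2 * d.ratio) ^ 2 := by
      refine lt_of_mul_lt_mul_left (a := (d.b 0 ^ 2 * d.edge 0 2 ^ 2 : ℝ)) ?_ (by positivity)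
      have : (d.b 0 ^ 2 * d.edge 0 2 ^ 2 : ℝ) * (2 * d.ratio) ^ 2 =
          4 * d.b 0 ^ 2 * (d.ratio ^ 2 * d.edge 0 2 ^ 2) := by ring
      rw [this, s.ratio_sq]
      linarith
    have h11 := lt_of_pow_lt_pow_left₀ 2 (by positivity) h10
    push_cast
    linarith

theorem length_twoCandidates_le (d : EdgeData) (i r : Fin 3) :
    (d.twoCandidates i r).length ≤ 2 := by
  unfold twoCandidates
  dsimp only
  split_ifs <;> simp

theorem IsSearchCase.length_evaluated_lt (s : d.IsSearchCase) :
    (d.evaluated.length : ℝ) < 15 + 2 * √2 * d.ratio := by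
  have hR := s.ratio_pos
  have hL : ((d.firstCandidates.filter fun P => P.WellDefined d).length : ℝ) ≤ 9 := by
    have h1 := List.length_filter_le (fun P : Params => decide (P.WellDefined d)) d.firstCandidates
    have h2 : d.firstCandidates.length ≤ 9 := by
      have := d.length_twoCandidates_le 2 1
      have := d.length_twoCandidates_le 2 0
      have := d.length_twoCandidates_le 1 0
      unfold firstCandidates
      simp only [List.length_append, List.length_cons, List.length_nil]
      omega
    exact_mod_cast h1.trans h2
  have hR2 : 0 < √2 * d.ratio := by positivity
  have hR3 : 2 * d.ratio ≤ 2 * (√2 * d.ratio) := by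
    have : (1 : ℝ) ≤ √2 := Real.one_le_sqrt.2 (by norm_num)
    have := mul_le_mul_of_nonneg_right this hR.le
    linarith
  unfold evaluated
  rcases range₂_spec s with ⟨h1, -⟩ | ⟨lo, hi, h1, h2, h3⟩
  · rw [h1]
    dsimp only
    linarith
  · rw [h1]
    dsimp only
    split_ifs with c1 c2
    · have g1 := s.length_descend_lt (lo := lo)
        (L := d.firstCandidates.filter fun P => P.WellDefined d) ((h3 _).2 c1) le_rfl
      have g2 := s.length_ascend_lt (m := hi - d.b 1)
        (L := d.descend lo (d.b 1) (d.firstCandidates.filter fun P => P.WellDefined d))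
        (fun h => (h3 _).2 (by omega))
      linarith
    · have := s.length_ascend_lt_of_lt (m := hi + 1 - lo)
        (L := d.firstCandidates.filter fun P => P.WellDefined d) ((h3 _).2 ⟨le_rfl, h2⟩) c2
        (fun t g1 g2 => ((h3 t).2 (by omega)).1.hcM)
      linarith
    · have := s.length_descend_lt (lo := lo)
        (L := d.firstCandidates.filter fun P => P.WellDefined d) ((h3 hi).2 ⟨h2, le_rfl⟩)
        (by omega)
      linarith

end EdgeData

/-! ### Relabeling, and the cases without search -/

/-- Permuting the colors of a complex permutes its flag numbers. -/
theorem ColoredComplex.exists_relabel {V : Type*} (Δ : ColoredComplex 3 V)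
    (σ : Equiv.Perm (Fin 3)) :
    ∃ Δ' : ColoredComplex 3 V, ∀ S, Δ'.flagNumber S = Δ.flagNumber (S.image σ) := by
  refine ⟨⟨Δ.toAbstractSimplicialComplex, σ.symm ∘ Δ.color, fun s hs u hu v hv h =>
    Δ.injOn_color s hs hu hv (σ.symm.injective h)⟩, fun S => ?_⟩
  unfold flagNumber
  congr 1
  ext s
  refine and_congr_right fun _ => ?_
  change s.image (σ.symm ∘ Δ.color) = S ↔ _
  rw [← Finset.image_image, ← (Finset.image_injective σ.injective).eq_iff, Finset.image_image]
  simp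

namespace EdgeData

variable {d : EdgeData}

theorem Realizes.relabel {T : ℕ} (h : d.Realizes T) (σ : Equiv.Perm (Fin 3)) :
    (d.relabel σ).Realizes T := by
  obtain ⟨V, hV, Δ, h1, h2, h3⟩ := h.exists_complex
  obtain ⟨Δ', h'⟩ := Δ.exists_relabel σ
  refine ⟨V, hV, Δ', ?_, ?_, ?_, ?_, ?_, ?_, ?_⟩ <;>
    simp only [h', image_insert, image_singleton, edge_relabel]
  · exact h1 _
  · exact h1 _
  · exact h1 _
  · exact h2 _ _ (by simp)
  · exact h2 _ _ (by simp)
  · exact h2 _ _ (by simp)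
  · exact h3 _ _ _ (by simp) (by simp) (by simp)

theorem TrivialInequalities.relabel (h : d.TrivialInequalities) (σ : Equiv.Perm (Fin 3)) :
    (d.relabel σ).TrivialInequalities := fun i j hij => by
  rw [edge_relabel]
  exact h _ _ fun e => hij (σ.injective e)

theorem vertexTest_relabel (σ : Equiv.Perm (Fin 3)) (i : Fin 3) :
    (d.relabel σ).VertexTest i ↔ d.VertexTest (σ i) := by
  have h1 : ∀ i : Fin 3, i ≠ i + 1 ∧ i ≠ i + 2 ∧ i + 1 ≠ i + 2 := by decide
  obtain ⟨h1, h2, h3⟩ := h1 i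
  rw [vertexTest_iff h1 h2 h3, vertexTest_iff (σ.injective.ne h1) (σ.injective.ne h2)
    (σ.injective.ne h3), edge_relabel, edge_relabel, edge_relabel]
  rfl

/-- Some structured complex has at least `m` facets, and no complex with the prescribed numbers
has more. Since structured complexes can be completed to ones with the prescribed numbers, `m` is
attained. -/
def IsMaximum (d : EdgeData) (m : ℕ) : Prop :=
  (∃ P : Params, P.WellDefined d ∧ m ≤ P.facets d) ∧ ∀ T, d.Realizes T → T ≤ m

theorem IsMaximum.of_relabel {σ : Equiv.Perm (Fin 3)} {m : ℕ} (h : (d.relabel σ).IsMaximum m) :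
    d.IsMaximum m := by
  obtain ⟨⟨P, h1, h2⟩, h3⟩ := h
  exact ⟨⟨P.map σ, Params.wellDefined_map σ h1, by rwa [Params.facets_map]⟩,
    fun T hT => h3 T (hT.relabel σ)⟩

theorem IsMaximum.isGreatest_structured {m : ℕ} (h : d.IsMaximum m) (ht : d.TrivialInequalities) :
    IsGreatest (structuredFacetNumbers d) m := by
  obtain ⟨⟨P, h1, h2⟩, h3⟩ := h
  refine ⟨⟨P, h1, le_antisymm (h3 _ (h1.realizes ht le_rfl)) h2⟩, ?_⟩
  rintro _ ⟨Q, hQ, rfl⟩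
  exact h3 _ (hQ.realizes ht le_rfl)

theorem IsMaximum.realizes_iff {m k : ℕ} (h : d.IsMaximum m) (ht : d.TrivialInequalities) :
    d.Realizes k ↔ k ≤ m := by
  obtain ⟨⟨P, h1, h2⟩, h3⟩ := h
  exact ⟨h3 k, fun hk => h1.realizes ht (hk.trans h2)⟩

/-- If the vertex test succeeds for the color `i`, all edges between the two other colors can be
joined to all vertices of color `i`. -/
theorem isMaximum_of_vertexTest (ht : d.TrivialInequalities) (hv : ∀ i, 0 < d.vert i)
    (he : ∀ i j, 0 < d.edge i j) {i j k : Fin 3} (hij : i ≠ j) (hik : i ≠ k) (hjk : j ≠ k)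
    (h : d.VertexTest i) : d.IsMaximum (d.vert i * d.edge j k) := by
  rw [vertexTest_iff hij hik hjk] at h
  constructor
  · have ha := hv i
    have hZ := he j k
    have t1 := ht i j hij
    have t2 := ht i k hik
    set a := d.vert i
    set Z := d.edge j k
    obtain ⟨x, hx⟩ : ∃ x, x = d.edge i j / a := ⟨_, rfl⟩
    obtain ⟨y, hy⟩ : ∃ y, y = d.edge i k / a := ⟨_, rfl⟩
    have x1 : a * x ≤ d.edge i j := by rw [hx]; exact Nat.mul_div_le _ _
    have y1 : a * y ≤ d.edge i k := by rw [hy]; exact Nat.mul_div_le _ _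
    have x2 : x ≤ d.vert j := Nat.le_of_mul_le_mul_left (x1.trans t1) ha
    have y2 : y ≤ d.vert k := Nat.le_of_mul_le_mul_left (y1.trans t2) ha
    rw [← hx, ← hy] at h
    have x0 : 0 < x := Nat.pos_of_mul_pos_right (hZ.trans_le h)
    have y0 : 0 < y := Nat.pos_of_mul_pos_left (hZ.trans_le h)
    obtain ⟨J, hJ⟩ : ∃ J, J = min x Z := ⟨_, rfl⟩
    have J0 : 0 < J := by rw [hJ]; exact lt_min x0 hZ
    have J1 : J ≤ x := hJ ▸ min_le_left _ _
    have J2 : J ≤ Z := hJ ▸ min_le_right _ _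
    obtain ⟨K, hK⟩ : ∃ K, K = Z / J := ⟨_, rfl⟩
    obtain ⟨z, hz⟩ : ∃ z, z = Z % J := ⟨_, rfl⟩
    have hZ' : J * K + z = Z := by rw [hK, hz]; exact Nat.div_add_mod Z J
    have hzJ : z < J := hz ▸ Nat.mod_lt _ J0
    have K0 : 0 < K := hK ▸ Nat.div_pos J2 J0
    -- `J` vertices of color `j` are joined to `K` vertices of color `k`, and `z` to a further one
    have hKy : K ≤ y ∧ (0 < z → K < y) := by
      rcases le_total x Z with hc | hc
      · rw [min_eq_left hc] at hJ
        rw [← hJ] at h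
        exact ⟨Nat.le_of_mul_le_mul_left (by omega : J * K ≤ J * y) J0,
          fun h0 => Nat.lt_of_mul_lt_mul_left (by omega : J * K < J * y)⟩
      · rw [min_eq_right hc] at hJ
        have : z = 0 := by rw [hz, hJ, Nat.mod_self]
        have : K = 1 := by rw [hK, hJ, Nat.div_self hZ]
        omega
    obtain ⟨K1, K2⟩ := hKy
    let P : Params := ⟨fun l => if l = i then a else if l = j then J else K, k, i⟩
    have gi : P.g i = a := if_pos rfl
    have gj : P.g j = J := by simp [P, hij.symm]
    have gk : P.g k = K := by simp [P, hik.symm, hjk.symm]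
    have hr : P.r = j := by
      change third k i = j
      clear * - hij hik hjk
      revert i j k; decide
    have all : ∀ l, l = i ∨ l = j ∨ l = k := by clear * - hij hik hjk; revert i j k; decide
    have w : P.WellDefined d := by
      have e1 : a * J ≤ d.edge i j := (Nat.mul_le_mul_left _ J1).trans x1
      have e2 : a * K ≤ d.edge i k := (Nat.mul_le_mul_left _ K1).trans y1
      have e3 : J * K ≤ d.edge j k := by change _ ≤ Z; omega
      refine ⟨hik.symm, fun l => ?_, fun l l' hl => ?_⟩
      · rcases all l with rfl | rfl | rfl
        · rw [gi]; exact ⟨ha, le_rfl⟩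
        · rw [gj]; exact ⟨J0, J1.trans x2⟩
        · rw [gk]; exact ⟨K0, K1.trans y2⟩
      · rcases all l with rfl | rfl | rfl <;> rcases all l' with rfl | rfl | rfl <;>
          first
          | exact absurd rfl hl
          | (simp only [gi, gj, gk]; assumption)
          | (rw [d.edge_comm, mul_comm]; simp only [gi, gj, gk]; assumption)
    refine ⟨P, w, ?_⟩
    rw [Params.facets_eq w.1, hr]
    change _ ≤ P.g k * P.g i * P.g j + P.firstDeg d i * P.firstDeg d j + _
    rw [gi, gj, gk]
    have key : a * z ≤ P.firstDeg d i * P.firstDeg d j := by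
      rcases Nat.eq_zero_or_pos z with h0 | h0
      · rw [h0]; exact Nat.zero_le _
      · have hK3 : P.g P.p < d.vert P.p := by
          change P.g k < d.vert k
          rw [gk]; exact (K2 h0).trans_le y2
        unfold Params.firstDeg
        rw [if_pos hK3, if_pos hK3]
        change _ ≤ min (P.g i) (d.edge k i - P.g k * P.g i) *
          min (P.g j) (d.edge k j - P.g k * P.g j)
        rw [gi, gj, gk, d.edge_comm k i, d.edge_comm k j]
        refine Nat.mul_le_mul (le_min le_rfl ?_) (le_min hzJ.le ?_)
        · have e1 : a * (K + 1) ≤ a * y := Nat.mul_le_mul_left _ (K2 h0)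
          have e2 : a * (K + 1) = K * a + a := by ring
          omega
        · change z ≤ Z - K * J
          rw [mul_comm K]; omega
    have e : a * Z = K * a * J + a * z := by rw [← hZ']; ring
    omega
  · intro T hT
    obtain ⟨⟨A, B, f, hT'⟩, -⟩ := hT.exists_feasible hjk hij.symm hik.symm
    refine hT'.trans ?_
    calc seqValue (d.edge j k) (d.vert i) A B ≤ ∑ _l ∈ range (d.vert i), d.edge j k :=
          Finset.sum_le_sum fun l _ => min_le_left _ _
      _ = _ := by simp

/-- If there are so many edges between the colors 2 and 3 that they impose no restriction, it is
best to use a single vertex of color 1 for all edges that contain this color. -/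
theorem isMaximum_of_b_eq_zero (hv : ∀ i, 0 < d.vert i) (he : ∀ i j, 0 < d.edge i j)
    (h : ∀ i, ¬ d.VertexTest i) (hb : d.b 0 = 0) : d.IsMaximum (d.edge 0 1 * d.edge 0 2) := by
  have hlt : d.edge 0 1 * d.edge 0 2 < d.edge 1 2 := by
    have := (le_b_iff (c := 1) he 0).not.1 (by omega)
    rw [one_pow, one_mul, not_le] at this
    exact this
  constructor
  · have h1 : d.edge 0 1 ≤ d.vert 1 := by
      by_contra! hc
      refine h 1 ((vertexTest_iff (j := 0) (k := 2) (by decide) (by decide) (by decide)).2 ?_)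
      rw [d.edge_comm 1 0]
      have e1 : 1 ≤ d.edge 0 1 / d.vert 1 := Nat.div_pos hc.le (hv 1)
      have e2 : d.edge 0 2 ≤ d.edge 1 2 / d.vert 1 := by
        rw [Nat.le_div_iff_mul_le (hv 1), mul_comm]
        exact (Nat.mul_le_mul_right _ hc.le).trans hlt.le
      exact e2.trans (Nat.le_mul_of_pos_left _ e1)
    have h2 : d.edge 0 2 ≤ d.vert 2 := by
      by_contra! hc
      refine h 2 ((vertexTest_iff (j := 0) (k := 1) (by decide) (by decide) (by decide)).2 ?_)
      rw [d.edge_comm 2 0, d.edge_comm 2 1]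
      have e1 : 1 ≤ d.edge 0 2 / d.vert 2 := Nat.div_pos hc.le (hv 2)
      have e2 : d.edge 0 1 ≤ d.edge 1 2 / d.vert 2 := by
        rw [Nat.le_div_iff_mul_le (hv 2)]
        exact (Nat.mul_le_mul_left _ hc.le).trans hlt.le
      exact e2.trans (Nat.le_mul_of_pos_left _ e1)
    let P : Params := ⟨![1, d.edge 0 1, d.edge 0 2], 0, 1⟩
    have w : P.WellDefined d := by
      refine ⟨(by decide : (0 : Fin 3) ≠ 1), fun i => ?_, fun i j hij => ?_⟩
      · fin_cases i
        · exact ⟨le_rfl, hv 0⟩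
        · exact ⟨he 0 1, h1⟩
        · exact ⟨he 0 2, h2⟩
      · fin_cases i <;> fin_cases j <;> first
          | exact absurd rfl hij
          | exact (one_mul _).le
          | exact (mul_one _).le
          | exact hlt.le
          | exact (mul_comm _ _).trans_le hlt.le
    refine ⟨P, w, ?_⟩
    rw [Params.facets_eq w.1, show P.r = 2 from (by decide : third 0 1 = 2)]
    change _ ≤ 1 * d.edge 0 1 * d.edge 0 2 + _ + _
    rw [one_mul]
    omega
  · intro T hT
    obtain ⟨⟨A, B, f, hT'⟩, -⟩ := hT.exists_feasible (i := 1) (j := 2) (k := 0) (by decide)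
      (by decide) (by decide)
    refine hT'.trans ?_
    rw [d.edge_comm 0 1, d.edge_comm 0 2]
    calc seqValue (d.edge 1 2) (d.vert 0) A B ≤
          ∑ l ∈ range (d.vert 0), A l * ∑ l ∈ range (d.vert 0), B l :=
          Finset.sum_le_sum fun l hl => (min_le_right _ _).trans
            (Nat.mul_le_mul_left _ (Finset.single_le_sum (fun _ _ => Nat.zero_le _) hl))
      _ = (∑ l ∈ range (d.vert 0), A l) * ∑ l ∈ range (d.vert 0), B l := by rw [Finset.sum_mul]
      _ ≤ _ := Nat.mul_le_mul f.sumA f.sumB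

theorem IsSearchCase.isMaximum (s : d.IsSearchCase) : d.IsMaximum (d.best d.evaluated) := by
  refine ⟨?_, fun T hT => ?_⟩
  · -- for any pair of sequences there is an evaluated complex that is at least as good
    have f : Feasible (d.vert 0) (d.vert 1) (d.vert 2) (d.edge 0 2) (d.edge 1 2) 0 0 :=
      ⟨antitone_const, antitone_const, fun _ => Nat.zero_le _, fun _ => Nat.zero_le _,
        fun _ _ => rfl, fun _ _ => rfl, by simp, by simp⟩
    obtain ⟨P, hP, -⟩ := s.exists_of_isCovered (s.searchCondition.isCovered f)
    obtain ⟨Q, hQ, e⟩ := d.exists_mem_best (List.ne_nil_of_mem hP)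
    exact ⟨Q, wellDefined_of_mem_evaluated Q hQ, e.ge⟩
  · obtain ⟨P, hP, h⟩ := s.exists_of_realizes hT
    exact h.trans (d.le_best hP)

theorem procedure_eq_none_iff (d : EdgeData) (σ : Equiv.Perm (Fin 3)) :
    (d.procedure σ).answer = none ↔ ¬ d.TrivialInequalities := by
  unfold procedure sortedProcedure
  split_ifs with h1 <;> simp [h1]

theorem isMaximum_of_mem_answer (hv : ∀ i, 0 < d.vert i) (he : ∀ i j, 0 < d.edge i j)
    {σ : Equiv.Perm (Fin 3)} (hσ : (d.relabel σ).IsSorted) {m : ℕ}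
    (h : (d.procedure σ).answer = some m) : d.IsMaximum m := by
  have ht : d.TrivialInequalities := by
    by_contra hc
    rw [(procedure_eq_none_iff d σ).2 hc] at h
    cases h
  unfold procedure at h
  rw [if_neg (not_not.2 ht)] at h
  split_ifs at h with h0 h1 h2
  · cases h
    exact isMaximum_of_vertexTest ht hv he (by decide) (by decide) (by decide) h0
  · cases h
    exact isMaximum_of_vertexTest ht hv he (by decide) (by decide) (by decide) h1
  · cases h
    exact isMaximum_of_vertexTest ht hv he (by decide) (by decide) (by decide) h2
  · have hn : ∀ i, ¬ (d.relabel σ).VertexTest i := fun i => by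
      rw [vertexTest_relabel]
      generalize σ i = j
      fin_cases j <;> assumption
    have he' : ∀ i j, 0 < (d.relabel σ).edge i j := fun i j => by rw [edge_relabel]; exact he _ _
    refine IsMaximum.of_relabel (σ := σ) ?_
    unfold sortedProcedure at h
    split_ifs at h with hb
    · cases h
      exact isMaximum_of_b_eq_zero (fun i => hv _) he' hn hb
    · cases h
      exact IsSearchCase.isMaximum ⟨ht.relabel σ, he', hn, hσ, hb⟩

theorem length_evaluated_procedure_lt (he : ∀ i j, 0 < d.edge i j)
    {σ : Equiv.Perm (Fin 3)} (hσ : (d.relabel σ).IsSorted) :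
    ((d.procedure σ).evaluated.length : ℝ) < 15 + 2 * √2 * (d.relabel σ).ratio := by
  have pos : (([] : List Params).length : ℝ) < 15 + 2 * √2 * (d.relabel σ).ratio := by
    have : 0 ≤ (d.relabel σ).ratio := by unfold ratio; positivity
    rw [List.length_nil, Nat.cast_zero]
    positivity
  unfold procedure sortedProcedure
  by_cases ht : d.TrivialInequalities
  swap
  · rw [if_pos ht]; exact pos
  rw [if_neg (not_not.2 ht)]
  split_ifs with h0 h1 h2 hb
  · exact pos
  · exact pos
  · exact pos
  · exact pos
  · exact IsSearchCase.length_evaluated_lt ⟨ht.relabel σ,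
      fun i j => by rw [edge_relabel]; exact he _ _, fun i => by
        rw [vertexTest_relabel]
        generalize σ i = j
        fin_cases j <;> assumption, hσ, hb⟩

end EdgeData

end

theorem theorem2 (f₁ f₂ f₃ f₁₂ f₁₃ f₂₃ : ℕ) (h₁ : 0 < f₁) (h₂ : 0 < f₂) (h₃ : 0 < f₃)
    (h₁₂ : 0 < f₁₂) (h₁₃ : 0 < f₁₃) (h₂₃ : 0 < f₂₃)
    (d : EdgeData) (hd : d = ⟨![f₁, f₂, f₃], ![f₂₃, f₁₃, f₁₂]⟩)
    (σ : Equiv.Perm (Fin 3)) (hσ : (d.relabel σ).IsSorted) :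
    -- the procedure reports that there is no complex exactly if a trivial inequality fails, and
    -- then there is indeed none
    ((d.procedure σ).answer = none ↔ ¬ (f₁₂ ≤ f₁ * f₂ ∧ f₁₃ ≤ f₁ * f₃ ∧ f₂₃ ≤ f₂ * f₃)) ∧
    ((d.procedure σ).answer = none → ∀ k, ¬ IsFlagVector f₁ f₂ f₃ f₁₂ f₁₃ f₂₃ k) ∧
    -- otherwise it computes the largest number of facets, which characterizes the flag f-vectors
    (∀ m, (d.procedure σ).answer = some m →
      IsGreatest (structuredFacetNumbers d) m ∧
      IsGreatest {k | IsFlagVector f₁ f₂ f₃ f₁₂ f₁₃ f₂₃ k} m ∧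
      ∀ k, IsFlagVector f₁ f₂ f₃ f₁₂ f₁₃ f₂₃ k ↔ k ≤ m) ∧
    -- the number of evaluated complexes, in terms of the relabeled (sorted) numbers of edges
    ((d.procedure σ).evaluated.length : ℝ) <
      15 + 2 * √2 * (√(((d.relabel σ).edge 0 1 : ℝ) * (d.relabel σ).edge 1 2) /
        (d.relabel σ).edge 0 2) := by
  have hf : ∀ k, IsFlagVector f₁ f₂ f₃ f₁₂ f₁₃ f₂₃ k ↔ d.Realizes k := fun k => by rw [hd]; rfl
  have hv : ∀ i, 0 < d.vert i := by
    rw [hd]; intro i; fin_cases i <;> assumption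
  have he : ∀ i j, 0 < d.edge i j := by
    have : ∀ l, 0 < d.opp l := by rw [hd]; intro l; fin_cases l <;> assumption
    exact fun i j => this _
  have ht : d.TrivialInequalities ↔ f₁₂ ≤ f₁ * f₂ ∧ f₁₃ ≤ f₁ * f₃ ∧ f₂₃ ≤ f₂ * f₃ := by
    rw [hd]
    refine ⟨fun h => ⟨h 0 1 (by decide), h 0 2 (by decide), h 1 2 (by decide)⟩, ?_⟩
    rintro ⟨a1, a2, a3⟩ i j hij
    fin_cases i <;> fin_cases j <;> first
      | exact absurd rfl hij
      | assumption
      | (rw [mul_comm]; assumption)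
  refine ⟨by rw [EdgeData.procedure_eq_none_iff, ht], fun h k hk => ?_, fun m hm => ?_,
    EdgeData.length_evaluated_procedure_lt he hσ⟩
  · refine (EdgeData.procedure_eq_none_iff d σ).1 h fun i j hij => ?_
    obtain ⟨k', h1, h2⟩ : ∃ k', i ≠ k' ∧ j ≠ k' := by clear * -; revert i j; decide
    exact (((hf k).1 hk).exists_feasible hij h1 h2).2
  · have ht' : d.TrivialInequalities := by
      by_contra hc
      rw [(EdgeData.procedure_eq_none_iff d σ).2 hc] at hm
      cases hm
    have max := EdgeData.isMaximum_of_mem_answer hv he hσ hm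
    have iff : ∀ k, IsFlagVector f₁ f₂ f₃ f₁₂ f₁₃ f₂₃ k ↔ k ≤ m := fun k => by
      rw [hf, max.realizes_iff ht']
    exact ⟨max.isGreatest_structured ht', ⟨(iff m).2 le_rfl, fun k hk => (iff k).1 hk⟩, iff⟩
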